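/- Let $\mathbb F$ be a field of characteristic zero, $I$ a finite set and $I_0\subseteq I$ a subset with $|I_0|>3$. For linearly independent vectors $\epsilon_i$ $(i\in I)$ put $BC_I=\{\pm\epsilon_i\}\cup\{\pm(\epsilon_i\pm\epsilon_j)\mid i,j\in I\}$ (so $0$ and $\pm2\epsilon_i$ belong to $BC_I$), and for a set $R$ of vectors put $R_{sdiv}=\{\alpha\in R\mid 2\alpha\notin R\}\cup\{0\}$ and $R^\times=R\setminus\{0\}$. Let $\mathcal L$ be a Lie algebra over $\mathbb F$ graded by $R=BC_I$ with grading pair $(\mathfrak g,\mathfrak h)$. This means: $\mathfrak h\subseteq\mathfrak g$ are subalgebras of $\mathcal L$ and $R\subseteq\mathfrak h^*$; with $\mathcal L_\alpha=\{x\in\mathcal L\mid [h,x]=\alpha(h)x \text{ for all } h\in\mathfrak h\}$ and $\mathfrak g_\alpha=\mathfrak g\cap\mathcal L_\alpha$ for $\alpha\in\mathfrak h^*$, the algebra $\mathfrak g$ is simple and locally finite (every finite subset generates a finite dimensional subalgebra), $\mathfrak g=\bigoplus_\alpha\mathfrak g_\alpha$, $\mathfrak g_0=\mathfrak h$ and $\{\alpha\mid\mathfrak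 g_\alpha\ne0\}=R_{sdiv}$; moreover $\mathcal L=\bigoplus_{\alpha\in R}\mathcal L_\alpha$ and $\mathcal L_0=\sum_{\alpha\in R^\times}[\mathcal L_\alpha,\mathcal L_{-\alpha}]$. Let $S=BC_{I_0}$ be the subsystem of $R$ built on the $\epsilon_i$ with $i\in I_0$, and put $$\mathcal L^S=\sum_{\alpha\in S^\times}\mathcal L_\alpha\oplus\sum_{\alpha\in S^\times}[\mathcal L_\alpha,\mathcal L_{-\alpha}],\qquad \mathfrak g^S=\sum_{\alpha\in S_{sdiv}^\times}\mathfrak g_\alpha\oplus\sum_{\alpha\in S_{sdiv}^\times}[\mathfrak g_\alpha,\mathfrak g_{-\alpha}].$$ For a finite set $K$ let $\mathfrak{sp}(K)$ be the Lie algebra of endomorphisms of the space $\mathcal V_K$ with basis $\{v_k,v_{\bar k}\mid k\in K\}$ that are skew-adjoint for the alternating form with $(v_j,v_{\bar k})=2\delta_{jk}$, $(v_j,v_k)=(v_{\bar j},v_{\bar k})=0$, and let $\mathcal S_K$ be the $\mathfrak{sp}(K)$-module, under the commutator, of the trace zero endomorphisms that are self-adjoint for this form. Put $\mathcal V=\mathcal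 V_I$, $\mathcal S=\mathcal S_I$, $\mathcal V^\ell=\mathcal V_{I_0}$, $\mathcal S^\ell=\mathcal S_{I_0}$. A $\mathfrak g^S$-module is said to be isomorphic to $\mathcal S^\ell$ or $\mathcal V^\ell$ if it is so through some isomorphism of Lie algebras $\mathfrak g^S\cong\mathfrak{sp}(I_0)$. Suppose that $$\mathcal L^S=\bigoplus_{i\in\mathcal I_0}\mathfrak g_i\oplus\bigoplus_{j\in\mathcal J_0}\mathfrak s_j\oplus\bigoplus_{t\in\mathcal T_0}V_t\oplus E$$ is a decomposition into $\mathfrak g^S$-submodules, with (possibly empty) index sets $\mathcal I_0,\mathcal J_0,\mathcal T_0$, in which $\mathfrak g_i\cong\mathfrak g^S$ (the adjoint module), $\mathfrak s_j\cong\mathcal S^\ell$, $V_t\cong\mathcal V^\ell$, and $E$ is a trivial module. Then there are an isomorphism of Lie algebras $\varphi:\mathfrak g\to\mathfrak{sp}(I)$, which maps each $h\in\mathfrak h$ to the endomorphism $v_i\mapsto\epsilon_i(h)v_i$, $v_{\bar i}\mapsto-\epsilon_i(h)v_{\bar i}$, index sets $\mathcal I\supseteq\mathcal I_0$, $\mathcal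 J\supseteq\mathcal J_0$, $\mathcal T\supseteq\mathcal T_0$, finite dimensional irreducible $\mathfrak g$-submodules $\mathcal G_i,\mathcal S_j,\mathcal V_t$ $(i\in\mathcal I,j\in\mathcal J,t\in\mathcal T)$ of $\mathcal L$ and a trivial $\mathfrak g$-submodule $\mathcal D_n$ of $\mathcal L$ such that - $\mathcal G_i\cong\mathfrak g$ (the adjoint module), and, through $\varphi$, $\mathcal S_j\cong\mathcal S$ and $\mathcal V_t\cong\mathcal V$ as $\mathfrak g$-modules, for all $i\in\mathcal I$, $j\in\mathcal J$, $t\in\mathcal T$; - for $i\in\mathcal I_0$, $j\in\mathcal J_0$, $t\in\mathcal T_0$, the submodule $\mathcal G_i$ contains $\mathfrak g_i$ and is the $\mathfrak g$-submodule of $\mathcal L$ generated by it, and likewise for $\mathfrak s_j\subseteq\mathcal S_j$ and $V_t\subseteq\mathcal V_t$; - $\mathcal L=\bigoplus_{i\in\mathcal I}\mathcal G_i\oplus\bigoplus_{j\in\mathcal J}\mathcal S_j\oplus\bigoplus_{t\in\mathcal T}\mathcal V_t\oplus\mathcal D_n$. -/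

import Mathlib

universe uF uL uI uA uB uC

/-! ### Root systems of type `BC` -/

/-- `{ε i - ε j}`; it contains `0`. -/
def rootsA {U I : Type*} [AddCommGroup U] (ε : I → U) : Set U :=
  {x | ∃ i j, x = ε i - ε j}

/-- The set `D_I`, built on the vectors `ε i`. -/
def rootsD {U I : Type*} [AddCommGroup U] (ε : I → U) : Set U :=
  rootsA ε ∪ {x | ∃ i j, i ≠ j ∧ (x = ε i + ε j ∨ x = -(ε i + ε j))}

/-- The set `B_I`, built on the vectors `ε i`. -/
def rootsB {U I : Type*} [AddCommGroup U] (ε : I → U) : Set U :=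
  rootsD ε ∪ {x | ∃ i, x = ε i ∨ x = -ε i}

/-- The set `C_I`, built on the vectors `ε i`. -/
def rootsC {U I : Type*} [AddCommGroup U] (ε : I → U) : Set U :=
  rootsD ε ∪ {x | ∃ i, x = (2 : ℕ) • ε i ∨ x = -((2 : ℕ) • ε i)}

/-- The set `BC_I = B_I ∪ C_I`, built on the vectors `ε i`. For linearly independent `ε` over a
field of characteristic zero it is the root system of type `BC_I` (with `0` counted as a root). -/
def rootsBC {U I : Type*} [AddCommGroup U] (ε : I → U) : Set U :=
  rootsB ε ∪ rootsC ε

/-- The semi-divisible subsystem `R_sdiv = (R \ {α ∈ R | 2α ∈ R}) ∪ {0}`. -/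
def semiDiv {U : Type*} [AddCommGroup U] (R : Set U) : Set U :=
  (R \ {α | α ∈ R ∧ (2 : ℕ) • α ∈ R}) ∪ {0}

/-! ### Root graded Lie algebras -/

/-- `𝓛_α = {x ∈ 𝓛 | [h, x] = α(h) x for all h ∈ 𝔥}`. -/
def rootSub {F L : Type*} [Field F] [LieRing L] [LieAlgebra F L] (𝔥 : LieSubalgebra F L)
    (α : Module.Dual F 𝔥) : Submodule F L where
  carrier := {x | ∀ h : 𝔥, ⁅(h : L), x⁆ = α h • x}
  add_mem' {x y} hx hy h := by rw [lie_add, hx h, hy h, smul_add]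
  zero_mem' h := by simp
  smul_mem' c x hx h := by rw [lie_smul, hx h, smul_comm]

/-- The span of all brackets `[x, y]` with `x ∈ A`, `y ∈ B`. -/
def bracketSpan {F L : Type*} [Field F] [LieRing L] [LieAlgebra F L] (A B : Submodule F L) :
    Submodule F L :=
  Submodule.span F {z | ∃ x ∈ A, ∃ y ∈ B, z = ⁅x, y⁆}

/-- `𝓛` is graded by `R` with grading pair `(𝔤, 𝔥)`, the set `R` being realised in the dual
of `𝔥`. Sums of the spaces `rootSub 𝔥 α` over distinct `α` are automatically direct. -/
structure IsRootGraded {F L : Type*} [Field F] [LieRing L] [LieAlgebra F L]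
    (𝔤 𝔥 : LieSubalgebra F L) (R : Set (Module.Dual F 𝔥)) : Prop where
  /-- `𝔤` is locally finite: finite subsets generate finite dimensional subalgebras. -/
  locallyFinite : ∀ s : Set L, s.Finite → s ⊆ 𝔤 →
    FiniteDimensional F (LieSubalgebra.lieSpan F L s)
  simple : LieAlgebra.IsSimple F 𝔤
  le : 𝔥 ≤ 𝔤
  /-- `𝔤` is the sum of its root spaces `𝔤_α = 𝔤 ∩ 𝓛_α`. -/
  iSup_rootSub_sub : ⨆ α : Module.Dual F 𝔥, 𝔤.toSubmodule ⊓ rootSub 𝔥 α = 𝔤.toSubmodule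
  /-- The root system of `𝔤` with respect to `𝔥` is `R_sdiv`. -/
  roots_sub : {α : Module.Dual F 𝔥 | 𝔤.toSubmodule ⊓ rootSub 𝔥 α ≠ ⊥} = semiDiv R
  /-- `𝔥` is a splitting Cartan subalgebra of `𝔤`: `𝔤_0 = 𝔥`. -/
  rootSub_zero_sub : 𝔤.toSubmodule ⊓ rootSub 𝔥 0 = 𝔥.toSubmodule
  /-- `𝓛` is the sum of its weight spaces, -/
  iSup_rootSub : ⨆ α : Module.Dual F 𝔥, rootSub 𝔥 α = ⊤
  /-- whose weights belong to `R`. -/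
  weights_mem : ∀ α : Module.Dual F 𝔥, rootSub 𝔥 α ≠ ⊥ → α ∈ R
  /-- `𝓛_0 = ∑_{α ∈ R, α ≠ 0} [𝓛_α, 𝓛_{-α}]`. -/
  rootSub_zero : rootSub 𝔥 0 =
    ⨆ α ∈ R \ {0}, bracketSpan (rootSub 𝔥 α) (rootSub 𝔥 (-α))

/-- For a subalgebra `𝔨` and a set `S` of weights, with `𝔨_α = 𝔨 ∩ 𝓛_α`, the subspace
`∑_{α ∈ S, α ≠ 0} 𝔨_α + ∑_{α ∈ S, α ≠ 0} [𝔨_α, 𝔨_{-α}]`. -/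
def subsystemSpace {F L : Type*} [Field F] [LieRing L] [LieAlgebra F L]
    (𝔨 𝔥 : LieSubalgebra F L) (S : Set (Module.Dual F 𝔥)) : Submodule F L :=
  (⨆ α ∈ S \ {0}, 𝔨.toSubmodule ⊓ rootSub 𝔥 α) ⊔
    ⨆ α ∈ S \ {0}, bracketSpan (𝔨.toSubmodule ⊓ rootSub 𝔥 α) (𝔨.toSubmodule ⊓ rootSub 𝔥 (-α))

/-- The space `𝓛^S`. -/
def gradedPart {F L : Type*} [Field F] [LieRing L] [LieAlgebra F L]
    (𝔥 : LieSubalgebra F L) (S : Set (Module.Dual F 𝔥)) : Submodule F L :=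
  subsystemSpace ⊤ 𝔥 S

/-- The Lie subalgebra `𝔤^S = ∑ 𝔤_α + ∑ [𝔤_α, 𝔤_{-α}]`, the sums running over the nonzero
`α ∈ S_sdiv`. It is written as the Lie subalgebra generated by this subspace; the subspace is
already closed under the bracket when `S` is the subsystem of type `BC` on a subset of the index
set, see `gradingSub_toSubmodule`. -/
def gradingSub {F L : Type*} [Field F] [LieRing L] [LieAlgebra F L]
    (𝔤 𝔥 : LieSubalgebra F L) (S : Set (Module.Dual F 𝔥)) : LieSubalgebra F L :=
  LieSubalgebra.lieSpan F L (subsystemSpace 𝔤 𝔥 (semiDiv S) : Set L)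

/-! ### Why `gradingSub` adds nothing to the sum of spaces that generates it -/

theorem lie_mem_rootSub {F L : Type*} [Field F] [LieRing L] [LieAlgebra F L]
    {𝔥 : LieSubalgebra F L} {α β : Module.Dual F 𝔥} {x y : L} (hx : x ∈ rootSub 𝔥 α)
    (hy : y ∈ rootSub 𝔥 β) : ⁅x, y⁆ ∈ rootSub 𝔥 (α + β) := by
  intro h
  rw [leibniz_lie, hx h, hy h, smul_lie, lie_smul, ← add_smul]
  rfl

theorem subsystemSpace_lie_mem {F L : Type*} [Field F] [LieRing L] [LieAlgebra F L]
    (𝔨 𝔥 : LieSubalgebra F L) (P : Set (Module.Dual F 𝔥))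
    (hP : ∀ α ∈ P \ {0}, ∀ β ∈ P \ {0}, α + β ≠ 0 → 𝔨.toSubmodule ⊓ rootSub 𝔥 (α + β) ≠ ⊥ →
      α + β ∈ P) {x y : L} (hx : x ∈ subsystemSpace 𝔨 𝔥 P) (hy : y ∈ subsystemSpace 𝔨 𝔥 P) :
    ⁅x, y⁆ ∈ subsystemSpace 𝔨 𝔥 P := by
  -- a spanning set
  set X : Set L := {z | ∃ α ∈ P \ {0}, z ∈ 𝔨.toSubmodule ⊓ rootSub 𝔥 α} with hX
  set Y : Set L := {z | ∃ α ∈ P \ {0}, ∃ x ∈ 𝔨.toSubmodule ⊓ rootSub 𝔥 α,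
    ∃ y ∈ 𝔨.toSubmodule ⊓ rootSub 𝔥 (-α), z = ⁅x, y⁆} with hY
  have hspan : subsystemSpace 𝔨 𝔥 P = Submodule.span F (X ∪ Y) := by
    apply le_antisymm
    · refine sup_le (iSup₂_le fun α hα z hz => Submodule.subset_span (Or.inl ⟨α, hα, hz⟩))
        (iSup₂_le fun α hα => Submodule.span_mono ?_)
      rintro z ⟨x, hx, y, hy, rfl⟩
      exact Or.inr ⟨α, hα, x, hx, y, hy, rfl⟩
    · rw [Submodule.span_le]
      rintro z (⟨α, hα, hz⟩ | ⟨α, hα, x, hx, y, hy, rfl⟩)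
      · exact (le_sup_left : _ ≤ subsystemSpace 𝔨 𝔥 P)
          (Submodule.mem_iSup_of_mem α (Submodule.mem_iSup_of_mem hα hz))
      · exact (le_sup_right : _ ≤ subsystemSpace 𝔨 𝔥 P)
          (Submodule.mem_iSup_of_mem α (Submodule.mem_iSup_of_mem hα
            (Submodule.subset_span ⟨x, hx, y, hy, rfl⟩)))
  have key {α β : Module.Dual F 𝔥} {a b : L} (ha : a ∈ 𝔨.toSubmodule ⊓ rootSub 𝔥 α)
      (hb : b ∈ 𝔨.toSubmodule ⊓ rootSub 𝔥 β) : ⁅a, b⁆ ∈ 𝔨.toSubmodule ⊓ rootSub 𝔥 (α + β) :=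
    ⟨𝔨.lie_mem ha.1 hb.1, lie_mem_rootSub ha.2 hb.2⟩
  have hXX : ∀ a ∈ X, ∀ b ∈ X, ⁅a, b⁆ ∈ Submodule.span F (X ∪ Y) := by
    rintro a ⟨α, hα, ha⟩ b ⟨β, hβ, hb⟩
    by_cases h0 : α + β = 0
    · obtain rfl : β = -α := (neg_eq_of_add_eq_zero_right h0).symm
      exact Submodule.subset_span (Or.inr ⟨α, hα, a, ha, b, hb, rfl⟩)
    · by_cases hbot : 𝔨.toSubmodule ⊓ rootSub 𝔥 (α + β) = ⊥
      · have h := key ha hb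
        rw [hbot, Submodule.mem_bot] at h
        rw [h]
        exact zero_mem _
      · exact Submodule.subset_span (Or.inl ⟨_, ⟨hP α hα β hβ h0 hbot, h0⟩, key ha hb⟩)
  have hYZ : ∀ a ∈ Y, a ∈ 𝔨.toSubmodule ⊓ rootSub 𝔥 0 := by
    rintro a ⟨α, hα, x, hx, y, hy, rfl⟩
    have h := key hx hy
    rwa [add_neg_cancel] at h
  have hZX : ∀ a ∈ 𝔨.toSubmodule ⊓ rootSub 𝔥 0, ∀ b ∈ X, ⁅a, b⁆ ∈ X := by
    rintro a ha b ⟨β, hβ, hb⟩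
    have h := key ha hb
    rw [zero_add] at h
    exact ⟨β, hβ, h⟩
  have hZY : ∀ a ∈ 𝔨.toSubmodule ⊓ rootSub 𝔥 0, ∀ b ∈ Y,
      ⁅a, b⁆ ∈ Submodule.span F (X ∪ Y) := by
    rintro a ha b ⟨β, hβ, x, hx, y, hy, rfl⟩
    rw [leibniz_lie]
    have h1 := key ha hx
    have h2 := key ha hy
    rw [zero_add] at h1 h2
    exact add_mem (Submodule.subset_span (Or.inr ⟨β, hβ, _, h1, y, hy, rfl⟩))
      (Submodule.subset_span (Or.inr ⟨β, hβ, x, hx, _, h2, rfl⟩))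
  rw [hspan] at hx hy ⊢
  refine Submodule.span_induction₂ (p := fun x y _ _ => ⁅x, y⁆ ∈ Submodule.span F (X ∪ Y))
    ?_ (fun y _ => by simp) (fun x _ => by simp)
    (fun x y z _ _ _ h1 h2 => by rw [add_lie]; exact add_mem h1 h2)
    (fun x y z _ _ _ h1 h2 => by rw [lie_add]; exact add_mem h1 h2)
    (fun r x y _ _ h => by rw [smul_lie]; exact Submodule.smul_mem _ _ h)
    (fun r x y _ _ h => by rw [lie_smul]; exact Submodule.smul_mem _ _ h) hx hy
  rintro a b (ha | ha) (hb | hb)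
  · exact hXX a ha b hb
  · rw [← lie_skew]
    exact neg_mem (Submodule.subset_span (Or.inl (hZX b (hYZ b hb) a ha)))
  · exact Submodule.subset_span (Or.inl (hZX a (hYZ a ha) b hb))
  · exact hZY a (hYZ a ha) b hb

/-- The roots of type `BC_{I₀}` are the roots of type `BC_I` in the span of the `ε i`, `i ∈ I₀`. -/
theorem mem_rootsBC_of_mem_span {F U I : Type*} [Field F] [CharZero F] [AddCommGroup U]
    [Module F U] {ε : I → U} (hε : LinearIndependent F ε) {I₀ : Finset I} (hI₀ : I₀.Nonempty)
    {x : U} (hx : x ∈ rootsBC ε) (hxs : x ∈ Submodule.span F (ε '' I₀)) :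
    x ∈ rootsBC (fun i : I₀ => ε i) := by
  classical
  have hcoef : ∀ c : I →₀ F, x = Finsupp.linearCombination F ε c → ∀ i, c i ≠ 0 → i ∈ I₀ := by
    intro c hc i hi
    obtain ⟨d, hd, hdx⟩ := (Finsupp.mem_span_image_iff_linearCombination F).1 hxs
    have : c = d := hε (by rw [← hc, hdx])
    subst this
    by_contra hn
    exact hi (by simpa using (Finsupp.mem_supported' F c).1 hd i hn)
  have one (i : I) (r : F) (hr : r ≠ 0) (h : x = r • ε i) : i ∈ I₀ :=
    hcoef (Finsupp.single i r) (by simp [h]) i (by simpa using hr)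
  have two (i j : I) (r t : F) (hij : i ≠ j) (hr : r ≠ 0) (ht : t ≠ 0)
      (h : x = r • ε i + t • ε j) : i ∈ I₀ ∧ j ∈ I₀ := by
    have h' : x = Finsupp.linearCombination F ε (Finsupp.single i r + Finsupp.single j t) := by
      simp [h]
    exact ⟨hcoef _ h' i (by simp [hij.symm, hr]), hcoef _ h' j (by simp [hij, ht])⟩
  have hA : x ∈ rootsA ε → x ∈ rootsA (fun i : I₀ => ε i) := by
    rintro ⟨i, j, h⟩
    by_cases hij : i = j
    · obtain ⟨k, hk⟩ := hI₀
      exact ⟨⟨k, hk⟩, ⟨k, hk⟩, by simp [h, hij]⟩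
    · obtain ⟨h1, h2⟩ := two i j 1 (-1) hij (by simp) (by simp) (by simp [h, sub_eq_add_neg])
      exact ⟨⟨i, h1⟩, ⟨j, h2⟩, h⟩
  have hD : x ∈ rootsD ε → x ∈ rootsD (fun i : I₀ => ε i) := by
    rintro (h | ⟨i, j, hij, h⟩)
    · exact Or.inl (hA h)
    · have h12 : i ∈ I₀ ∧ j ∈ I₀ := by
        rcases h with h | h
        · exact two i j 1 1 hij (by simp) (by simp) (by simp [h])
        · exact two i j (-1) (-1) hij (by simp) (by simp) (by rw [h]; module)
      exact Or.inr ⟨⟨i, h12.1⟩, ⟨j, h12.2⟩, fun e => hij (congrArg Subtype.val e), h⟩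
  rcases hx with (h | ⟨i, h⟩) | (h | ⟨i, h⟩)
  · exact Or.inl (Or.inl (hD h))
  · have h1 : i ∈ I₀ := by
      rcases h with h | h
      · exact one i 1 (by simp) (by simp [h])
      · exact one i (-1) (by simp) (by simp [h])
    exact Or.inl (Or.inr ⟨⟨i, h1⟩, h⟩)
  · exact Or.inl (Or.inl (hD h))
  · have h1 : i ∈ I₀ := by
      rcases h with h | h
      · exact one i 2 (by simp) (by rw [h]; module)
      · exact one i (-2) (by simp) (by rw [h]; module)
    exact Or.inr (Or.inr ⟨⟨i, h1⟩, h⟩)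

theorem mem_rootsBC_of_subset {F U I : Type*} [Field F] [AddCommGroup U] [Module F U] {ε : I → U}
    {I₀ : Finset I} {x : U} (hx : x ∈ rootsBC (fun i : I₀ => ε i)) :
    x ∈ rootsBC ε ∧ x ∈ Submodule.span F (ε '' I₀) := by
  have hm (i : I₀) : ε i ∈ Submodule.span F (ε '' I₀) :=
    Submodule.subset_span ⟨i, i.2, rfl⟩
  have hD : x ∈ rootsD (fun i : I₀ => ε i) →
      x ∈ rootsD ε ∧ x ∈ Submodule.span F (ε '' I₀) := by
    rintro (⟨i, j, rfl⟩ | ⟨i, j, hij, h⟩)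
    · exact ⟨Or.inl ⟨i, j, rfl⟩, sub_mem (hm i) (hm j)⟩
    · refine ⟨Or.inr ⟨i, j, fun e => hij (Subtype.ext e), h⟩, ?_⟩
      rcases h with rfl | rfl
      · exact add_mem (hm i) (hm j)
      · exact neg_mem (add_mem (hm i) (hm j))
  rcases hx with (h | ⟨i, h⟩) | (h | ⟨i, h⟩)
  · exact ⟨Or.inl (Or.inl (hD h).1), (hD h).2⟩
  · refine ⟨Or.inl (Or.inr ⟨i, h⟩), ?_⟩
    rcases h with rfl | rfl
    · exact hm i
    · exact neg_mem (hm i)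
  · exact ⟨Or.inl (Or.inl (hD h).1), (hD h).2⟩
  · refine ⟨Or.inr (Or.inr ⟨i, h⟩), ?_⟩
    rcases h with rfl | rfl
    · exact Submodule.smul_of_tower_mem _ 2 (hm i)
    · exact neg_mem (Submodule.smul_of_tower_mem _ 2 (hm i))

theorem gradingSub_toSubmodule {F L I : Type*} [Field F] [CharZero F] [LieRing L]
    [LieAlgebra F L] (I₀ : Finset I) (hI₀ : I₀.Nonempty) (𝔤 𝔥 : LieSubalgebra F L)
    (ε : I → Module.Dual F 𝔥) (hε : LinearIndependent F ε)
    (hL : IsRootGraded 𝔤 𝔥 (rootsBC ε)) :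
    (gradingSub 𝔤 𝔥 (rootsBC (fun i : I₀ => ε i))).toSubmodule =
      subsystemSpace 𝔤 𝔥 (semiDiv (rootsBC (fun i : I₀ => ε i))) := by
  have hS {α : Module.Dual F 𝔥} (hα : α ∈ semiDiv (rootsBC (fun i : I₀ => ε i)) \ {0}) :
      α ∈ rootsBC (fun i : I₀ => ε i) := by
    rcases hα with ⟨h | h, h0⟩
    · exact h.1
    · exact absurd h h0
  let K : LieSubalgebra F L :=
    { subsystemSpace 𝔤 𝔥 (semiDiv (rootsBC (fun i : I₀ => ε i))) with
      lie_mem' := by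
        intro x y hx hy
        refine subsystemSpace_lie_mem 𝔤 𝔥 _ ?_ hx hy
        intro α hα β hβ h0 hbot
        have hR : α + β ∈ semiDiv (rootsBC ε) := by
          rw [← hL.roots_sub]; exact hbot
        rcases hR with ⟨h1, h2⟩ | h1
        · have hmem := mem_rootsBC_of_mem_span hε hI₀ h1
            (add_mem (mem_rootsBC_of_subset (F := F) (hS hα)).2
              (mem_rootsBC_of_subset (F := F) (hS hβ)).2)
          exact Or.inl ⟨hmem, fun h => h2 ⟨h1, (mem_rootsBC_of_subset (F := F) h.2).1⟩⟩
        · exact absurd h1 h0 }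
  apply le_antisymm
  · exact (LieSubalgebra.lieSpan_le (K := K)).2 (fun x hx => hx)
  · exact LieSubalgebra.subset_lieSpan

/-! ### The modules `𝒮` and `𝒱` of `𝔰𝔭`

Mathlib's `LieAlgebra.Symplectic.sp ι F` consists of the matrices, with rows and columns indexed by
`ι ⊕ ι`, that are skew-adjoint for the alternating form with matrix `Matrix.J ι F`. A nonzero
multiple of a form has the same adjoints. For a subset `I₀` of `I`, the algebras and modules on
`I₀` are taken on the index type `I₀` itself. -/

/-- `𝒮`: the trace zero matrices that are self-adjoint for the alternating form. -/
def spS (ι F : Type*) [Fintype ι] [DecidableEq ι] [Field F] :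
    Submodule F (Matrix (ι ⊕ ι) (ι ⊕ ι) F) :=
  selfAdjointMatricesSubmodule (Matrix.J ι F) ⊓
    LinearMap.ker (Matrix.traceLinearMap (ι ⊕ ι) F F)

/-- The `𝔨`-module `N` is isomorphic to `𝒮`, on which `𝔰𝔭` acts by the commutator, when `𝔨` is
identified with `𝔰𝔭` through `φ`. -/
def IsIsoS {F L ι : Type*} [Field F] [LieRing L] [LieAlgebra F L] [Fintype ι] [DecidableEq ι]
    {𝔨 : LieSubalgebra F L} (φ : 𝔨 ≃ₗ⁅F⁆ LieAlgebra.Symplectic.sp ι F)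
    (N : LieSubmodule F 𝔨 L) : Prop :=
  ∃ f : N ≃ₗ[F] spS ι F, ∀ (x : 𝔨) (m : N),
    (f ⁅x, m⁆ : Matrix (ι ⊕ ι) (ι ⊕ ι) F) =
      ⁅(φ x : Matrix (ι ⊕ ι) (ι ⊕ ι) F), (f m : Matrix (ι ⊕ ι) (ι ⊕ ι) F)⁆

/-- The `𝔨`-module `N` is isomorphic to the natural module `𝒱` of column vectors of `𝔰𝔭`, when
`𝔨` is identified with `𝔰𝔭` through `φ`. -/
def IsIsoV {F L ι : Type*} [Field F] [LieRing L] [LieAlgebra F L] [Fintype ι] [DecidableEq ι]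
    {𝔨 : LieSubalgebra F L} (φ : 𝔨 ≃ₗ⁅F⁆ LieAlgebra.Symplectic.sp ι F)
    (N : LieSubmodule F 𝔨 L) : Prop :=
  ∃ f : N ≃ₗ[F] (ι ⊕ ι → F), ∀ (x : 𝔨) (m : N),
    f ⁅x, m⁆ = Matrix.mulVec (φ x : Matrix (ι ⊕ ι) (ι ⊕ ι) F) (f m)

/-- `W = ⨁ A_a ⊕ ⨁ B_b ⊕ ⨁ C_c ⊕ E`, an internal direct sum of `𝔨`-submodules. -/
def IsDirectDecomp {F L A B C : Type*} [Field F] [LieRing L] [LieAlgebra F L]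
    {𝔨 : LieSubalgebra F L} (W : Submodule F L) (a : A → LieSubmodule F 𝔨 L)
    (b : B → LieSubmodule F 𝔨 L) (c : C → LieSubmodule F 𝔨 L) (e : LieSubmodule F 𝔨 L) : Prop :=
  iSupIndep (Sum.elim a (Sum.elim b (Sum.elim c fun _ : Unit => e))) ∧
    (⨆ k, Sum.elim a (Sum.elim b (Sum.elim c fun _ : Unit => e)) k).toSubmodule = W

/-! In the coordinates given by the `ε i`, the weights of `L` are the integer vectors of ℓ¹-norm at
most 2 and the roots of `𝔤` are those of norm 0 or 2, so statements about roots become statements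
about small integer vectors.

The identification of `𝔤` with `sp` comes from a uniqueness theorem: a simple Lie algebra with a
self-centralising torus and roots of type C is determined, together with its torus
(`IsTypeC.exists_equiv`), and both algebras are of this kind (`IsRootGraded.isTypeC`,
`isTypeC_spTorus`). Strings of root vectors yield the coroots and one dimensional root spaces; the
isomorphism is the subalgebra of the product generated by pairs of corresponding root vectors. It
carries `𝔤^S` to the standard copy of `sp I₀` in `sp I` (`exists_equiv_gradingSub`).

Since `L` may be infinite dimensional, the decomposition is obtained from the Casimir operator.
Every nonzero submodule contains a highest weight vector. The nonzero dominant weights of norm at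
most 2 are `2ε₁`, `ε₁ + ε₂` and `ε₁`; they belong to the adjoint module, to `𝒮` and to `𝒱`, and the
Casimir operator takes distinct positive values on them (`IsDom.casEig_injective`) and 0 on
invariants. Hence a highest weight vector of such a weight generates an irreducible module
determined by the weight, and linearly independent highest weight vectors generate independent
modules, independent also from the kernel of the Casimir operator (`iSupIndep_lieSpan`).

Choose the positive system so that `ε₁` and `ε₂` belong to `I₀`. Each given nontrivial summand is
generated by a highest weight vector for `sp I₀`. This vector is a highest weight vector for `sp I`
as well (`IsHW.of_comp`): the only positive root that can be added to one of the three weights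
without leaving BC is `ε₁ - ε₂`, and it belongs to `I₀`. So the summand generates an irreducible
`𝔤`-module of the same type. The modules so obtained contain the nonzero weight spaces of `L^S`, and
therefore all nonzero weight spaces of `L`, because root vectors move any weight into the span of
`I₀` and back (`wtSpace_le_of_support`). The complement is the kernel of the Casimir operator, where
`𝔤` acts trivially. No summands beyond those generated by the given ones are needed. -/

set_option linter.unusedSectionVars false

/-! ### Integral weights -/

section Weights

variable {F ι : Type*} [Field F] [Fintype ι]

/-- The value of the integral weight `μ` at the point `c`. -/
def wtEval (μ : ι → ℤ) (c : ι → F) : F := ∑ i, (μ i : F) * c i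

theorem wtEval_add (μ ν : ι → ℤ) (c : ι → F) : wtEval (μ + ν) c = wtEval μ c + wtEval ν c := by
  simp [wtEval, add_mul, Finset.sum_add_distrib]

theorem wtEval_neg (μ : ι → ℤ) (c : ι → F) : wtEval (-μ) c = -wtEval μ c := by
  simp [wtEval]

theorem wtEval_neg_right (μ : ι → ℤ) (c : ι → F) : wtEval μ (-c) = -wtEval μ c := by
  simp [wtEval]

theorem wtEval_sub (μ ν : ι → ℤ) (c : ι → F) : wtEval (μ - ν) c = wtEval μ c - wtEval ν c := by
  rw [sub_eq_add_neg, wtEval_add, wtEval_neg, sub_eq_add_neg]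

theorem wtEval_add_right (μ : ι → ℤ) (c d : ι → F) :
    wtEval μ (c + d) = wtEval μ c + wtEval μ d := by
  simp [wtEval, mul_add, Finset.sum_add_distrib]

theorem wtEval_sub_right (μ : ι → ℤ) (c d : ι → F) :
    wtEval μ (c - d) = wtEval μ c - wtEval μ d := by
  rw [sub_eq_add_neg, wtEval_add_right, wtEval_neg_right, sub_eq_add_neg]

theorem wtEval_smul_right (μ : ι → ℤ) (r : F) (c : ι → F) :
    wtEval μ (r • c) = r * wtEval μ c := by
  simp [wtEval, Finset.mul_sum, mul_left_comm]

theorem wtEval_zero (c : ι → F) : wtEval (0 : ι → ℤ) c = 0 := by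
  simp [wtEval]

theorem wtEval_nsmul (n : ℕ) (μ : ι → ℤ) (c : ι → F) : wtEval (n • μ) c = n * wtEval μ c := by
  simp [wtEval, Finset.mul_sum, mul_assoc]

variable [DecidableEq ι]

theorem wtEval_single_left (i : ι) (a : ℤ) (c : ι → F) : wtEval (Pi.single i a) c = a * c i := by
  rw [wtEval, Finset.sum_eq_single i] <;> simp +contextual

theorem wtEval_single_right (μ : ι → ℤ) (i : ι) (r : F) : wtEval μ (Pi.single i r) = μ i * r := by
  rw [wtEval, Finset.sum_eq_single i] <;> simp +contextual

/-- In characteristic zero distinct integral weights already differ at a basis vector. The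
independence of weight spaces rests on such separating points. -/
theorem exists_wtEval_ne [CharZero F] {μ ν : ι → ℤ} (h : μ ≠ ν) :
    ∃ c : ι → F, wtEval μ c ≠ wtEval ν c := by
  obtain ⟨i, hi⟩ := Function.ne_iff.1 h
  exact ⟨Pi.single i 1, by simpa [wtEval_single_right] using hi⟩

end Weights

/-! ### Weight spaces -/

section WeightSpaces

variable {F ι K M : Type*} [Field F] [Fintype ι] [LieRing K] [LieAlgebra F K]
  [AddCommGroup M] [Module F M] [LieRingModule K M] [LieModule F K M]

/-- The weight space of weight `μ`, for the torus parametrised by `η`. -/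
def wtSpace (η : (ι → F) →ₗ[F] K) (M : Type*) [AddCommGroup M] [Module F M] [LieRingModule K M]
    [LieModule F K M] (μ : ι → ℤ) : Submodule F M where
  carrier := {m | ∀ c, ⁅η c, m⁆ = wtEval μ c • m}
  add_mem' {x y} hx hy c := by rw [lie_add, hx c, hy c, smul_add]
  zero_mem' c := by simp
  smul_mem' r x hx c := by rw [lie_smul, hx c, smul_comm]

variable {η : (ι → F) →ₗ[F] K}

theorem mem_wtSpace {μ : ι → ℤ} {m : M} :
    m ∈ wtSpace η M μ ↔ ∀ c, ⁅η c, m⁆ = wtEval μ c • m := Iff.rfl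

theorem lie_mem_wtSpace {μ ν : ι → ℤ} {x : K} {m : M} (hx : x ∈ wtSpace η K μ)
    (hm : m ∈ wtSpace η M ν) : ⁅x, m⁆ ∈ wtSpace η M (μ + ν) := by
  intro c
  rw [leibniz_lie, hx c, hm c, smul_lie, lie_smul, ← add_smul, wtEval_add]

theorem lie_mem_wtSpace' {μ ν κ : ι → ℤ} {x : K} {m : M} (hx : x ∈ wtSpace η K μ)
    (hm : m ∈ wtSpace η M ν) (h : μ + ν = κ) : ⁅x, m⁆ ∈ wtSpace η M κ :=
  h ▸ lie_mem_wtSpace hx hm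

theorem iterate_lie_mem_wtSpace {μ ν : ι → ℤ} {x : K} {m : M} (hx : x ∈ wtSpace η K μ)
    (hm : m ∈ wtSpace η M ν) (n : ℕ) :
    (fun y : M => ⁅x, y⁆)^[n] m ∈ wtSpace η M (ν + n • μ) := by
  induction n with
  | zero => simpa using hm
  | succ n ih =>
    rw [Function.iterate_succ_apply']
    exact lie_mem_wtSpace' hx ih (by rw [succ_nsmul]; abel)

/-- Components with respect to distinct weights of an element of a stable subspace belong to
that subspace. -/
theorem wtComponent_mem [CharZero F] (N : Submodule F M) (hN : ∀ c, ∀ m ∈ N, ⁅η c, m⁆ ∈ N)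
    (s : Finset (ι → ℤ)) : ∀ (x : (ι → ℤ) → M), (∀ μ ∈ s, x μ ∈ wtSpace η M μ) →
    ∑ μ ∈ s, x μ ∈ N → ∀ μ ∈ s, x μ ∈ N := by
  classical
  induction s using Finset.induction_on with
  | empty => simp
  | insert ν s hν ih =>
    intro x hx hsum
    have hs : ∀ μ ∈ s, x μ ∈ N := by
      intro μ hμ
      obtain ⟨c, hc⟩ := exists_wtEval_ne (F := F) (show μ ≠ ν by rintro rfl; exact hν hμ)
      -- Acting with `η c` and subtracting `wtEval ν c` times the sum kills the component of weight
      -- `ν` and multiplies that of weight `μ` by a nonzero scalar; the induction hypothesis applies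
      -- to the shorter sum.
      have h1 : ∑ κ ∈ s, (wtEval κ c - wtEval ν c) • x κ ∈ N := by
        have h2 := N.sub_mem (hN c _ hsum) (N.smul_mem (wtEval ν c) hsum)
        rw [lie_sum, Finset.smul_sum, ← Finset.sum_sub_distrib, Finset.sum_insert hν,
          hx ν (Finset.mem_insert_self _ _) c, sub_self, zero_add] at h2
        convert h2 using 1
        refine Finset.sum_congr rfl fun κ hκ => ?_
        rw [hx κ (Finset.mem_insert_of_mem hκ) c, sub_smul]
      have h3 := ih (fun κ => (wtEval κ c - wtEval ν c) • x κ)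
        (fun κ hκ => Submodule.smul_mem _ _ (hx κ (Finset.mem_insert_of_mem hκ))) h1 μ hμ
      exact (N.smul_mem_iff (sub_ne_zero.2 hc)).1 h3
    intro μ hμ
    rcases Finset.mem_insert.1 hμ with rfl | h
    · rw [Finset.sum_insert hν] at hsum
      exact (N.add_mem_iff_left (N.sum_mem hs)).1 hsum
    · exact hs μ h

/-- `M` is the sum of its weight spaces, with weights in `S`. -/
def IsWeightedBy (η : (ι → F) →ₗ[F] K) (M : Type*) [AddCommGroup M] [Module F M]
    [LieRingModule K M] [LieModule F K M] (S : Finset (ι → ℤ)) : Prop :=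
  ∀ m : M, m ∈ ⨆ μ ∈ S, wtSpace η M μ

theorem IsWeightedBy.exists_sum {S : Finset (ι → ℤ)} (h : IsWeightedBy η M S) (m : M) :
    ∃ x : (ι → ℤ) → M, (∀ μ, x μ ∈ wtSpace η M μ) ∧ ∑ μ ∈ S, x μ = m := by
  obtain ⟨x, hx⟩ := (Submodule.mem_iSup_finset_iff_exists_sum _ _).1 (h m)
  exact ⟨fun μ => x μ, fun μ => (x μ).2, hx⟩

theorem mem_iSup_wtSpace {S : Finset (ι → ℤ)} {μ : ι → ℤ} (hμ : μ ∈ S) {m : M}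
    (hm : m ∈ wtSpace η M μ) : m ∈ ⨆ μ ∈ S, wtSpace η M μ :=
  Submodule.mem_iSup_of_mem μ (Submodule.mem_iSup_of_mem hμ hm)

/-- A subspace containing all weight spaces contains everything. -/
theorem IsWeightedBy.mem_of_forall {S : Finset (ι → ℤ)} (h : IsWeightedBy η M S)
    (N : Submodule F M) (hN : ∀ μ ∈ S, ∀ m ∈ wtSpace η M μ, m ∈ N) (m : M) : m ∈ N := by
  have : ⨆ μ ∈ S, wtSpace η M μ ≤ N := iSup₂_le hN
  exact this (h m)

theorem sum_wt_eq_zero [CharZero F] {s : Finset (ι → ℤ)} {x : (ι → ℤ) → M}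
    (hx : ∀ μ ∈ s, x μ ∈ wtSpace η M μ) (h : ∑ μ ∈ s, x μ = 0) : ∀ μ ∈ s, x μ = 0 := by
  have := wtComponent_mem (η := η) (⊥ : Submodule F M)
    (fun c m hm => by rw [(Submodule.mem_bot F).1 hm]; simp) s x hx (by simpa using h)
  simpa using this

theorem eq_zero_of_mem_wtSpace_of_mem_iSup [CharZero F] {μ : ι → ℤ} {s : Finset (ι → ℤ)}
    (hμ : μ ∉ s) {m : M} (hm : m ∈ wtSpace η M μ) (h : m ∈ ⨆ ν ∈ s, wtSpace η M ν) : m = 0 := by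
  classical
  obtain ⟨x, hx⟩ := (Submodule.mem_iSup_finset_iff_exists_sum _ _).1 h
  let y : (ι → ℤ) → M := fun ν => if ν = μ then -m else x ν
  have hs : ∑ ν ∈ s, y ν = m := by
    rw [← hx]
    refine Finset.sum_congr rfl fun ν hν => if_neg ?_
    rintro rfl
    exact hμ hν
  have := sum_wt_eq_zero (η := η) (s := insert μ s) (x := y) (fun ν _ => ?_) ?_ μ
    (Finset.mem_insert_self _ _)
  · simpa [y] using this
  · by_cases hν : ν = μ
    · subst hν
      simpa [y] using hm
    · simp [y, hν]
  · rw [Finset.sum_insert hμ, hs]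
    simp [y]

theorem IsWeightedBy.eq_zero [CharZero F] {S : Finset (ι → ℤ)} (h : IsWeightedBy η M S)
    {μ : ι → ℤ} (hμ : μ ∉ S) {m : M} (hm : m ∈ wtSpace η M μ) : m = 0 :=
  eq_zero_of_mem_wtSpace_of_mem_iSup hμ hm (h m)

theorem IsWeightedBy.mem_of_ne_zero [CharZero F] {S : Finset (ι → ℤ)} (h : IsWeightedBy η M S)
    {μ : ι → ℤ} {m : M} (hm : m ∈ wtSpace η M μ) (h0 : m ≠ 0) : μ ∈ S := by
  by_contra hμ
  exact h0 (h.eq_zero hμ hm)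

/-- The elements of `K` that map `m` into `N`. -/
def bracketComap (K : Type*) [LieRing K] [LieAlgebra F K] [LieRingModule K M] [LieModule F K M]
    (m : M) (N : Submodule F M) : Submodule F K where
  carrier := {y | ⁅y, m⁆ ∈ N}
  add_mem' {x y} hx hy := by
    change ⁅x + y, m⁆ ∈ N
    rw [add_lie]; exact N.add_mem hx hy
  zero_mem' := by
    change ⁅(0 : K), m⁆ ∈ N
    rw [zero_lie]; exact N.zero_mem
  smul_mem' r x hx := by
    change ⁅r • x, m⁆ ∈ N
    rw [smul_lie]; exact N.smul_mem r hx

/-- The elements of `M` that `y` maps into `N`. -/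
def lieComap (y : K) (N : Submodule F M) : Submodule F M where
  carrier := {m | ⁅y, m⁆ ∈ N}
  add_mem' {a b} ha hb := by
    change ⁅y, a + b⁆ ∈ N
    rw [lie_add]; exact N.add_mem ha hb
  zero_mem' := by
    change ⁅y, (0 : M)⁆ ∈ N
    rw [lie_zero]; exact N.zero_mem
  smul_mem' r x hx := by
    change ⁅y, r • x⁆ ∈ N
    rw [lie_smul]; exact N.smul_mem r hx

theorem lie_mem_of_span {y : K} {s : Set M} {N : Submodule F M} (hs : ∀ x ∈ s, ⁅y, x⁆ ∈ N) {x : M}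
    (hx : x ∈ Submodule.span F s) : ⁅y, x⁆ ∈ N :=
  (Submodule.span_le (p := lieComap y N)).2 hs hx

/-! ### Strings -/

theorem lie_iterate_lie {h f : K} {γ c : F} {m : M} (hf : ⁅h, f⁆ = -(γ • f))
    (hm : ⁅h, m⁆ = c • m) (n : ℕ) :
    ⁅h, (fun y : M => ⁅f, y⁆)^[n] m⁆ = (c - n * γ) • (fun y : M => ⁅f, y⁆)^[n] m := by
  induction n with
  | zero => simpa using hm
  | succ n ih =>
    rw [Function.iterate_succ_apply', leibniz_lie, hf, ih, neg_lie, smul_lie, lie_smul]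
    push_cast
    module

/-- Moving `e` through the powers of `f` produces the arithmetic progression `c, c - γ, ..., c -
nγ`, whose sum is the coefficient. The triple is not normalised: `γ` is arbitrary, and `γ = 0` is
needed later. -/
theorem lie_iterate_succ_lie [CharZero F] {e h f : K} {γ c : F} {m : M} (hef : ⁅e, f⁆ = h)
    (hf : ⁅h, f⁆ = -(γ • f)) (hm : ⁅h, m⁆ = c • m) (hem : ⁅e, m⁆ = 0) (n : ℕ) :
    ⁅e, (fun y : M => ⁅f, y⁆)^[n + 1] m⁆ =
      ((n + 1) * (2 * c - n * γ) / 2 : F) • (fun y : M => ⁅f, y⁆)^[n] m := by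
  induction n with
  | zero =>
    simp only [zero_add, Function.iterate_one, Function.iterate_zero, id]
    rw [leibniz_lie, hef, hem, hm, lie_zero, add_zero]
    congr 1
    push_cast
    ring
  | succ n ih =>
    rw [Function.iterate_succ_apply', leibniz_lie, hef, lie_iterate_lie hf hm, ih, lie_smul,
      ← Function.iterate_succ_apply' (fun y : M => ⁅f, y⁆), ← add_smul]
    congr 1
    push_cast
    ring

/-- Repeated application of a root vector to a weight vector gives zero eventually. -/
theorem IsWeightedBy.exists_iterate_eq_zero [CharZero F] {S : Finset (ι → ℤ)}
    (h : IsWeightedBy η M S) {α μ : ι → ℤ} (hα : α ≠ 0) {e : K} {m : M} (he : e ∈ wtSpace η K α)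
    (hm : m ∈ wtSpace η M μ) : ∃ n : ℕ, (fun y : M => ⁅e, y⁆)^[n] m = 0 := by
  by_contra! hne
  have hinj : Function.Injective fun n : ℕ => μ + n • α := by
    intro a b hab
    obtain ⟨i, hi⟩ := Function.ne_iff.1 hα
    have h1 : (μ + a • α) i = (μ + b • α) i := congrFun hab i
    have h2 : (a : ℤ) * α i = b * α i := by simpa using h1
    exact_mod_cast mul_right_cancel₀ hi h2
  refine Set.infinite_range_of_injective hinj (S.finite_toSet.subset ?_)
  rintro _ ⟨n, rfl⟩
  exact h.mem_of_ne_zero (iterate_lie_mem_wtSpace he hm n) (hne n)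

theorem IsWeightedBy.exists_top [CharZero F] {S : Finset (ι → ℤ)}
    (h : IsWeightedBy η M S) {α μ : ι → ℤ} (hα : α ≠ 0) {e : K} {m : M} (he : e ∈ wtSpace η K α)
    (hm : m ∈ wtSpace η M μ) (hm0 : m ≠ 0) :
    ∃ n : ℕ, (fun y : M => ⁅e, y⁆)^[n] m ≠ 0 ∧ (fun y : M => ⁅e, y⁆)^[n + 1] m = 0 :=
  Nat.exists_not_and_succ_of_not_zero_of_exists (p := fun n => (fun y : M => ⁅e, y⁆)^[n] m = 0)
    hm0 (h.exists_iterate_eq_zero hα he hm)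

/-- The string through a weight vector annihilated by a root vector. -/
theorem IsWeightedBy.exists_string [CharZero F] {S : Finset (ι → ℤ)}
    (h : IsWeightedBy η M S) {α μ : ι → ℤ} (hα : α ≠ 0) {e f : K} {d : ι → F} {m : M}
    (hf : f ∈ wtSpace η K (-α)) (hef : ⁅e, f⁆ = η d)
    (hm : m ∈ wtSpace η M μ) (hm0 : m ≠ 0) (hem : ⁅e, m⁆ = 0) :
    ∃ k : ℕ, 2 * wtEval μ d = k * wtEval α d ∧ (fun y : M => ⁅f, y⁆)^[k] m ≠ 0 ∧
      (fun y : M => ⁅f, y⁆)^[k + 1] m = 0 := by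
  obtain ⟨k, hk, hk1⟩ := h.exists_top (neg_ne_zero.2 hα) hf hm hm0
  refine ⟨k, ?_, hk, hk1⟩
  -- Since `f^(k+1) m = 0` and `f^k m ≠ 0`, the coefficient in the string formula vanishes. If `α(d)
  -- = 0`, the outcome is `μ(d) = 0`.
  have h1 := lie_iterate_succ_lie (γ := wtEval α d) (c := wtEval μ d) hef
    (by rw [hf d, wtEval_neg, neg_smul]) (hm d) hem k
  rw [hk1, lie_zero] at h1
  have h2 := (smul_eq_zero.1 h1.symm).resolve_right hk
  have h3 : (k + 1 : F) ≠ 0 := Nat.cast_add_one_ne_zero k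
  have h4 : (2 : F) ≠ 0 := two_ne_zero
  rw [div_eq_zero_iff, mul_eq_zero] at h2
  rcases h2 with (h2 | h2) | h2
  · exact absurd h2 h3
  · exact sub_eq_zero.1 h2
  · exact absurd h2 h4

theorem iterate_lie_ne_zero {f : K} {m : M} {k i : ℕ} (h : (fun y : M => ⁅f, y⁆)^[k] m ≠ 0)
    (hi : i ≤ k) : (fun y : M => ⁅f, y⁆)^[i] m ≠ 0 := by
  intro h0
  apply h
  rw [← Nat.sub_add_cancel hi, Function.iterate_add_apply, h0]
  exact Function.iterate_fixed (lie_zero f) _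

end WeightSpaces

/-! ### Weights of type `C` and `BC` -/

section RootWeights

variable {ι : Type*} [Fintype ι]

/-- The `ℓ¹`-norm. -/
def lOne (μ : ι → ℤ) : ℤ := ∑ i, |μ i|

theorem abs_le_lOne (μ : ι → ℤ) (i : ι) : |μ i| ≤ lOne μ :=
  Finset.single_le_sum (f := fun i => |μ i|) (fun _ _ => abs_nonneg _) (Finset.mem_univ i)

theorem lOne_nonneg (μ : ι → ℤ) : 0 ≤ lOne μ := Finset.sum_nonneg fun _ _ => abs_nonneg _

theorem lOne_neg (μ : ι → ℤ) : lOne (-μ) = lOne μ := by simp [lOne]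

theorem lOne_add_self (μ : ι → ℤ) : lOne (μ + μ) = 2 * lOne μ := by
  rw [lOne, lOne, Finset.mul_sum]
  exact Finset.sum_congr rfl fun i _ => by rw [Pi.add_apply, ← two_mul, abs_mul]; rfl

theorem lOne_add_le (μ ν : ι → ℤ) : lOne (μ + ν) ≤ lOne μ + lOne ν := by
  rw [lOne, lOne, lOne, ← Finset.sum_add_distrib]
  exact Finset.sum_le_sum fun i _ => abs_add_le _ _

theorem eq_zero_of_lOne {μ : ι → ℤ} (h : lOne μ = 0) : μ = 0 := by
  ext i
  have := abs_le_lOne μ i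
  rw [h] at this
  simpa using this

variable [DecidableEq ι]

variable (ι) in
/-- The weights of type `BC`. -/
noncomputable def weightsBC : Finset (ι → ℤ) :=
  (Fintype.piFinset fun _ => Finset.Icc (-2) 2).filter fun μ => lOne μ ≤ 2

variable (ι) in
/-- The weights of type `C`. -/
noncomputable def weightsC : Finset (ι → ℤ) :=
  (weightsBC ι).filter fun μ => lOne μ = 0 ∨ lOne μ = 2

theorem abs_add_abs_le_lOne (μ : ι → ℤ) {i j : ι} (hij : i ≠ j) : |μ i| + |μ j| ≤ lOne μ := by
  have := Finset.sum_le_sum_of_subset_of_nonneg (f := fun i => |μ i|)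
    (Finset.subset_univ {i, j}) (fun _ _ _ => abs_nonneg _)
  rwa [Finset.sum_pair hij] at this

theorem abs_add_abs_add_abs_le_lOne (μ : ι → ℤ) {i j k : ι} (hij : i ≠ j) (hik : i ≠ k)
    (hjk : j ≠ k) : |μ i| + |μ j| + |μ k| ≤ lOne μ := by
  have := Finset.sum_le_sum_of_subset_of_nonneg (f := fun i => |μ i|)
    (Finset.subset_univ {i, j, k}) (fun _ _ _ => abs_nonneg _)
  rw [Finset.sum_insert (by simp [hij, hik]), Finset.sum_pair hjk] at this
  rw [add_assoc]
  exact this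

theorem mem_weightsBC {μ : ι → ℤ} : μ ∈ weightsBC ι ↔ lOne μ ≤ 2 := by
  simp only [weightsBC, Finset.mem_filter, Fintype.mem_piFinset, Finset.mem_Icc, and_iff_right_iff_imp]
  intro h i
  exact abs_le.1 ((abs_le_lOne μ i).trans h)

theorem mem_weightsC {μ : ι → ℤ} : μ ∈ weightsC ι ↔ lOne μ = 0 ∨ lOne μ = 2 := by
  rw [weightsC, Finset.mem_filter, mem_weightsBC]
  omega

theorem weightsC_subset : weightsC ι ⊆ weightsBC ι := Finset.filter_subset _ _

theorem lOne_single (i : ι) (a : ℤ) : lOne (Pi.single i a) = |a| := by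
  rw [lOne, Finset.sum_eq_single i] <;> simp +contextual

theorem lOne_eq_abs_add (μ : ι → ℤ) (i : ι) : lOne μ = |μ i| + lOne (Function.update μ i 0) := by
  rw [lOne, lOne, ← Finset.add_sum_erase _ _ (Finset.mem_univ i),
    ← Finset.add_sum_erase (a := i) _ (fun j => |Function.update μ i 0 j|) (Finset.mem_univ i)]
  simp only [Function.update_self, abs_zero, zero_add]
  congr 1
  refine Finset.sum_congr rfl fun j hj => ?_
  rw [Function.update_of_ne (Finset.ne_of_mem_erase hj)]

theorem lOne_single_add_single {i j : ι} (hij : i ≠ j) (a b : ℤ) :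
    lOne (Pi.single i a + Pi.single j b) = |a| + |b| := by
  rw [lOne_eq_abs_add _ i]
  have : Function.update (Pi.single i a + Pi.single j b : ι → ℤ) i 0 = Pi.single j b := by
    ext k
    by_cases hk : k = i
    · subst hk; simp [hij]
    · simp [hk]
  rw [this, lOne_single]
  simp [hij]

/-- A weight of `ℓ¹`-norm one is a unit vector up to sign. -/
theorem exists_single_of_lOne_one {μ : ι → ℤ} (h : lOne μ = 1) :
    ∃ i, ∃ t : ℤ, (t = 1 ∨ t = -1) ∧ μ = Pi.single i t := by
  obtain ⟨i, hi⟩ : ∃ i, μ i ≠ 0 := by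
    by_contra! h0
    simp [lOne, h0] at h
  have h1 := lOne_eq_abs_add μ i
  have h2 := lOne_nonneg (Function.update μ i 0)
  have h3 := abs_pos.2 hi
  have h4 : Function.update μ i 0 = 0 := eq_zero_of_lOne (by omega)
  refine ⟨i, μ i, ?_, ?_⟩
  · rw [← abs_eq one_pos.le]; omega
  · ext j
    by_cases hj : j = i
    · subst hj; simp
    · have := congrFun h4 j
      simpa [hj] using this

/-- The nonzero weights of type `C`. -/
theorem weightsC_cases {μ : ι → ℤ} (h : lOne μ = 2) :
    (∃ i, ∃ t : ℤ, (t = 1 ∨ t = -1) ∧ μ = Pi.single i (2 * t)) ∨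
    ∃ i j, i ≠ j ∧ ∃ t u : ℤ, (t = 1 ∨ t = -1) ∧ (u = 1 ∨ u = -1) ∧
      μ = Pi.single i t + Pi.single j u := by
  obtain ⟨i, hi⟩ : ∃ i, μ i ≠ 0 := by
    by_contra! h0
    simp [lOne, h0] at h
  have h1 := lOne_eq_abs_add μ i
  have h2 := lOne_nonneg (Function.update μ i 0)
  have h3 := abs_pos.2 hi
  have hμ : μ = Pi.single i (μ i) + Function.update μ i 0 := by
    ext j
    by_cases hj : j = i
    · subst hj; simp
    · simp [hj]
  rcases (show |μ i| = 1 ∨ |μ i| = 2 by omega) with h4 | h4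
  · right
    obtain ⟨j, u, hu, hju⟩ := exists_single_of_lOne_one (μ := Function.update μ i 0) (by omega)
    refine ⟨i, j, ?_, μ i, u, (abs_eq one_pos.le).1 h4, hu, by rw [← hju]; exact hμ⟩
    rintro rfl
    have := congrFun hju i
    simp only [Function.update_self, Pi.single_eq_same] at this
    omega
  · left
    have h5 : Function.update μ i 0 = 0 := eq_zero_of_lOne (by omega)
    rw [h5, add_zero] at hμ
    rcases (abs_eq (by norm_num : (0 : ℤ) ≤ 2)).1 h4 with h6 | h6
    · exact ⟨i, 1, Or.inl rfl, by rw [hμ, h6]; rfl⟩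
    · exact ⟨i, -1, Or.inr rfl, by rw [hμ, h6]; rfl⟩

end RootWeights

/-! ### Simple Lie algebras with roots of type `C` -/

section TypeC

variable {F ι K : Type*} [Field F] [CharZero F] [Fintype ι] [DecidableEq ι] [LieRing K]
  [LieAlgebra F K] {η : (ι → F) →ₗ[F] K}

/-- `K` is simple, with a self-centralising torus `η` whose roots are those of type `C`. -/
structure IsTypeC (η : (ι → F) →ₗ[F] K) : Prop where
  simple : ∀ J : LieIdeal F K, J = ⊥ ∨ J = ⊤
  inj : Function.Injective η
  comm : ∀ c d, ⁅η c, η d⁆ = 0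
  weighted : IsWeightedBy η K (weightsC ι)
  zero : ∀ x ∈ wtSpace η K 0, ∃ c, η c = x
  nonzero : ∀ μ, lOne μ = 2 → ∃ x ∈ wtSpace η K μ, x ≠ 0

omit [DecidableEq ι] in
theorem ne_zero_of_lOne {α : ι → ℤ} (h : lOne α = 2) : α ≠ 0 := by
  rintro rfl
  simp [lOne] at h

-- Proportionality gives `γ i * β j = γ j * β i`. Summing absolute values over `j` and using that
-- both norms are 2 yields `|γ i| = |β i|`, and one nonzero coordinate fixes the common sign.
omit [Fintype ι] [DecidableEq ι] [CharZero F] in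
theorem eq_or_eq_neg_of_smul [Fintype ι] [CharZero F] {β γ : ι → ℤ} (hβ : lOne β = 2)
    (hγ : lOne γ = 2) {a b : F} (ha : a ≠ 0) (h : ∀ i, a * γ i = b * β i) :
    γ = β ∨ γ = -β := by
  have hc : ∀ i j, γ i * β j = γ j * β i := by
    intro i j
    have h1 : (a * (γ i * β j) : F) = a * (γ j * β i) := by
      rw [← mul_assoc, h i, ← mul_assoc, h j]; ring
    exact_mod_cast mul_left_cancel₀ ha h1
  have habs : ∀ i, |γ i| = |β i| := by
    intro i
    have h1 : ∑ j, |γ i| * |β j| = ∑ j, |γ j| * |β i| :=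
      Finset.sum_congr rfl fun j _ => by rw [← abs_mul, hc i j, abs_mul]
    rw [← Finset.mul_sum, ← Finset.sum_mul] at h1
    change |γ i| * lOne β = lOne γ * |β i| at h1
    rw [hβ, hγ] at h1
    omega
  obtain ⟨i, hi⟩ : ∃ i, β i ≠ 0 := Function.ne_iff.1 (ne_zero_of_lOne hβ)
  rcases abs_eq_abs.1 (habs i) with h1 | h1
  · left
    ext j
    have := hc i j
    rw [h1, mul_comm] at this
    exact (mul_right_cancel₀ hi this).symm
  · right
    ext j
    have := hc i j
    rw [h1, neg_mul, mul_comm, ← neg_mul] at this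
    exact (mul_right_cancel₀ hi this).symm

namespace IsTypeC

variable (hK : IsTypeC η)
include hK

theorem eta_mem (c : ι → F) : η c ∈ wtSpace η K 0 := by
  intro d
  rw [hK.comm, wtEval_zero, zero_smul]

theorem lie_mem_range {α : ι → ℤ} {e f : K} (he : e ∈ wtSpace η K α)
    (hf : f ∈ wtSpace η K (-α)) : ∃ d, ⁅e, f⁆ = η d := by
  obtain ⟨d, hd⟩ := hK.zero _ (lie_mem_wtSpace' he hf (add_neg_cancel α))
  exact ⟨d, hd.symm⟩

/-- When `α(d) = 0`, every value on `d` along an `α`-string is the same, and the string formula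
forces it to vanish. Applied to the top of a string through a vector of weight `2ε_i`, this gives `d
i = 0`. -/
theorem eq_zero_of_pairing {α : ι → ℤ} (hα : α ≠ 0) {e f : K} {d : ι → F}
    (he : e ∈ wtSpace η K α) (hf : f ∈ wtSpace η K (-α)) (hef : ⁅e, f⁆ = η d)
    (h0 : wtEval α d = 0) : d = 0 := by
  ext i
  obtain ⟨y, hy, hy0⟩ := hK.nonzero (Pi.single i 2) (by rw [lOne_single]; rfl)
  obtain ⟨n, hn, hn1⟩ := hK.weighted.exists_top hα he hy hy0
  obtain ⟨k, hk, -⟩ := hK.weighted.exists_string hα hf hef (iterate_lie_mem_wtSpace he hy n) hn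
    (by rwa [Function.iterate_succ_apply'] at hn1)
  rw [wtEval_add, wtEval_nsmul, h0, wtEval_single_left] at hk
  simpa using hk

/-- As `β + α` is not a root, a root vector of weight `β` is at the top of its `α`-string. The
length of the string is `β(d)`, and each weight on it is a root. -/
theorem string_up {α β : ι → ℤ} (hα : lOne α = 2) {e f : K} {d : ι → F}
    (he : e ∈ wtSpace η K α) (hf : f ∈ wtSpace η K (-α)) (hef : ⁅e, f⁆ = η d)
    (h2 : wtEval α d = 2) (hβ : lOne β = 2) (hαβ : 2 < lOne (β + α)) :
    ∃ k : ℕ, wtEval β d = k ∧ ∀ i ≤ k, lOne (β + i • (-α)) ≤ 2 := by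
  obtain ⟨y, hy, hy0⟩ := hK.nonzero β hβ
  have hey : ⁅e, y⁆ = 0 := hK.weighted.eq_zero (μ := β + α)
    (fun h => by have := mem_weightsC.1 h; omega) (lie_mem_wtSpace' he hy (add_comm _ _))
  obtain ⟨k, hk, hk1, -⟩ := hK.weighted.exists_string (ne_zero_of_lOne hα) hf hef hy hy0 hey
  refine ⟨k, ?_, fun i hi => ?_⟩
  · rw [h2, mul_comm] at hk
    exact mul_right_cancel₀ two_ne_zero hk
  · exact mem_weightsBC.1 (weightsC_subset (hK.weighted.mem_of_ne_zero
      (iterate_lie_mem_wtSpace hf hy i) (iterate_lie_ne_zero hk1 hi)))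

/-- Neither `2ε_i + α` nor `2ε_i - α` is a root, both having norm 4. So `2ε_i` takes on `d` and on
`-d` values that are natural numbers, and both are zero. -/
theorem coroot_apply_eq_zero {α : ι → ℤ} (hα : lOne α = 2) {e f : K} {d : ι → F}
    (he : e ∈ wtSpace η K α) (hf : f ∈ wtSpace η K (-α)) (hef : ⁅e, f⁆ = η d)
    (h2 : wtEval α d = 2) {i : ι} (hi : α i = 0) : d i = 0 := by
  have hl : ∀ γ : ι → ℤ, lOne γ = 2 → γ i = 0 → 2 < lOne (Pi.single i 2 + γ) := by
    intro γ hγ hi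
    have hu : Function.update (Pi.single i 2 + γ : ι → ℤ) i 0 = γ := by
      ext j
      by_cases hj : j = i
      · subst hj; simp [hi]
      · simp [hj]
    rw [lOne_eq_abs_add _ i, hu, hγ]
    simp [hi]
  have hs : lOne (Pi.single i 2 : ι → ℤ) = 2 := by rw [lOne_single]; rfl
  obtain ⟨k, hk, -⟩ := hK.string_up hα he hf hef h2 hs (hl α hα hi)
  obtain ⟨l, hl, -⟩ := hK.string_up (α := -α) (e := f) (f := e) (d := -d) (by rwa [lOne_neg]) hf
    (by rwa [neg_neg]) (by rw [← lie_skew, hef, map_neg])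
    (by rw [wtEval_neg, wtEval_neg_right, neg_neg, h2]) hs
    (hl (-α) (by rwa [lOne_neg]) (by simp [hi]))
  rw [wtEval_neg_right] at hl
  have h3 : ((k + l : ℕ) : F) = 0 := by push_cast; rw [← hk, ← hl]; ring
  have h4 : k = 0 := by have := Nat.cast_eq_zero.1 h3; omega
  rw [h4, wtEval_single_left] at hk
  simpa using hk

/-- The string from `2tε_i` in the direction `-α`, for `α = tε_i + uε_j`, has length `2t d_i`. It
has at most two steps, because `2tε_i - 3α = -tε_i - 3uε_j` has norm 4. -/
theorem coroot_apply_bound {i j : ι} {t u : ℤ} (hij : i ≠ j) (ht : t = 1 ∨ t = -1)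
    (hu : u = 1 ∨ u = -1) {e f : K} {d : ι → F}
    (he : e ∈ wtSpace η K (Pi.single i t + Pi.single j u))
    (hf : f ∈ wtSpace η K (-(Pi.single i t + Pi.single j u))) (hef : ⁅e, f⁆ = η d)
    (h2 : wtEval (Pi.single i t + Pi.single j u) d = 2) :
    ∃ k : ℕ, (2 * t : F) * d i = k ∧ k ≤ 2 := by
  obtain ⟨k, hk, hk2⟩ := hK.string_up (β := Pi.single i (2 * t))
    (by rw [lOne_single_add_single hij]; rcases ht with rfl | rfl <;> rcases hu with rfl | rfl <;> rfl)
    he hf hef h2 (by rw [lOne_single]; rcases ht with rfl | rfl <;> rfl)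
    (by
      rw [← add_assoc, ← Pi.single_add, lOne_single_add_single hij]
      rcases ht with rfl | rfl <;> rcases hu with rfl | rfl <;> decide)
  refine ⟨k, ?_, ?_⟩
  · rw [wtEval_single_left] at hk
    rw [← hk]; push_cast; rfl
  · by_contra! h
    have h3 := hk2 3 h
    have : ((Pi.single i (2 * t) + 3 • -(Pi.single i t + Pi.single j u : ι → ℤ) : ι → ℤ)) =
        Pi.single i (-t) + Pi.single j (-3 * u) := by
      ext l
      simp only [Pi.add_apply, Pi.smul_apply, Pi.neg_apply, Pi.single_apply]
      split_ifs <;> simp <;> ring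
    rw [this, lOne_single_add_single hij] at h3
    rcases ht with rfl | rfl <;> rcases hu with rfl | rfl <;> revert h3 <;> decide

/-- The coroot is proportional to the root; no invariant form is used. For a long root this is the
vanishing of the other coordinates. For a short root `tε_i + uε_j` the numbers `2t d_i` and `2u d_j`
are natural, at most 2 and of sum 4, so both equal 2. -/
theorem exists_coroot_eq {α : ι → ℤ} (hα : lOne α = 2) {e f : K} {d : ι → F}
    (he : e ∈ wtSpace η K α) (hf : f ∈ wtSpace η K (-α)) (hef : ⁅e, f⁆ = η d)
    (h2 : wtEval α d = 2) : ∃ s : F, s ≠ 0 ∧ ∀ i, d i = s * α i := by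
  have hzero : ∀ i, α i = 0 → d i = 0 :=
    fun i hi => hK.coroot_apply_eq_zero hα he hf hef h2 hi
  rcases weightsC_cases hα with ⟨i, t, ht, rfl⟩ | ⟨i, j, hij, t, u, ht, hu, rfl⟩
  · refine ⟨1 / 2, by norm_num, fun j => ?_⟩
    by_cases hj : j = i
    · subst hj
      rw [wtEval_single_left] at h2
      simp only [Pi.single_eq_same]
      rcases ht with rfl | rfl
      · push_cast at h2 ⊢
        linear_combination h2 / 2
      · push_cast at h2 ⊢
        linear_combination -h2 / 2
    · rw [hzero j (by simp [hj])]
      simp [hj]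
  · obtain ⟨k, hk, hk2⟩ := hK.coroot_apply_bound hij ht hu he hf hef h2
    obtain ⟨l, hl, hl2⟩ := hK.coroot_apply_bound hij.symm hu ht (by rwa [add_comm])
      (by rwa [add_comm (Pi.single j u : ι → ℤ)]) hef (by rwa [add_comm])
    have hsum : (t : F) * d i + u * d j = 2 := by
      rw [← h2, wtEval_add, wtEval_single_left, wtEval_single_left]
    have h4 : ((k + l : ℕ) : F) = (4 : ℕ) := by
      push_cast
      rw [← hk, ← hl]
      linear_combination 2 * hsum
    have h5 := Nat.cast_injective h4
    obtain rfl : k = 2 := by omega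
    obtain rfl : l = 2 := by omega
    have hdi : ∀ (t : ℤ) (x : F), (t = 1 ∨ t = -1) → (2 * t : F) * x = (2 : ℕ) → x = t := by
      rintro t x (rfl | rfl) h
      · push_cast at h ⊢; linear_combination h / 2
      · push_cast at h ⊢; linear_combination -h / 2
    refine ⟨1, one_ne_zero, fun l => ?_⟩
    by_cases hli : l = i
    · subst hli
      rw [hdi t _ ht hk]
      simp [hij]
    · by_cases hlj : l = j
      · subst hlj
        rw [hdi u _ hu hl]
        simp [hli]
      · rw [hzero l (by simp [hli, hlj])]
        simp [hli, hlj]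

/-- Root spaces are lines. Correct `x` by a multiple of `e` so that its bracket with `f` has zero
pairing with `α`, hence vanishes. The corrected vector also commutes with `e`, since `2α` is not a
root, so `[e, f]` kills it; but `[e, f]` acts on it as multiplication by 2. -/
theorem exists_smul_eq {α : ι → ℤ} (hα : lOne α = 2) {e f : K} {d : ι → F}
    (he : e ∈ wtSpace η K α) (hf : f ∈ wtSpace η K (-α)) (hef : ⁅e, f⁆ = η d)
    (h2 : wtEval α d = 2) {x : K} (hx : x ∈ wtSpace η K α) : ∃ c : F, x = c • e := by
  obtain ⟨d', hd'⟩ := hK.lie_mem_range hx hf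
  refine ⟨wtEval α d' / 2, ?_⟩
  set c := wtEval α d' / 2 with hc
  have hx' : x - c • e ∈ wtSpace η K α := sub_mem hx (Submodule.smul_mem _ _ he)
  have hxf : ⁅x - c • e, f⁆ = η (d' - c • d) := by
    rw [sub_lie, smul_lie, hd', hef, map_sub, map_smul]
  have h0 : ⁅x - c • e, f⁆ = 0 := by
    rw [hxf, hK.eq_zero_of_pairing (ne_zero_of_lOne hα) hx' hf hxf, map_zero]
    rw [wtEval_sub_right, wtEval_smul_right, h2, hc]
    ring
  have h1 : ⁅e, x - c • e⁆ = 0 := by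
    refine hK.weighted.eq_zero (μ := α + α) (fun h => ?_) (lie_mem_wtSpace he hx')
    have h3 := lOne_add_self α
    have := mem_weightsC.1 h
    omega
  have h3 : (2 : F) • (x - c • e) = 0 := by
    rw [← h2, ← hx' d, ← hef, lie_lie, h1, lie_zero, sub_zero, ← lie_skew f, h0, neg_zero,
      lie_zero]
  exact sub_eq_zero.1 ((smul_eq_zero.1 h3).resolve_left two_ne_zero)

/-- A bracket `η d` with `α(d) ≠ 0` could be rescaled to a normalised triple, and one with `α(d) =
0` vanishes by `eq_zero_of_pairing`. -/
theorem not_good {α : ι → ℤ} (hα : α ≠ 0)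
    (hb : ¬∃ e ∈ wtSpace η K α, ∃ f ∈ wtSpace η K (-α), ∃ d, ⁅e, f⁆ = η d ∧ wtEval α d = 2)
    {e f : K} (he : e ∈ wtSpace η K α) (hf : f ∈ wtSpace η K (-α)) : ⁅e, f⁆ = 0 := by
  obtain ⟨d, hd⟩ := hK.lie_mem_range he hf
  by_cases h0 : wtEval α d = 0
  · rw [hd, hK.eq_zero_of_pairing hα he hf hd h0, map_zero]
  · refine absurd ⟨(2 / wtEval α d) • e, Submodule.smul_mem _ _ he, f, hf,
      (2 / wtEval α d) • d, ?_, ?_⟩ hb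
    · rw [smul_lie, hd, map_smul]
    · rw [wtEval_smul_right, div_mul_cancel₀ _ h0]

/-- If `[y, x]` were nonzero, the coroot direction of the good root `β + α` would occur among the
brackets of the root spaces of `β` and `-β`. Then `β + α = ±β`, that is `α = 0` or `α = -2β`, and
neither has norm 2. -/
theorem lie_eq_zero_of_not_good {α β : ι → ℤ} (hα : lOne α = 2)
    (hb : ¬∃ e ∈ wtSpace η K α, ∃ f ∈ wtSpace η K (-α), ∃ d, ⁅e, f⁆ = η d ∧ wtEval α d = 2)
    (hβα : lOne (β + α) = 2)
    (hg : ∃ e ∈ wtSpace η K (β + α), ∃ f ∈ wtSpace η K (-(β + α)), ∃ d, ⁅e, f⁆ = η d ∧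
      wtEval (β + α) d = 2) {x y : K} (hx : x ∈ wtSpace η K α) (hy : y ∈ wtSpace η K β) :
    ⁅y, x⁆ = 0 := by
  obtain ⟨e₀, he₀, f₀, hf₀, d₀, hd₀, h2₀⟩ := hg
  by_cases hy0 : y = 0
  · rw [hy0, zero_lie]
  have hβ0 : β ≠ 0 := by
    rintro rfl
    rw [zero_add] at *
    exact hb ⟨e₀, he₀, f₀, hf₀, d₀, hd₀, h2₀⟩
  have hβ : lOne β = 2 := (mem_weightsC.1 (hK.weighted.mem_of_ne_zero hy hy0)).resolve_left
    fun h => hβ0 (eq_zero_of_lOne h)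
  obtain ⟨c, hc⟩ := hK.exists_smul_eq hβα he₀ hf₀ hd₀ h2₀ (lie_mem_wtSpace hy hx)
  obtain ⟨s₀, hs₀, hs₀d⟩ := hK.exists_coroot_eq hβα he₀ hf₀ hd₀ h2₀
  have hz : ⁅x, f₀⁆ ∈ wtSpace η K (-β) := lie_mem_wtSpace' hx hf₀ (by abel)
  -- The second Leibniz term `[x, [y, f₀]]` is a bracket of root vectors for `α` and `-α`, and these
  -- all vanish.
  have hbr : ⁅y, ⁅x, f₀⁆⁆ = η (c • d₀) := by
    have h1 : ⁅x, ⁅y, f₀⁆⁆ = 0 :=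
      hK.not_good (ne_zero_of_lOne hα) hb hx (lie_mem_wtSpace' hy hf₀ (by abel))
    have h2 := leibniz_lie y x f₀
    rw [h1, add_zero, hc, smul_lie, hd₀, ← map_smul] at h2
    exact h2
  suffices hc0 : c = 0 by rw [hc, hc0, zero_smul]
  by_contra hc0
  have hcd : c • d₀ ≠ 0 := by
    intro h
    have h3 := congrArg (wtEval (β + α)) h
    rw [wtEval_smul_right, h2₀] at h3
    simp [wtEval] at h3
    exact hc0 h3
  by_cases hgβ : ∃ e ∈ wtSpace η K β, ∃ f ∈ wtSpace η K (-β), ∃ d, ⁅e, f⁆ = η d ∧ wtEval β d = 2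
  · obtain ⟨e₁, he₁, f₁, hf₁, d₁, hd₁, h2₁⟩ := hgβ
    obtain ⟨s₁, hs₁, hs₁d⟩ := hK.exists_coroot_eq hβ he₁ hf₁ hd₁ h2₁
    obtain ⟨b, hb1⟩ := hK.exists_smul_eq hβ he₁ hf₁ hd₁ h2₁ hy
    -- This multiple of `f₁` makes the pairing of the difference with `β` vanish, so `c • d₀` is
    -- exactly `r` times the coroot `d₁`.
    set r := wtEval β (c • d₀) / 2 with hr
    have h4 : ⁅e₁, b • ⁅x, f₀⁆ - r • f₁⁆ = η (c • d₀ - r • d₁) := by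
      rw [lie_sub, lie_smul, lie_smul, hd₁, ← smul_lie, ← hb1, hbr, map_sub, map_smul η r]
    have h5 := hK.eq_zero_of_pairing hβ0 he₁
      (sub_mem (Submodule.smul_mem _ _ hz) (Submodule.smul_mem _ _ hf₁)) h4
      (by rw [wtEval_sub_right, wtEval_smul_right β r, h2₁, hr]; ring)
    rcases eq_or_eq_neg_of_smul (F := F) hβ hβα (a := c * s₀) (b := r * s₁)
      (mul_ne_zero hc0 hs₀) (fun i => by
        have h6 := congrFun (sub_eq_zero.1 h5) i
        simp only [Pi.smul_apply, smul_eq_mul, hs₀d, hs₁d] at h6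
        linear_combination h6) with h7 | h7
    · exact ne_zero_of_lOne hα (by simpa using h7)
    · have h8 : α = -β + -β := by rw [← h7]; nth_rewrite 2 [h7]; abel
      have h9 : lOne α = 4 := by
        rw [h8, lOne_add_self, lOne_neg, hβ]; rfl
      omega
  · rw [hK.not_good hβ0 hgβ hy hz] at hbr
    exact hcd (hK.inj (by rw [← hbr, map_zero]))

/-- The root spaces without a normalised triple span an ideal, by `not_good` and
`lie_eq_zero_of_not_good`. It misses the nonzero torus, so simplicity makes it zero, whereas every
root space is nonzero. -/
theorem good {α : ι → ℤ} (hα : lOne α = 2) :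
    ∃ e ∈ wtSpace η K α, ∃ f ∈ wtSpace η K (-α), ∃ d, ⁅e, f⁆ = η d ∧ wtEval α d = 2 := by
  classical
  by_contra hb
  let T := (weightsC ι).filter fun α => lOne α = 2 ∧
    ¬∃ e ∈ wtSpace η K α, ∃ f ∈ wtSpace η K (-α), ∃ d, ⁅e, f⁆ = η d ∧ wtEval α d = 2
  have hαT : α ∈ T := Finset.mem_filter.2 ⟨mem_weightsC.2 (Or.inr hα), hα, hb⟩
  let J : LieIdeal F K :=
    { (⨆ μ ∈ T, wtSpace η K μ : Submodule F K) with
      lie_mem := by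
        intro y x hx
        refine hK.weighted.mem_of_forall
          (bracketComap K x (⨆ μ ∈ T, wtSpace η K μ)) ?_ y
        intro β hβ y hy
        change ⁅y, x⁆ ∈ ⨆ μ ∈ T, wtSpace η K μ
        have hle : ⨆ μ ∈ T, wtSpace η K μ ≤
            lieComap y (⨆ μ ∈ T, wtSpace η K μ) := by
          refine iSup₂_le fun α hαT x hx => ?_
          change ⁅y, x⁆ ∈ ⨆ μ ∈ T, wtSpace η K μ
          obtain ⟨-, hα, hb⟩ := Finset.mem_filter.1 hαT
          by_cases h0 : ⁅y, x⁆ = 0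
          · rw [h0]; exact zero_mem _
          have hmem := lie_mem_wtSpace hy hx
          rcases mem_weightsC.1 (hK.weighted.mem_of_ne_zero hmem h0) with h1 | h1
          · obtain rfl : β = -α := by rw [eq_neg_iff_add_eq_zero]; exact eq_zero_of_lOne h1
            refine absurd ?_ h0
            rw [← lie_skew, hK.not_good (ne_zero_of_lOne hα) hb hx hy, neg_zero]
          · refine mem_iSup_wtSpace (Finset.mem_filter.2 ⟨mem_weightsC.2 (Or.inr h1), h1, ?_⟩) hmem
            intro hg
            exact h0 (hK.lie_eq_zero_of_not_good hα hb h1 hg hx hy)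
        exact hle hx }
  have hJ : ∀ x : K, x ∈ J ↔ x ∈ ⨆ μ ∈ T, wtSpace η K μ := fun x => Iff.rfl
  rcases hK.simple J with h | h
  · obtain ⟨x, hx, hx0⟩ := hK.nonzero α hα
    have : x ∈ J := (hJ x).2 (mem_iSup_wtSpace hαT hx)
    rw [h] at this
    exact hx0 ((LieSubmodule.mem_bot x).1 this)
  · obtain ⟨i, hi⟩ : ∃ i, α i ≠ 0 := Function.ne_iff.1 (ne_zero_of_lOne hα)
    have h1 : η (Pi.single i 1) ∈ J := by rw [h]; exact LieSubmodule.mem_top _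
    have h2 := eq_zero_of_mem_wtSpace_of_mem_iSup (fun h0 => ?_) (hK.eta_mem _) ((hJ _).1 h1)
    · rw [← map_zero η] at h2
      simpa using congrFun (hK.inj h2) i
    · simpa [lOne] using (Finset.mem_filter.1 h0).2.1

omit hK in
/-- The coroot of `α`. -/
noncomputable def _root_.corootVec (F : Type*) [Field F] (α : ι → ℤ) : ι → F :=
  fun i => 2 / (∑ j, (α j : F) ^ 2) * α i

/-- Root vectors for opposite roots, normalised by their bracket. -/
theorem exists_rootVectors {α : ι → ℤ} (hα : lOne α = 2) :
    ∃ e ∈ wtSpace η K α, ∃ f ∈ wtSpace η K (-α), ⁅e, f⁆ = η (corootVec F α) ∧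
      wtEval α (corootVec F α) = 2 ∧ e ≠ 0 ∧ f ≠ 0 ∧
      (∀ x ∈ wtSpace η K α, ∃ c : F, x = c • e) ∧ ∀ x ∈ wtSpace η K (-α), ∃ c : F, x = c • f := by
  obtain ⟨e, he, f, hf, d, hd, h2⟩ := hK.good hα
  obtain ⟨s, hs, hsd⟩ := hK.exists_coroot_eq hα he hf hd h2
  have hd' : d = corootVec F α := by
    -- The factor of proportionality is fixed by the normalisation `α(d) = 2`.
    have h3 : s * ∑ j, (α j : F) ^ 2 = 2 := by
      rw [← h2, wtEval, Finset.mul_sum]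
      exact Finset.sum_congr rfl fun i _ => by rw [hsd]; ring
    have h4 : (∑ j, (α j : F) ^ 2) ≠ 0 := by
      intro h
      rw [h, mul_zero] at h3
      exact two_ne_zero h3.symm
    ext i
    rw [hsd, corootVec, ← h3, mul_div_cancel_right₀ _ h4]
  have he0 : ⁅e, f⁆ ≠ 0 := by
    intro h
    rw [h, ← map_zero η] at hd
    rw [← hK.inj hd] at h2
    simp [wtEval] at h2
  subst hd'
  refine ⟨e, he, f, hf, hd, h2, ?_, ?_, fun x hx => hK.exists_smul_eq hα he hf hd h2 hx,
    fun x hx => hK.exists_smul_eq (α := -α) (by rwa [lOne_neg]) hf (by rwa [neg_neg])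
      (d := -corootVec F α) (by rw [← lie_skew, hd, map_neg])
      (by rw [wtEval_neg, wtEval_neg_right, neg_neg, h2]) hx⟩
  · rintro rfl; exact he0 (zero_lie _)
  · rintro rfl; exact he0 (lie_zero _)

end IsTypeC

end TypeC

/-! ### Star-shaped systems of generators -/

section Star

variable {F ι Q : Type*} [Field F] [CharZero F] [Fintype ι] [DecidableEq ι] [LieRing Q]
  [LieAlgebra F Q] {η : (ι → F) →ₗ[F] Q}

/-- The weight `ε i - ε o`. -/
def starWt (o i : ι) : ι → ℤ := Pi.single i 1 - Pi.single o 1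

/-- A sign vector certifies a large norm. Each vanishing bracket of root vectors below is verified
by exhibiting one. -/
theorem sum_mul_le_lOne (μ s : ι → ℤ) (hs : ∀ i, |s i| ≤ 1) : ∑ i, μ i * s i ≤ lOne μ := by
  refine Finset.sum_le_sum fun i _ => (le_abs_self _).trans ?_
  rw [abs_mul]
  exact mul_le_of_le_one_right (abs_nonneg _) (hs i)

theorem sum_single_mul (i : ι) (a : ℤ) (s : ι → ℤ) :
    ∑ j, (Pi.single i a : ι → ℤ) j * s j = a * s i := by
  rw [Finset.sum_eq_single i] <;> simp +contextual

/-- Root vectors for the roots `±(ε i - ε o)` and `±2 ε o`. -/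
structure StarData (η : (ι → F) →ₗ[F] Q) (o : ι) (E G : ι → Q) (σ τ : Q) : Prop where
  weighted : IsWeightedBy η Q (weightsC ι)
  comm : ∀ c d, ⁅η c, η d⁆ = 0
  memE : ∀ i ≠ o, E i ∈ wtSpace η Q (starWt o i)
  memG : ∀ i ≠ o, G i ∈ wtSpace η Q (-starWt o i)
  memσ : σ ∈ wtSpace η Q (Pi.single o 2)
  memτ : τ ∈ wtSpace η Q (-Pi.single o 2)
  lieEG : ∀ i ≠ o, ∃ c, ⁅E i, G i⁆ = η c
  lieστ : ∃ c, ⁅σ, τ⁆ = η c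

theorem wtSpace_neg (μ : ι → ℤ) {M : Type*} [AddCommGroup M] [Module F M] [LieRingModule Q M]
    [LieModule F Q M] : wtSpace (-η) M μ = wtSpace η M (-μ) := by
  ext m
  simp only [mem_wtSpace, LinearMap.neg_apply, neg_lie, wtEval_neg, neg_smul, neg_eq_iff_eq_neg]

theorem isWeightedBy_neg {M : Type*} [AddCommGroup M] [Module F M] [LieRingModule Q M]
    [LieModule F Q M] (h : IsWeightedBy η M (weightsC ι)) :
    IsWeightedBy (-η) M (weightsC ι) := by
  refine fun m => h.mem_of_forall _ (fun μ hμ x hx => ?_) m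
  refine mem_iSup_wtSpace (μ := -μ) ?_ (by rwa [wtSpace_neg, neg_neg])
  rwa [mem_weightsC, lOne_neg, ← mem_weightsC]

namespace StarData

variable {o : ι} {E G : ι → Q} {σ τ : Q}

/-- The reflection exchanging `E` with `G` and `σ` with `τ` turns each bracket computation for the
positive part into the one for the negative part. -/
theorem swap (h : StarData η o E G σ τ) : StarData (-η) o G E τ σ where
  weighted := isWeightedBy_neg h.weighted
  comm c d := by simp [h.comm]
  memE i hi := by rw [wtSpace_neg]; exact h.memG i hi
  memG i hi := by rw [wtSpace_neg, neg_neg]; exact h.memE i hi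
  memσ := by rw [wtSpace_neg]; exact h.memτ
  memτ := by rw [wtSpace_neg, neg_neg]; exact h.memσ
  lieEG i hi := by
    obtain ⟨c, hc⟩ := h.lieEG i hi
    exact ⟨c, by rw [← lie_skew, hc]; rfl⟩
  lieστ := by
    obtain ⟨c, hc⟩ := h.lieστ
    exact ⟨c, by rw [← lie_skew, hc]; rfl⟩

/-- The part of degree zero. -/
def partZero (η : (ι → F) →ₗ[F] Q) (o : ι) (E G : ι → Q) : Submodule F Q :=
  Submodule.span F {x | (∃ c, x = η c) ∨ (∃ i, i ≠ o ∧ x = E i) ∨ (∃ i, i ≠ o ∧ x = G i) ∨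
    ∃ i j, i ≠ o ∧ j ≠ o ∧ i ≠ j ∧ x = ⁅E i, G j⁆}

/-- The part generated by `σ`. -/
def partOne (F : Type*) [Field F] {Q : Type*} [LieRing Q] [LieAlgebra F Q] {ι : Type*} (o : ι)
    (E : ι → Q) (σ : Q) : Submodule F Q :=
  Submodule.span F {x | x = σ ∨ (∃ i, i ≠ o ∧ x = ⁅E i, σ⁆) ∨
    ∃ i j, i ≠ o ∧ j ≠ o ∧ x = ⁅E i, ⁅E j, σ⁆⁆}

theorem partZero_swap : partZero (-η) o G E = partZero η o E G := by
  have key : ∀ (η : (ι → F) →ₗ[F] Q) (E G : ι → Q), partZero (-η) o G E ≤ partZero η o E G := by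
    intro η E G
    refine Submodule.span_le.2 ?_
    rintro x (⟨c, rfl⟩ | ⟨i, hi, rfl⟩ | ⟨i, hi, rfl⟩ | ⟨i, j, hi, hj, hij, rfl⟩)
    · exact neg_mem (Submodule.subset_span (Or.inl ⟨c, rfl⟩))
    · exact Submodule.subset_span (Or.inr (Or.inr (Or.inl ⟨i, hi, rfl⟩)))
    · exact Submodule.subset_span (Or.inr (Or.inl ⟨i, hi, rfl⟩))
    · rw [← lie_skew]
      exact neg_mem (Submodule.subset_span (Or.inr (Or.inr (Or.inr ⟨j, i, hj, hi, hij.symm, rfl⟩))))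
  refine le_antisymm (key η E G) ?_
  have := key (-η) G E
  rwa [neg_neg] at this

variable (h : StarData η o E G σ τ)
include h

theorem lie_eta {μ : ι → ℤ} {x : Q} (hx : x ∈ wtSpace η Q μ) (c : ι → F) :
    ∃ r : F, ⁅x, η c⁆ = r • x :=
  ⟨-wtEval μ c, by rw [← lie_skew, hx c, neg_smul]⟩

theorem vanish {μ : ι → ℤ} {x : Q} (hx : x ∈ wtSpace η Q μ) (s : ι → ℤ) (hs : ∀ i, |s i| ≤ 1)
    (hμ : 2 < ∑ i, μ i * s i) : x = 0 := by
  refine h.weighted.eq_zero (fun hm => ?_) hx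
  have := mem_weightsC.1 hm
  have := sum_mul_le_lOne μ s hs
  omega

theorem lie_EE {i j : ι} (hi : i ≠ o) (hj : j ≠ o) : ⁅E i, E j⁆ = 0 := by
  refine h.vanish (lie_mem_wtSpace (h.memE i hi) (h.memE j hj))
    (fun l => if l = o then -1 else 1) (fun l => by split_ifs <;> simp) ?_
  simp [starWt, add_mul, sub_mul, Finset.sum_add_distrib, Finset.sum_sub_distrib,
    sum_single_mul, hi, hj, -mul_ite]

theorem lie_Gσ {i : ι} (hi : i ≠ o) : ⁅G i, σ⁆ = 0 := by
  refine h.vanish (lie_mem_wtSpace (h.memG i hi) h.memσ)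
    (fun l => if l = i then -1 else 1) (fun l => by split_ifs <;> simp) ?_
  simp [starWt, add_mul, sub_mul, Finset.sum_add_distrib, Finset.sum_sub_distrib,
    sum_single_mul, hi.symm, -mul_ite]

theorem lie_EG_σ {i j : ι} (hi : i ≠ o) (hj : j ≠ o) (hij : i ≠ j) : ⁅⁅E i, G j⁆, σ⁆ = 0 := by
  refine h.vanish (lie_mem_wtSpace (lie_mem_wtSpace (h.memE i hi) (h.memG j hj)) h.memσ)
    (fun l => if l = j then -1 else 1) (fun l => by split_ifs <;> simp) ?_
  simp [starWt, add_mul, sub_mul, Finset.sum_add_distrib, Finset.sum_sub_distrib,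
    sum_single_mul, hj.symm, hij, -mul_ite]

theorem lie_τE {i : ι} (hi : i ≠ o) : ⁅τ, E i⁆ = 0 := by
  refine h.vanish (lie_mem_wtSpace h.memτ (h.memE i hi))
    (fun l => if l = o then -1 else 1) (fun l => by split_ifs <;> simp) ?_
  simp [starWt, add_mul, sub_mul, Finset.sum_add_distrib, Finset.sum_sub_distrib,
    sum_single_mul, hi, -mul_ite]

theorem lie_EEEσ {i j k : ι} (hi : i ≠ o) (hj : j ≠ o) (hk : k ≠ o) :
    ⁅E k, ⁅E i, ⁅E j, σ⁆⁆⁆ = 0 := by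
  refine h.vanish (lie_mem_wtSpace (h.memE k hk) (lie_mem_wtSpace (h.memE i hi)
    (lie_mem_wtSpace (h.memE j hj) h.memσ)))
    (fun l => if l = o then -1 else 1) (fun l => by split_ifs <;> simp) ?_
  simp [starWt, add_mul, sub_mul, Finset.sum_add_distrib, Finset.sum_sub_distrib,
    sum_single_mul, hi, hj, hk, -mul_ite]

/-- For `k = j` the bracket reduces to the action of a torus element on `E i`; for `k ≠ j` the
weight has norm greater than 2. -/
theorem lie_E_EG {i j k : ι} (hi : i ≠ o) (hj : j ≠ o) (hk : k ≠ o) (hij : i ≠ j) :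
    ∃ r : F, ⁅E k, ⁅E i, G j⁆⁆ = r • E i := by
  by_cases hkj : k = j
  · subst hkj
    rw [leibniz_lie, h.lie_EE hk hi, zero_lie, zero_add]
    obtain ⟨c, hc⟩ := h.lieEG k hk
    rw [hc]
    exact h.lie_eta (h.memE i hi) c
  · refine ⟨0, ?_⟩
    rw [zero_smul]
    refine h.vanish (lie_mem_wtSpace (h.memE k hk)
      (lie_mem_wtSpace (h.memE i hi) (h.memG j hj)))
      (fun l => if l = o then -1 else if l = j then -1 else 1)
      (fun l => by split_ifs <;> simp) ?_
    simp [starWt, add_mul, sub_mul, Finset.sum_add_distrib, Finset.sum_sub_distrib,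
      sum_single_mul, hi, hj, hk, hij, hkj, -mul_ite]

theorem lie_E_partZero {k : ι} (hk : k ≠ o) {x : Q} (hx : x ∈ partZero η o E G) :
    ⁅E k, x⁆ ∈ partZero η o E G := by
  have hE : ∀ i ≠ o, E i ∈ partZero η o E G :=
    fun i hi => Submodule.subset_span (Or.inr (Or.inl ⟨i, hi, rfl⟩))
  refine lie_mem_of_span ?_ hx
  rintro x (⟨c, rfl⟩ | ⟨i, hi, rfl⟩ | ⟨i, hi, rfl⟩ | ⟨i, j, hi, hj, hij, rfl⟩)
  · obtain ⟨r, hr⟩ := h.lie_eta (h.memE k hk) c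
    rw [hr]
    exact Submodule.smul_mem _ _ (hE k hk)
  · rw [h.lie_EE hk hi]
    exact zero_mem _
  · by_cases hki : k = i
    · subst hki
      obtain ⟨c, hc⟩ := h.lieEG k hk
      rw [hc]
      exact Submodule.subset_span (Or.inl ⟨c, rfl⟩)
    · exact Submodule.subset_span (Or.inr (Or.inr (Or.inr ⟨k, i, hk, hi, hki, rfl⟩)))
  · obtain ⟨r, hr⟩ := h.lie_E_EG hi hj hk hij
    rw [hr]
    exact Submodule.smul_mem _ _ (hE i hi)

theorem lie_σ_partZero {x : Q} (hx : x ∈ partZero η o E G) : ⁅σ, x⁆ ∈ partOne F o E σ := by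
  refine lie_mem_of_span ?_ hx
  rintro x (⟨c, rfl⟩ | ⟨i, hi, rfl⟩ | ⟨i, hi, rfl⟩ | ⟨i, j, hi, hj, hij, rfl⟩)
  · obtain ⟨r, hr⟩ := h.lie_eta h.memσ c
    rw [hr]
    exact Submodule.smul_mem _ _ (Submodule.subset_span (Or.inl rfl))
  · rw [← lie_skew]
    exact neg_mem (Submodule.subset_span (Or.inr (Or.inl ⟨i, hi, rfl⟩)))
  · rw [← lie_skew, h.lie_Gσ hi, neg_zero]
    exact zero_mem _
  · rw [← lie_skew, h.lie_EG_σ hi hj hij, neg_zero]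
    exact zero_mem _

theorem lie_E_partOne {k : ι} (hk : k ≠ o) {x : Q} (hx : x ∈ partOne F o E σ) :
    ⁅E k, x⁆ ∈ partOne F o E σ := by
  refine lie_mem_of_span ?_ hx
  rintro x (rfl | ⟨i, hi, rfl⟩ | ⟨i, j, hi, hj, rfl⟩)
  · exact Submodule.subset_span (Or.inr (Or.inl ⟨k, hk, rfl⟩))
  · exact Submodule.subset_span (Or.inr (Or.inr ⟨k, i, hk, hi, rfl⟩))
  · rw [h.lie_EEEσ hi hj hk]
    exact zero_mem _

theorem lie_G_Eσ {k i : ι} (hk : k ≠ o) (hi : i ≠ o) : ∃ r : F, ⁅G k, ⁅E i, σ⁆⁆ = r • σ := by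
  rw [leibniz_lie, h.lie_Gσ hk, lie_zero, add_zero, ← lie_skew (G k) (E i), neg_lie]
  by_cases hki : k = i
  · subst hki
    obtain ⟨c, hc⟩ := h.lieEG k hk
    exact ⟨-wtEval (Pi.single o 2) c, by rw [hc, h.memσ c, neg_smul]⟩
  · exact ⟨0, by rw [h.lie_EG_σ hi hk (Ne.symm hki), neg_zero, zero_smul]⟩

/-- `G k` annihilates `σ`, so it can be moved to the right past the factors `E i`, leaving a torus
element or some `[E i, G k]`, both already controlled. -/
theorem lie_G_partOne {k : ι} (hk : k ≠ o) {x : Q} (hx : x ∈ partOne F o E σ) :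
    ⁅G k, x⁆ ∈ partOne F o E σ := by
  have hσ : σ ∈ partOne F o E σ := Submodule.subset_span (Or.inl rfl)
  have hE : ∀ i ≠ o, ⁅E i, σ⁆ ∈ partOne F o E σ :=
    fun i hi => Submodule.subset_span (Or.inr (Or.inl ⟨i, hi, rfl⟩))
  refine lie_mem_of_span ?_ hx
  rintro x (rfl | ⟨i, hi, rfl⟩ | ⟨i, j, hi, hj, rfl⟩)
  · rw [h.lie_Gσ hk]
    exact zero_mem _
  · obtain ⟨r, hr⟩ := h.lie_G_Eσ hk hi
    rw [hr]
    exact Submodule.smul_mem _ _ hσ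
  · rw [leibniz_lie]
    obtain ⟨r, hr⟩ := h.lie_G_Eσ hk hj
    rw [hr, lie_smul]
    refine add_mem ?_ (Submodule.smul_mem _ _ (hE i hi))
    rw [← lie_skew (G k) (E i), neg_lie]
    refine neg_mem ?_
    by_cases hki : i = k
    · subst hki
      obtain ⟨c, hc⟩ := h.lieEG i hk
      rw [hc, lie_mem_wtSpace (h.memE j hj) h.memσ c]
      exact Submodule.smul_mem _ _ (hE j hj)
    · rw [leibniz_lie, h.lie_EG_σ hi hk hki, lie_zero, add_zero, ← lie_skew _ (E j), neg_lie]
      obtain ⟨r, hr⟩ := h.lie_E_EG hi hk hj hki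
      rw [hr, smul_lie]
      exact neg_mem (Submodule.smul_mem _ _ (hE i hi))

/-- Every weight in the bracket has coordinate sum 4, while the sum is at most 2 for a root. -/
theorem lie_σ_partOne {x : Q} (hx : x ∈ partOne F o E σ) : ⁅σ, x⁆ = 0 := by
  rw [← Submodule.mem_bot F]
  refine lie_mem_of_span ?_ hx
  rintro x (rfl | ⟨i, hi, rfl⟩ | ⟨i, j, hi, hj, rfl⟩)
  · rw [lie_self]; exact zero_mem _
  · rw [Submodule.mem_bot]
    refine h.vanish (lie_mem_wtSpace h.memσ (lie_mem_wtSpace (h.memE i hi) h.memσ))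
      (fun _ => 1) (by simp) ?_
    simp [starWt, Finset.sum_add_distrib, Finset.sum_sub_distrib]
  · rw [Submodule.mem_bot]
    refine h.vanish (lie_mem_wtSpace h.memσ (lie_mem_wtSpace (h.memE i hi)
      (lie_mem_wtSpace (h.memE j hj) h.memσ))) (fun _ => 1) (by simp) ?_
    simp [starWt, Finset.sum_add_distrib, Finset.sum_sub_distrib]

theorem lie_τ_partOne {x : Q} (hx : x ∈ partOne F o E σ) : ⁅τ, x⁆ ∈ partZero η o E G := by
  obtain ⟨c, hc⟩ := h.lieστ
  have hσ : ⁅τ, σ⁆ ∈ partZero η o E G := by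
    rw [← lie_skew, hc]
    exact neg_mem (Submodule.subset_span (Or.inl ⟨c, rfl⟩))
  have hE : ∀ i ≠ o, ⁅τ, ⁅E i, σ⁆⁆ ∈ partZero η o E G := by
    intro i hi
    rw [leibniz_lie, h.lie_τE hi, zero_lie, zero_add]
    exact h.lie_E_partZero hi hσ
  refine lie_mem_of_span ?_ hx
  rintro x (rfl | ⟨i, hi, rfl⟩ | ⟨i, j, hi, hj, rfl⟩)
  · exact hσ
  · exact hE i hi
  · rw [leibniz_lie, h.lie_τE hi, zero_lie, zero_add]
    exact h.lie_E_partZero hi (hE j hj)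

/-- The sum of the coordinates grades the algebra with degrees -2, 0 and 2, and the three parts are
explicit spans in these degrees. Each generator maps their sum into itself. -/
theorem lieSpan_le : (LieSubalgebra.lieSpan F Q
      {x | (∃ i, i ≠ o ∧ x = E i) ∨ (∃ i, i ≠ o ∧ x = G i) ∨ x = σ ∨ x = τ}).toSubmodule ≤
    partZero η o E G ⊔ (partOne F o E σ ⊔ partOne F o G τ) := by
  set P := partZero η o E G ⊔ (partOne F o E σ ⊔ partOne F o G τ) with hP
  have h0 : partZero η o E G ≤ P := le_sup_left
  have h1 : partOne F o E σ ≤ P := le_sup_left.trans le_sup_right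
  have h2 : partOne F o G τ ≤ P := le_sup_right.trans le_sup_right
  have hs := h.swap
  have hgen : ∀ y, ((∃ i, i ≠ o ∧ y = E i) ∨ (∃ i, i ≠ o ∧ y = G i) ∨ y = σ ∨ y = τ) →
      P ≤ lieComap y P := by
    intro y hy
    refine sup_le (fun x hx => ?_) (sup_le (fun x hx => ?_) fun x hx => ?_)
    all_goals change ⁅y, x⁆ ∈ P
    · have hx' := hx
      rw [← partZero_swap] at hx'
      rcases hy with ⟨k, hk, rfl⟩ | ⟨k, hk, rfl⟩ | rfl | rfl
      · exact h0 (h.lie_E_partZero hk hx)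
      · exact h0 (by rw [← partZero_swap]; exact hs.lie_E_partZero hk hx')
      · exact h1 (h.lie_σ_partZero hx)
      · exact h2 (hs.lie_σ_partZero hx')
    · rcases hy with ⟨k, hk, rfl⟩ | ⟨k, hk, rfl⟩ | rfl | rfl
      · exact h1 (h.lie_E_partOne hk hx)
      · exact h1 (h.lie_G_partOne hk hx)
      · rw [h.lie_σ_partOne hx]; exact zero_mem _
      · exact h0 (h.lie_τ_partOne hx)
    · rcases hy with ⟨k, hk, rfl⟩ | ⟨k, hk, rfl⟩ | rfl | rfl
      · exact h2 (hs.lie_G_partOne hk hx)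
      · exact h2 (hs.lie_E_partOne hk hx)
      · exact h0 (by rw [← partZero_swap]; exact hs.lie_τ_partOne hx)
      · rw [hs.lie_σ_partOne hx]; exact zero_mem _
  intro x hx
  -- Membership in `P` alone is not preserved by brackets in the induction; together with stability
  -- of `P` under `x` it is.
  have hx2 : x ∈ P ∧ P ≤ lieComap x P := by
    rw [LieSubalgebra.mem_toSubmodule] at hx
    induction hx using LieSubalgebra.lieSpan_induction with
    | mem x hx =>
      refine ⟨?_, hgen x hx⟩
      rcases hx with ⟨k, hk, rfl⟩ | ⟨k, hk, rfl⟩ | rfl | rfl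
      · exact h0 (Submodule.subset_span (Or.inr (Or.inl ⟨k, hk, rfl⟩)))
      · exact h0 (Submodule.subset_span (Or.inr (Or.inr (Or.inl ⟨k, hk, rfl⟩))))
      · exact h1 (Submodule.subset_span (Or.inl rfl))
      · exact h2 (Submodule.subset_span (Or.inl rfl))
    | zero => exact ⟨zero_mem _, fun y hy => by change ⁅(0 : Q), y⁆ ∈ P; rw [zero_lie]; exact zero_mem _⟩
    | add x y _ _ hx hy =>
      refine ⟨add_mem hx.1 hy.1, fun z hz => ?_⟩
      change ⁅x + y, z⁆ ∈ P
      rw [add_lie]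
      exact add_mem (hx.2 hz) (hy.2 hz)
    | smul a x _ hx =>
      refine ⟨Submodule.smul_mem _ _ hx.1, fun z hz => ?_⟩
      change ⁅a • x, z⁆ ∈ P
      rw [smul_lie]
      exact Submodule.smul_mem _ _ (hx.2 hz)
    | lie x y _ _ hx hy =>
      refine ⟨hx.2 hy.1, fun z hz => ?_⟩
      change ⁅⁅x, y⁆, z⁆ ∈ P
      rw [lie_lie]
      exact sub_mem (hx.2 (hy.2 hz)) (hy.2 (hx.2 hz))
  exact hx2.1

/-- The subalgebra generated by a star has a one dimensional root space for `2 ε o`. -/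
theorem exists_smul_of_mem {x : Q} (hx : x ∈ LieSubalgebra.lieSpan F Q
      {x | (∃ i, i ≠ o ∧ x = E i) ∨ (∃ i, i ≠ o ∧ x = G i) ∨ x = σ ∨ x = τ})
    (hx2 : x ∈ wtSpace η Q (Pi.single o 2)) : ∃ c : F, x = c • σ := by
  set T := (weightsC ι).erase (Pi.single o 2) with hT
  have hmem : ∀ (μ : ι → ℤ) (y : Q), y ∈ wtSpace η Q μ → μ ≠ Pi.single o 2 →
      y ∈ Submodule.span F {σ} ⊔ ⨆ μ ∈ T, wtSpace η Q μ := by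
    intro μ y hy hμ
    by_cases hy0 : y = 0
    · rw [hy0]; exact zero_mem _
    · exact Submodule.mem_sup_right
        (mem_iSup_wtSpace (Finset.mem_erase.2 ⟨hμ, h.weighted.mem_of_ne_zero hy hy0⟩) hy)
  have hne : ∀ (μ : ι → ℤ) (s : ι → ℤ), ∑ i, μ i * s i ≠ 2 * s o → μ ≠ Pi.single o 2 := by
    rintro μ s hs rfl
    exact hs (sum_single_mul _ _ _)
  -- Among the spanning elements only `σ` has weight `2ε_o`: the parts of degree 0 and -2 differ
  -- from it in the sum of the coordinates, and the remaining elements of degree 2 in the coordinate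
  -- at `o`.
  have hP : partZero η o E G ⊔ (partOne F o E σ ⊔ partOne F o G τ) ≤
      Submodule.span F {σ} ⊔ ⨆ μ ∈ T, wtSpace η Q μ := by
    refine sup_le (Submodule.span_le.2 ?_) (sup_le (Submodule.span_le.2 ?_) (Submodule.span_le.2 ?_))
    · rintro x (⟨c, rfl⟩ | ⟨i, hi, rfl⟩ | ⟨i, hi, rfl⟩ | ⟨i, j, hi, hj, hij, rfl⟩)
      · refine hmem 0 _ (fun d => by rw [h.comm, wtEval_zero, zero_smul]) (hne _ 1 (by simp))
      · exact hmem _ _ (h.memE i hi) (hne _ 1 (by simp [starWt, Finset.sum_sub_distrib]))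
      · exact hmem _ _ (h.memG i hi) (hne _ 1 (by simp [starWt, Finset.sum_sub_distrib]))
      · exact hmem _ _ (lie_mem_wtSpace (h.memE i hi) (h.memG j hj))
          (hne _ 1 (by simp [starWt, Finset.sum_sub_distrib]))
    · rintro x (rfl | ⟨i, hi, rfl⟩ | ⟨i, j, hi, hj, rfl⟩)
      · exact Submodule.mem_sup_left (Submodule.mem_span_singleton_self _)
      · refine hmem _ _ (lie_mem_wtSpace (h.memE i hi) h.memσ) (hne _ (Pi.single o 1) ?_)
        simp [starWt, add_mul, sub_mul, Finset.sum_add_distrib, Finset.sum_sub_distrib,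
          sum_single_mul, hi]
      · refine hmem _ _ (lie_mem_wtSpace (h.memE i hi) (lie_mem_wtSpace (h.memE j hj) h.memσ))
          (hne _ (Pi.single o 1) ?_)
        simp [starWt, add_mul, sub_mul, Finset.sum_add_distrib, Finset.sum_sub_distrib,
          sum_single_mul, hi, hj]
    · rintro x (rfl | ⟨i, hi, rfl⟩ | ⟨i, j, hi, hj, rfl⟩)
      · exact hmem _ _ h.memτ (hne _ 1 (by simp))
      · exact hmem _ _ (lie_mem_wtSpace (h.memG i hi) h.memτ)
          (hne _ 1 (by simp [starWt, Finset.sum_sub_distrib, Finset.sum_add_distrib]))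
      · exact hmem _ _ (lie_mem_wtSpace (h.memG i hi) (lie_mem_wtSpace (h.memG j hj) h.memτ))
          (hne _ 1 (by simp [starWt, Finset.sum_sub_distrib, Finset.sum_add_distrib]))
  obtain ⟨y, hy, z, hz, hyz⟩ := Submodule.mem_sup.1 (hP (h.lieSpan_le hx))
  obtain ⟨c, rfl⟩ := Submodule.mem_span_singleton.1 hy
  refine ⟨c, ?_⟩
  have hz2 : z ∈ wtSpace η Q (Pi.single o 2) := by
    rw [← eq_sub_iff_add_eq'] at hyz
    rw [hyz]
    exact sub_mem hx2 (Submodule.smul_mem _ _ h.memσ)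
  rw [← hyz, eq_zero_of_mem_wtSpace_of_mem_iSup (Finset.notMem_erase _ _) hz2 hz, add_zero]

end StarData

end Star

/-! ### Uniqueness of simple Lie algebras of type `C` -/

section Uniqueness

variable {F ι K K' : Type*} [Field F] [CharZero F] [Fintype ι] [DecidableEq ι] [LieRing K]
  [LieAlgebra F K] [LieRing K'] [LieAlgebra F K'] {η : (ι → F) →ₗ[F] K} {η' : (ι → F) →ₗ[F] K'}

theorem lOne_starWt {o i : ι} (hi : i ≠ o) : lOne (starWt o i) = 2 := by
  rw [starWt, sub_eq_add_neg, ← Pi.single_neg, lOne_single_add_single hi]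
  rfl

theorem lOne_single_two (o : ι) : lOne (Pi.single o 2 : ι → ℤ) = 2 := by
  rw [lOne_single]
  rfl

theorem corootVec_starWt {o i : ι} (hi : i ≠ o) :
    corootVec F (starWt o i) = Pi.single i 1 - Pi.single o 1 := by
  have hc : ∀ j, ((starWt o i j : ℤ) : F) = (Pi.single i 1 - Pi.single o 1 : ι → F) j := by
    intro j
    simp only [starWt, Pi.sub_apply, Pi.single_apply]
    split_ifs <;> simp
  have hs : ∑ j, (starWt o i j : F) ^ 2 = 2 := by
    have : ∑ j, (starWt o i j : F) ^ 2 =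
        wtEval (starWt o i) (Pi.single i 1 - Pi.single o 1 : ι → F) :=
      Finset.sum_congr rfl fun j _ => by rw [← hc, sq]
    rw [this, wtEval_sub_right, wtEval_single_right, wtEval_single_right]
    simp [starWt, hi, hi.symm]
    norm_num
  ext j
  rw [corootVec, hs, hc, div_self two_ne_zero, one_mul]

theorem corootVec_single (o : ι) : corootVec F (Pi.single o 2 : ι → ℤ) = Pi.single o 1 := by
  have hs : ∑ j, ((Pi.single o 2 : ι → ℤ) j : F) ^ 2 = 4 := by
    rw [Finset.sum_eq_single o] <;> simp +contextual
    norm_num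
  ext j
  rw [corootVec, hs]
  by_cases hj : j = o
  · subst hj
    simp
    norm_num
  · simp [hj]

namespace IsTypeC

theorem neg (hK : IsTypeC η) : IsTypeC (-η) where
  simple := hK.simple
  inj c d h := hK.inj (neg_injective h)
  comm c d := by simp [hK.comm]
  weighted := isWeightedBy_neg hK.weighted
  zero x hx := by
    rw [wtSpace_neg, neg_zero] at hx
    obtain ⟨c, hc⟩ := hK.zero x hx
    exact ⟨-c, by simpa using hc⟩
  nonzero μ hμ := by
    rw [wtSpace_neg]
    exact hK.nonzero _ (by rwa [lOne_neg])

variable (hK : IsTypeC η)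
include hK

theorem exists_smul_of_ne_zero {α : ι → ℤ} (hα : lOne α = 2) {x y : K} (hx : x ∈ wtSpace η K α)
    (hx0 : x ≠ 0) (hy : y ∈ wtSpace η K α) : ∃ c : F, y = c • x := by
  obtain ⟨e, he, -, -, -, -, -, -, h1, -⟩ := hK.exists_rootVectors hα
  obtain ⟨a, rfl⟩ := h1 x hx
  obtain ⟨b, rfl⟩ := h1 y hy
  have ha : a ≠ 0 := by rintro rfl; exact hx0 (zero_smul _ _)
  exact ⟨b / a, by rw [smul_smul, div_mul_cancel₀ _ ha]⟩

/-- Otherwise `y` would be at the top of its `α`-string, and the value of `β` on the coroot of `α`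
would be a natural number. -/
theorem lie_ne_zero {α β : ι → ℤ} (hα : lOne α = 2) {x y : K} (hx : x ∈ wtSpace η K α)
    (hx0 : x ≠ 0) (hy : y ∈ wtSpace η K β) (hy0 : y ≠ 0) {n : ℕ}
    (hn : wtEval β (corootVec F α) = -(n + 1)) : ⁅x, y⁆ ≠ 0 := by
  intro h
  obtain ⟨e, he, f, hf, hef, h2, -, -, -, -⟩ := hK.exists_rootVectors hα
  obtain ⟨c, rfl⟩ := hK.exists_smul_of_ne_zero hα hx hx0 he
  obtain ⟨k, hk, -, -⟩ := hK.weighted.exists_string (ne_zero_of_lOne hα) hf hef hy hy0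
    (by rw [smul_lie, h, smul_zero])
  rw [h2, hn] at hk
  have : ((k + n + 1 : ℕ) : F) = 0 := by push_cast; linear_combination -hk / 2
  exact Nat.succ_ne_zero _ (Nat.cast_eq_zero.1 this)

/-- Brackets of the star elements reach all roots of coordinate sum 0 or 2. Root spaces being lines,
one nonzero vector in `U` brings in the whole root space. -/
theorem mem_of_subalgebra {U : LieSubalgebra F K} {o : ι} {e f : ι → K} {s : K}
    (he : ∀ i ≠ o, e i ∈ wtSpace η K (starWt o i)) (he0 : ∀ i ≠ o, e i ≠ 0)
    (heU : ∀ i ≠ o, e i ∈ U) (hf : ∀ i ≠ o, f i ∈ wtSpace η K (-starWt o i))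
    (hf0 : ∀ i ≠ o, f i ≠ 0) (hfU : ∀ i ≠ o, f i ∈ U)
    (hs : s ∈ wtSpace η K (Pi.single o 2)) (hs0 : s ≠ 0) (hsU : s ∈ U) :
    (∀ i j, i ≠ j → wtSpace η K (Pi.single i 1 + Pi.single j (-1)) ≤ U.toSubmodule) ∧
    (∀ i j, i ≠ j → wtSpace η K (Pi.single i 1 + Pi.single j 1) ≤ U.toSubmodule) ∧
    ∀ i, wtSpace η K (Pi.single i 2) ≤ U.toSubmodule := by
  have key : ∀ {α : ι → ℤ} (_ : lOne α = 2) {x : K} (_ : x ∈ wtSpace η K α) (_ : x ≠ 0)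
      (_ : x ∈ U), wtSpace η K α ≤ U.toSubmodule := by
    intro α hα x hx hx0 hxU y hy
    obtain ⟨c, rfl⟩ := hK.exists_smul_of_ne_zero hα hx hx0 hy
    exact U.smul_mem c hxU
  have hso : ∀ i ≠ o, ⁅e i, s⁆ ∈ wtSpace η K (Pi.single i 1 + Pi.single o 1) := fun i hi =>
    lie_mem_wtSpace' (he i hi) hs (by
      rw [starWt, show (2 : ℤ) = 1 + 1 from rfl, Pi.single_add]; abel)
  have hso0 : ∀ i ≠ o, ⁅e i, s⁆ ≠ 0 := by
    intro i hi
    refine hK.lie_ne_zero (lOne_starWt hi) (he i hi) (he0 i hi) hs hs0 (n := 1) ?_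
    rw [corootVec_starWt hi, wtEval_sub_right, wtEval_single_right, wtEval_single_right]
    simp [hi]
    norm_num
  refine ⟨fun i j hij => ?_, fun i j hij => ?_, fun i => ?_⟩
  · by_cases hj : j = o
    · subst hj
      refine key (lOne_single_add_single hij _ _) ?_ (he0 i hij) (heU i hij)
      rw [Pi.single_neg, ← sub_eq_add_neg]
      exact he i hij
    · by_cases hi : i = o
      · subst hi
        refine key (lOne_single_add_single hij _ _) ?_ (hf0 j hj) (hfU j hj)
        have := hf j hj
        rwa [starWt, neg_sub, sub_eq_add_neg, ← Pi.single_neg] at this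
      · refine key (lOne_single_add_single hij _ _)
          (lie_mem_wtSpace' (he i hi) (hf j hj) ?_)
          (hK.lie_ne_zero (lOne_starWt hi) (he i hi) (he0 i hi) (hf j hj) (hf0 j hj) (n := 0) ?_)
          (U.lie_mem (heU i hi) (hfU j hj))
        · rw [starWt, starWt, Pi.single_neg]; abel
        · rw [corootVec_starWt hi, wtEval_sub_right, wtEval_single_right, wtEval_single_right]
          simp [starWt, hi, hij, Ne.symm hj]
  · by_cases hj : j = o
    · subst hj
      exact key (lOne_single_add_single hij _ _) (hso i hij) (hso0 i hij)
        (U.lie_mem (heU i hij) hsU)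
    · by_cases hi : i = o
      · subst hi
        rw [add_comm]
        exact key (lOne_single_add_single hij.symm _ _) (hso j hj) (hso0 j hj)
          (U.lie_mem (heU j hj) hsU)
      · refine key (lOne_single_add_single hij _ _)
          (lie_mem_wtSpace' (he i hi) (hso j hj) ?_)
          (hK.lie_ne_zero (lOne_starWt hi) (he i hi) (he0 i hi) (hso j hj) (hso0 j hj) (n := 0) ?_)
          (U.lie_mem (heU i hi) (U.lie_mem (heU j hj) hsU))
        · rw [starWt]; abel
        · rw [corootVec_starWt hi, wtEval_sub_right, wtEval_single_right, wtEval_single_right]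
          simp [hi, hij, Ne.symm hj]
  · by_cases hi : i = o
    · subst hi
      exact key (lOne_single_two i) hs hs0 hsU
    -- The second bracket escapes `lie_ne_zero`, since `ε_i + ε_o` vanishes on the coroot of `ε_i -
    -- ε_o`. Instead `s` is the end of a string, killed by the opposite root vector, and the string
    -- has length exactly 2.
    · refine key (lOne_single_two i) (x := ⁅e i, ⁅e i, s⁆⁆)
        (lie_mem_wtSpace' (he i hi) (hso i hi) ?_) ?_
        (U.lie_mem (heU i hi) (U.lie_mem (heU i hi) hsU))
      · rw [starWt, show (2 : ℤ) = 1 + 1 from rfl, Pi.single_add]; abel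
      · obtain ⟨e', he', f', hf', hef, h2, -, -, -, -⟩ := hK.exists_rootVectors (lOne_starWt hi)
        have hfs : ⁅f', s⁆ = 0 := by
          refine hK.weighted.eq_zero (fun hm => ?_) (lie_mem_wtSpace hf' hs)
          have h1 := abs_add_abs_le_lOne (-starWt o i + Pi.single o 2) hi
          simp [starWt, hi, Ne.symm hi] at h1
          rw [mem_weightsC, starWt, neg_sub] at hm
          omega
        obtain ⟨k, hk, hk1, -⟩ := hK.weighted.exists_string (α := -starWt o i)
          (neg_ne_zero.2 (ne_zero_of_lOne (lOne_starWt hi))) (e := f') (f := e')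
          (d := -corootVec F (starWt o i)) (by rwa [neg_neg]) (by rw [← lie_skew, hef, map_neg])
          hs hs0 hfs
        rw [wtEval_neg, wtEval_neg_right, wtEval_neg_right, neg_neg, h2, corootVec_starWt hi,
          wtEval_sub_right, wtEval_single_right, wtEval_single_right] at hk
        have hk2 : k = 2 := by
          simp [hi] at hk
          have : (k : F) = (2 : ℕ) := by push_cast; exact hk.symm
          exact Nat.cast_injective this
        subst hk2
        obtain ⟨c, rfl⟩ := hK.exists_smul_of_ne_zero (lOne_starWt hi) (he i hi) (he0 i hi) he'
        intro h0
        apply hk1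
        simp [h0]

/-- A star of root vectors generates. -/
theorem subalgebra_eq_top {U : LieSubalgebra F K} {o : ι} {e f : ι → K} {s t : K}
    (he : ∀ i ≠ o, e i ∈ wtSpace η K (starWt o i)) (he0 : ∀ i ≠ o, e i ≠ 0)
    (heU : ∀ i ≠ o, e i ∈ U) (hf : ∀ i ≠ o, f i ∈ wtSpace η K (-starWt o i))
    (hf0 : ∀ i ≠ o, f i ≠ 0) (hfU : ∀ i ≠ o, f i ∈ U)
    (hs : s ∈ wtSpace η K (Pi.single o 2)) (hs0 : s ≠ 0) (hsU : s ∈ U)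
    (ht : t ∈ wtSpace η K (-Pi.single o 2)) (ht0 : t ≠ 0) (htU : t ∈ U) : U = ⊤ := by
  obtain ⟨h1, h2, h3⟩ := hK.mem_of_subalgebra he he0 heU hf hf0 hfU hs hs0 hsU
  -- The roots of negative coordinate sum come from the same argument for the torus `-η`.
  obtain ⟨-, h5, h6⟩ := hK.neg.mem_of_subalgebra (e := f) (f := e) (s := t)
    (fun i hi => by rw [wtSpace_neg]; exact hf i hi) hf0 hfU
    (fun i hi => by rw [wtSpace_neg, neg_neg]; exact he i hi) he0 heU
    (by rwa [wtSpace_neg]) ht0 htU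
  simp only [wtSpace_neg] at h5 h6
  have hroot : ∀ α : ι → ℤ, lOne α = 2 → wtSpace η K α ≤ U.toSubmodule := by
    intro α hα
    rcases weightsC_cases hα with ⟨i, t, ht, rfl⟩ | ⟨i, j, hij, t, u, ht, hu, rfl⟩
    · rcases ht with rfl | rfl
      · exact h3 i
      · have := h6 i
        rwa [← Pi.single_neg] at this
    · rcases ht with rfl | rfl <;> rcases hu with rfl | rfl
      · exact h2 i j hij
      · exact h1 i j hij
      · rw [add_comm]; exact h1 j i hij.symm
      · have := h5 i j hij
        rwa [neg_add, ← Pi.single_neg, ← Pi.single_neg] at this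
  have hη : ∀ c, η c ∈ U := by
    intro c
    have h0 : c = ∑ i, c i • (Pi.single i 1 : ι → F) := by
      ext j
      simp [Finset.sum_apply, Pi.single_apply]
    rw [h0, map_sum]
    refine sum_mem fun i _ => ?_
    rw [map_smul]
    refine U.smul_mem _ ?_
    rw [← corootVec_single]
    obtain ⟨e', he', f', hf', hef, -⟩ := hK.exists_rootVectors (lOne_single_two i)
    rw [← hef]
    exact U.lie_mem (hroot _ (lOne_single_two i) he')
      (hroot _ (by rw [lOne_neg, lOne_single_two]) hf')
  rw [eq_top_iff]
  intro x _
  refine hK.weighted.mem_of_forall U.toSubmodule (fun μ hμ x hx => ?_) x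
  rcases mem_weightsC.1 hμ with h | h
  · obtain rfl := eq_zero_of_lOne h
    obtain ⟨c, rfl⟩ := hK.zero x hx
    exact hη c
  · exact hroot μ h hx

end IsTypeC

theorem mem_wtSpace_prod {μ : ι → ℤ} {x : K × K'} : x ∈ wtSpace (η.prod η') (K × K') μ ↔
    x.1 ∈ wtSpace η K μ ∧ x.2 ∈ wtSpace η' K' μ := by
  simp only [mem_wtSpace, LinearMap.prod_apply, LieAlgebra.Prod.bracket_apply, Function.prod,
    Prod.ext_iff, Prod.smul_fst, Prod.smul_snd, forall_and]

/-- Two simple Lie algebras with roots of type `C` are isomorphic. -/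
theorem IsTypeC.exists_equiv [Nonempty ι] (hK : IsTypeC η) (hK' : IsTypeC η') :
    ∃ φ : K ≃ₗ⁅F⁆ K', ∀ c, φ (η c) = η' c := by
  classical
  obtain ⟨o⟩ := ‹Nonempty ι›
  have hr : ∀ i, ∃ e ∈ wtSpace η K (starWt o i), ∃ f ∈ wtSpace η K (-starWt o i),
      i ≠ o → ⁅e, f⁆ = η (corootVec F (starWt o i)) ∧ e ≠ 0 ∧ f ≠ 0 := by
    intro i
    by_cases hi : i = o
    · exact ⟨0, zero_mem _, 0, zero_mem _, fun h => absurd hi h⟩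
    · obtain ⟨e, he, f, hf, hef, -, h1, h2, -⟩ := hK.exists_rootVectors (lOne_starWt hi)
      exact ⟨e, he, f, hf, fun _ => ⟨hef, h1, h2⟩⟩
  have hr' : ∀ i, ∃ e ∈ wtSpace η' K' (starWt o i), ∃ f ∈ wtSpace η' K' (-starWt o i),
      i ≠ o → ⁅e, f⁆ = η' (corootVec F (starWt o i)) ∧ e ≠ 0 ∧ f ≠ 0 := by
    intro i
    by_cases hi : i = o
    · exact ⟨0, zero_mem _, 0, zero_mem _, fun h => absurd hi h⟩
    · obtain ⟨e, he, f, hf, hef, -, h1, h2, -⟩ := hK'.exists_rootVectors (lOne_starWt hi)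
      exact ⟨e, he, f, hf, fun _ => ⟨hef, h1, h2⟩⟩
  choose e he f hf hef using hr
  choose e' he' f' hf' hef' using hr'
  obtain ⟨s, hs, t, ht, hst, -, hs0, ht0, -⟩ := hK.exists_rootVectors (lOne_single_two o)
  obtain ⟨s', hs', t', ht', hst', -, hs0', ht0', -⟩ := hK'.exists_rootVectors (lOne_single_two o)
  have hw : IsWeightedBy (η.prod η') (K × K') (weightsC ι) := by
    have h1 : ∀ x : K, ((x, 0) : K × K') ∈
        ⨆ μ ∈ weightsC ι, wtSpace (η.prod η') (K × K') μ := fun x =>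
      hK.weighted.mem_of_forall ((⨆ μ ∈ weightsC ι, wtSpace (η.prod η') (K × K') μ).comap
        (LinearMap.inl F K K')) (fun μ hμ y hy => mem_iSup_wtSpace hμ
          (mem_wtSpace_prod.2 ⟨hy, zero_mem _⟩)) x
    have h2 : ∀ x : K', ((0, x) : K × K') ∈
        ⨆ μ ∈ weightsC ι, wtSpace (η.prod η') (K × K') μ := fun x =>
      hK'.weighted.mem_of_forall ((⨆ μ ∈ weightsC ι, wtSpace (η.prod η') (K × K') μ).comap
        (LinearMap.inr F K K')) (fun μ hμ y hy => mem_iSup_wtSpace hμ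
          (mem_wtSpace_prod.2 ⟨zero_mem _, hy⟩)) x
    rintro ⟨x, y⟩
    have := add_mem (h1 x) (h2 y)
    simpa using this
  have hS : StarData (η.prod η') o (fun i => (e i, e' i)) (fun i => (f i, f' i))
      (s, s') (t, t') :=
    { weighted := hw
      comm := fun c d => Prod.ext (hK.comm c d) (hK'.comm c d)
      memE := fun i _ => mem_wtSpace_prod.2 ⟨he i, he' i⟩
      memG := fun i _ => mem_wtSpace_prod.2 ⟨hf i, hf' i⟩
      memσ := mem_wtSpace_prod.2 ⟨hs, hs'⟩
      memτ := mem_wtSpace_prod.2 ⟨ht, ht'⟩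
      lieEG := fun i hi => ⟨_, Prod.ext (hef i hi).1 (hef' i hi).1⟩
      lieστ := ⟨_, Prod.ext hst hst'⟩ }
  -- The subalgebra generated by the pairs of corresponding root vectors will turn out to be the
  -- graph of the isomorphism.
  set D := LieSubalgebra.lieSpan F (K × K') {x | (∃ i, i ≠ o ∧ x = (e i, e' i)) ∨
    (∃ i, i ≠ o ∧ x = (f i, f' i)) ∨ x = (s, s') ∨ x = (t, t')} with hD
  have hDe : ∀ i ≠ o, (e i, e' i) ∈ D :=
    fun i hi => LieSubalgebra.subset_lieSpan (Or.inl ⟨i, hi, rfl⟩)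
  have hDf : ∀ i ≠ o, (f i, f' i) ∈ D :=
    fun i hi => LieSubalgebra.subset_lieSpan (Or.inr (Or.inl ⟨i, hi, rfl⟩))
  have hDs : (s, s') ∈ D := LieSubalgebra.subset_lieSpan (Or.inr (Or.inr (Or.inl rfl)))
  have hDt : (t, t') ∈ D := LieSubalgebra.subset_lieSpan (Or.inr (Or.inr (Or.inr rfl)))
  have hDη : ∀ c, (η c, η' c) ∈ D := by
    intro c
    have h0 : c = ∑ i, c i • (Pi.single i 1 : ι → F) := by
      ext j
      simp [Finset.sum_apply, Pi.single_apply]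
    have hso : (η.prod η') (Pi.single o 1) ∈ D := by
      rw [← corootVec_single]
      change (η _, η' _) ∈ D
      rw [← hst, ← hst']
      exact D.lie_mem hDs hDt
    change (η.prod η') c ∈ D
    rw [h0, map_sum]
    refine sum_mem fun i _ => ?_
    rw [map_smul]
    refine D.smul_mem _ ?_
    by_cases hi : i = o
    · rw [hi]; exact hso
    · have h3 : (η.prod η') (corootVec F (starWt o i)) ∈ D := by
        change (η _, η' _) ∈ D
        rw [← (hef i hi).1, ← (hef' i hi).1]
        exact D.lie_mem (hDe i hi) (hDf i hi)
      rw [corootVec_starWt hi, map_sub] at h3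
      simpa using add_mem h3 hso
  let p₁ : D →ₗ⁅F⁆ K := (LieHom.fst F K K').comp D.incl
  let p₂ : D →ₗ⁅F⁆ K' := (LieHom.snd F K K').comp D.incl
  -- The image of each projection contains a star of root vectors, hence is everything.
  have hp₁ : Function.Surjective p₁ := by
    rw [← LieHom.range_eq_top]
    exact hK.subalgebra_eq_top (fun i _ => he i) (fun i hi => (hef i hi).2.1)
      (fun i hi => ⟨⟨_, hDe i hi⟩, rfl⟩) (fun i _ => hf i) (fun i hi => (hef i hi).2.2)
      (fun i hi => ⟨⟨_, hDf i hi⟩, rfl⟩) hs hs0 ⟨⟨_, hDs⟩, rfl⟩ ht ht0 ⟨⟨_, hDt⟩, rfl⟩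
  have hp₂ : Function.Surjective p₂ := by
    rw [← LieHom.range_eq_top]
    exact hK'.subalgebra_eq_top (fun i _ => he' i) (fun i hi => (hef' i hi).2.1)
      (fun i hi => ⟨⟨_, hDe i hi⟩, rfl⟩) (fun i _ => hf' i) (fun i hi => (hef' i hi).2.2)
      (fun i hi => ⟨⟨_, hDf i hi⟩, rfl⟩) hs' hs0' ⟨⟨_, hDs⟩, rfl⟩ ht' ht0' ⟨⟨_, hDt⟩, rfl⟩
  -- By surjectivity of `p₁` these `x` form an ideal of `K`. Were it all of `K`, then `(s, 0)` would
  -- lie in `D`; but the elements of weight `2ε_o` in `D` are multiples of `(s, s')`.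
  have hi₂ : ∀ x, (x, 0) ∈ D → x = 0 := by
    let J : LieIdeal F K :=
      { D.toSubmodule.comap (LinearMap.inl F K K') with
        lie_mem := by
          intro y x hx
          obtain ⟨⟨⟨y, y'⟩, hy⟩, rfl⟩ := hp₁ y
          have := D.lie_mem hy (show ((x, 0) : K × K') ∈ D from hx)
          rw [LieAlgebra.Prod.bracket_apply, lie_zero] at this
          exact this }
    have hJ : J = ⊥ := by
      refine (hK.simple J).resolve_right fun h => ?_
      have hsJ : s ∈ J := by rw [h]; exact LieSubmodule.mem_top _
      obtain ⟨c, hc⟩ := hS.exists_smul_of_mem (show ((s, 0) : K × K') ∈ D from hsJ)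
        (mem_wtSpace_prod.2 ⟨hs, zero_mem _⟩)
      rcases smul_eq_zero.1 (congrArg Prod.snd hc).symm with h | h
      · exact hs0 (by simpa [h] using congrArg Prod.fst hc)
      · exact hs0' h
    intro x hx
    have : x ∈ J := hx
    rwa [hJ, LieSubmodule.mem_bot] at this
  have hi₁ : ∀ x, (0, x) ∈ D → x = 0 := by
    let J : LieIdeal F K' :=
      { D.toSubmodule.comap (LinearMap.inr F K K') with
        lie_mem := by
          intro y x hx
          obtain ⟨⟨⟨y, y'⟩, hy⟩, rfl⟩ := hp₂ y
          have := D.lie_mem hy (show ((0, x) : K × K') ∈ D from hx)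
          rw [LieAlgebra.Prod.bracket_apply, lie_zero] at this
          exact this }
    have hJ : J = ⊥ := by
      refine (hK'.simple J).resolve_right fun h => ?_
      have hsJ : s' ∈ J := by rw [h]; exact LieSubmodule.mem_top _
      obtain ⟨c, hc⟩ := hS.exists_smul_of_mem (show ((0, s') : K × K') ∈ D from hsJ)
        (mem_wtSpace_prod.2 ⟨zero_mem _, hs'⟩)
      rcases smul_eq_zero.1 (congrArg Prod.fst hc).symm with h | h
      · exact hs0' (by simpa [h] using congrArg Prod.snd hc)
      · exact hs0 h
    intro x hx
    have : x ∈ J := hx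
    rwa [hJ, LieSubmodule.mem_bot] at this
  have hb₁ : Function.Bijective p₁ := by
    refine ⟨(injective_iff_map_eq_zero p₁).2 ?_, hp₁⟩
    rintro ⟨⟨x, y⟩, hxy⟩ h0
    obtain rfl : x = 0 := h0
    exact Subtype.ext (Prod.ext rfl (hi₁ y hxy))
  have hb₂ : Function.Bijective p₂ := by
    refine ⟨(injective_iff_map_eq_zero p₂).2 ?_, hp₂⟩
    rintro ⟨⟨x, y⟩, hxy⟩ h0
    obtain rfl : y = 0 := h0
    exact Subtype.ext (Prod.ext (hi₂ x hxy) rfl)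
  let q₁ := LieEquiv.ofBijective p₁ hb₁
  let q₂ := LieEquiv.ofBijective p₂ hb₂
  refine ⟨q₁.symm.trans q₂, fun c => ?_⟩
  have h1 : q₁.symm (η c) = ⟨(η c, η' c), hDη c⟩ := by
    rw [LieEquiv.symm_apply_eq]
    rfl
  change q₂ (q₁.symm (η c)) = _
  rw [h1]
  rfl

end Uniqueness

/-! ### The symplectic Lie algebra -/

section Symplectic

open LieAlgebra.Symplectic

variable {F ι : Type*} [Field F] [Fintype ι] [DecidableEq ι]

/-- The sign of an index. -/
def sgn (F : Type*) [Field F] : ι ⊕ ι → F := Sum.elim (fun _ => 1) (fun _ => -1)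

@[simp] theorem sgn_mul_self (p : ι ⊕ ι) : sgn F p * sgn F p = 1 := by
  cases p <;> simp [sgn]

@[simp] theorem sgn_swap (p : ι ⊕ ι) : sgn F p.swap = -sgn F p := by
  cases p <;> simp [sgn]

/-- The adjoint with respect to the alternating form. -/
def spAdj : Matrix (ι ⊕ ι) (ι ⊕ ι) F →ₗ[F] Matrix (ι ⊕ ι) (ι ⊕ ι) F where
  toFun A := Matrix.of fun r s => sgn F r * sgn F s * A s.swap r.swap
  map_add' A B := by ext r s; simp [mul_add]
  map_smul' c A := by ext r s; simp [mul_left_comm]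

theorem spAdj_apply (A : Matrix (ι ⊕ ι) (ι ⊕ ι) F) (r s : ι ⊕ ι) :
    spAdj A r s = sgn F r * sgn F s * A s.swap r.swap := rfl

theorem spAdj_spAdj (A : Matrix (ι ⊕ ι) (ι ⊕ ι) F) : spAdj (spAdj A) = A := by
  ext r s
  rw [spAdj_apply, spAdj_apply, sgn_swap, sgn_swap, Sum.swap_swap, Sum.swap_swap]
  linear_combination (sgn F s * sgn F s * A r s) * sgn_mul_self (F := F) r +
    A r s * sgn_mul_self (F := F) s

theorem spAdj_mul (A B : Matrix (ι ⊕ ι) (ι ⊕ ι) F) : spAdj (A * B) = spAdj B * spAdj A := by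
  ext r s
  rw [spAdj_apply, Matrix.mul_apply, Matrix.mul_apply, Finset.mul_sum,
    ← (Equiv.sumComm ι ι).sum_comp]
  refine Finset.sum_congr rfl fun t _ => ?_
  rw [spAdj_apply, spAdj_apply, Equiv.sumComm_apply]
  linear_combination (-sgn F r * sgn F s * A s.swap t.swap * B t.swap r.swap) *
    sgn_mul_self (F := F) t

theorem J_apply (p q : ι ⊕ ι) : Matrix.J ι F p q = if q = p.swap then -sgn F p else 0 := by
  rcases p with i | i <;> rcases q with j | j <;>
    simp [Matrix.J, sgn, Matrix.one_apply, eq_comm, neg_ite]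

theorem transpose_mul_J (A : Matrix (ι ⊕ ι) (ι ⊕ ι) F) (p q : ι ⊕ ι) :
    (A.transpose * Matrix.J ι F) p q = sgn F q * A q.swap p := by
  rw [Matrix.mul_apply, Finset.sum_eq_single q.swap]
  · rw [J_apply, if_pos (by simp), Matrix.transpose_apply, sgn_swap]
    ring
  · intro r _ hr
    rw [J_apply, if_neg, mul_zero]
    rintro rfl
    exact hr (by simp)
  · simp

theorem J_mul_apply (A : Matrix (ι ⊕ ι) (ι ⊕ ι) F) (p q : ι ⊕ ι) :
    (Matrix.J ι F * A) p q = -sgn F p * A p.swap q := by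
  rw [Matrix.mul_apply, Finset.sum_eq_single p.swap]
  · rw [J_apply, if_pos rfl]
  · intro r _ hr
    rw [J_apply, if_neg hr, zero_mul]
  · simp

/-- The matrix `J` has one nonzero entry in each row, so adjointness becomes the entrywise formula
of `spAdj`, with which all later computations are done. -/
theorem isAdjointPair_iff (A B : Matrix (ι ⊕ ι) (ι ⊕ ι) F) :
    Matrix.IsAdjointPair (Matrix.J ι F) (Matrix.J ι F) A B ↔ spAdj A = B := by
  have hs : ∀ p : ι ⊕ ι, sgn F p ≠ 0 := by
    intro p h
    have := sgn_mul_self (F := F) p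
    rw [h, zero_mul] at this
    exact zero_ne_one this
  rw [Matrix.IsAdjointPair, ← Matrix.ext_iff, ← Matrix.ext_iff]
  constructor
  · intro h r s
    have := h r.swap s
    rw [transpose_mul_J, J_mul_apply, sgn_swap, Sum.swap_swap, neg_neg] at this
    rw [spAdj_apply, mul_assoc, this, ← mul_assoc, sgn_mul_self, one_mul]
  · intro h r s
    rw [transpose_mul_J, J_mul_apply, ← h, spAdj_apply, sgn_swap, Sum.swap_swap]
    linear_combination (-sgn F s * A s.swap r) * sgn_mul_self (F := F) r

theorem mem_sp_iff {A : Matrix (ι ⊕ ι) (ι ⊕ ι) F} : A ∈ sp ι F ↔ spAdj A = -A := by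
  rw [sp, mem_skewAdjointMatricesLieSubalgebra, mem_skewAdjointMatricesSubmodule]
  exact isAdjointPair_iff _ _

theorem mem_spS_iff {A : Matrix (ι ⊕ ι) (ι ⊕ ι) F} :
    A ∈ spS ι F ↔ spAdj A = A ∧ A.trace = 0 := by
  rw [spS, Submodule.mem_inf, mem_selfAdjointMatricesSubmodule, LinearMap.mem_ker]
  exact and_congr (isAdjointPair_iff _ _) Iff.rfl

theorem sub_spAdj_mem (A : Matrix (ι ⊕ ι) (ι ⊕ ι) F) : A - spAdj A ∈ sp ι F := by
  rw [mem_sp_iff, map_sub, spAdj_spAdj, neg_sub]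

theorem coe_sp_add (x y : sp ι F) : ((x + y : sp ι F) : Matrix (ι ⊕ ι) (ι ⊕ ι) F) =
    (x : Matrix (ι ⊕ ι) (ι ⊕ ι) F) + y := rfl

theorem coe_sp_smul (c : F) (x : sp ι F) : ((c • x : sp ι F) : Matrix (ι ⊕ ι) (ι ⊕ ι) F) =
    c • (x : Matrix (ι ⊕ ι) (ι ⊕ ι) F) := rfl

theorem coe_sp_lie (x y : sp ι F) : ((⁅x, y⁆ : sp ι F) : Matrix (ι ⊕ ι) (ι ⊕ ι) F) =
    (x : Matrix (ι ⊕ ι) (ι ⊕ ι) F) * (y : Matrix (ι ⊕ ι) (ι ⊕ ι) F) -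
      (y : Matrix (ι ⊕ ι) (ι ⊕ ι) F) * (x : Matrix (ι ⊕ ι) (ι ⊕ ι) F) := rfl

/-- The skew part of a matrix (up to a factor). -/
def spProj : Matrix (ι ⊕ ι) (ι ⊕ ι) F →ₗ[F] sp ι F where
  toFun A := ⟨A - spAdj A, sub_spAdj_mem A⟩
  map_add' A B := Subtype.ext (by rw [coe_sp_add]; simp only [map_add]; abel)
  map_smul' c A := Subtype.ext (by
    rw [RingHom.id_apply, coe_sp_smul]; simp only [map_smul, smul_sub])

theorem coe_spProj (A : Matrix (ι ⊕ ι) (ι ⊕ ι) F) :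
    (spProj A : Matrix (ι ⊕ ι) (ι ⊕ ι) F) = A - spAdj A := rfl

theorem lie_spProj (g : sp ι F) (A : Matrix (ι ⊕ ι) (ι ⊕ ι) F) :
    ⁅g, spProj A⁆ = spProj ((g : Matrix (ι ⊕ ι) (ι ⊕ ι) F) * A -
      A * (g : Matrix (ι ⊕ ι) (ι ⊕ ι) F)) := by
  apply Subtype.ext
  have hg := mem_sp_iff.1 g.2
  rw [coe_sp_lie, coe_spProj, coe_spProj, map_sub, spAdj_mul,
    spAdj_mul, hg]
  noncomm_ring

/-- The standard spanning elements of the symplectic Lie algebra. -/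
def spX (F : Type*) [Field F] (p q : ι ⊕ ι) : sp ι F := spProj (Matrix.single p q 1)

theorem spAdj_single (p q : ι ⊕ ι) :
    spAdj (Matrix.single p q (1 : F)) = (sgn F p * sgn F q) • Matrix.single q.swap p.swap 1 := by
  ext r s
  rw [spAdj_apply, Matrix.smul_apply, Matrix.single_apply, Matrix.single_apply]
  by_cases h : p = s.swap ∧ q = r.swap
  · obtain ⟨rfl, rfl⟩ := h
    simp
    ring
  · rw [if_neg h, if_neg, mul_zero, smul_zero]
    rintro ⟨rfl, rfl⟩
    exact h (by simp)

theorem spX_apply (p q r s : ι ⊕ ι) :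
    (spX F p q : Matrix (ι ⊕ ι) (ι ⊕ ι) F) r s = (if p = r ∧ q = s then 1 else 0) -
      sgn F p * sgn F q * if q.swap = r ∧ p.swap = s then 1 else 0 := by
  rw [spX, coe_spProj, spAdj_single, Matrix.sub_apply, Matrix.smul_apply, Matrix.single_apply,
    Matrix.single_apply, smul_eq_mul]

theorem spProj_eq_sum (A : Matrix (ι ⊕ ι) (ι ⊕ ι) F) :
    spProj A = ∑ p, ∑ q, A p q • spX F p q := by
  conv_lhs => rw [Matrix.matrix_eq_sum_single A]
  rw [map_sum]
  refine Finset.sum_congr rfl fun p _ => ?_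
  rw [map_sum]
  refine Finset.sum_congr rfl fun q _ => ?_
  rw [spX, ← map_smul, Matrix.smul_single, smul_eq_mul, mul_one]

theorem spProj_coe (g : sp ι F) : spProj (g : Matrix (ι ⊕ ι) (ι ⊕ ι) F) = (2 : F) • g := by
  apply Subtype.ext
  rw [coe_spProj, mem_sp_iff.1 g.2, sub_neg_eq_add, coe_sp_smul, two_smul]

/-- `spProj` doubles the elements of `sp`, so the `spX p q` span wherever 2 is invertible. -/
theorem sp_induction [CharZero F] (N : Submodule F (sp ι F)) (h : ∀ p q, spX F p q ∈ N)
    (g : sp ι F) : g ∈ N := by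
  have h1 := spProj_coe g
  rw [spProj_eq_sum] at h1
  refine (N.smul_mem_iff (two_ne_zero (α := F))).1 ?_
  rw [← h1]
  exact N.sum_mem fun p _ => N.sum_mem fun q _ => N.smul_mem _ (h p q)

theorem lie_spX (g : sp ι F) (p q : ι ⊕ ι) :
    ⁅g, spX F p q⁆ = ∑ r, (g : Matrix (ι ⊕ ι) (ι ⊕ ι) F) r p • spX F r q -
      ∑ r, (g : Matrix (ι ⊕ ι) (ι ⊕ ι) F) q r • spX F p r := by
  rw [spX, lie_spProj, map_sub]
  congr 1
  · rw [spProj_eq_sum]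
    refine Finset.sum_congr rfl fun r _ => ?_
    rw [Finset.sum_eq_single q]
    · simp
    · intro s _ hs
      simp [Matrix.mul_single_apply_of_ne, hs]
    · simp
  · rw [spProj_eq_sum, Finset.sum_eq_single p]
    · simp
    · intro s _ hs
      simp [Matrix.single_mul_apply_of_ne, hs]
    · simp

/-! #### The torus -/

/-- The diagonal torus. -/
def spTorus (F ι : Type*) [Field F] [Fintype ι] [DecidableEq ι] : (ι → F) →ₗ[F] sp ι F where
  toFun c := ⟨Matrix.diagonal (Sum.elim c (-c)), by
    rw [mem_sp_iff]
    ext r s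
    rw [spAdj_apply, Matrix.neg_apply, Matrix.diagonal_apply, Matrix.diagonal_apply]
    by_cases h : r = s
    · subst h
      rw [if_pos rfl, if_pos rfl, sgn_mul_self, one_mul]
      cases r <;> simp
    · rw [if_neg h, if_neg (fun e => h (by
        simpa using (congrArg Sum.swap e).symm))]
      simp⟩
  map_add' c d := by
    apply Subtype.ext
    rw [coe_sp_add, Matrix.diagonal_add]
    refine congrArg Matrix.diagonal (funext fun r => ?_)
    rcases r with i | i <;> simp [add_comm]
  map_smul' a c := by
    apply Subtype.ext
    rw [RingHom.id_apply, coe_sp_smul, ← Matrix.diagonal_smul]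
    refine congrArg Matrix.diagonal (funext fun r => ?_)
    rcases r with i | i <;> simp

theorem coe_spTorus (c : ι → F) : (spTorus F ι c : Matrix (ι ⊕ ι) (ι ⊕ ι) F) =
    Matrix.diagonal (Sum.elim c (-c)) := rfl

/-- The weight of a basis vector. -/
def wt : ι ⊕ ι → ι → ℤ := Sum.elim (fun i => Pi.single i 1) (fun i => -Pi.single i 1)

theorem wt_swap (p : ι ⊕ ι) : wt p.swap = -wt p := by
  cases p <;> simp [wt]

theorem wtEval_wt (p : ι ⊕ ι) (c : ι → F) : wtEval (wt p) c = Sum.elim c (-c) p := by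
  cases p <;> simp [wt, wtEval_neg, wtEval_single_left]

theorem spX_mem (p q : ι ⊕ ι) : spX F p q ∈ wtSpace (spTorus F ι) (sp ι F) (wt p - wt q) := by
  intro c
  rw [lie_spX, wtEval_sub, wtEval_wt, wtEval_wt, sub_smul]
  congr 1
  · rw [Finset.sum_eq_single p]
    · rw [coe_spTorus, Matrix.diagonal_apply_eq]
    · intro r _ hr
      rw [coe_spTorus, Matrix.diagonal_apply_ne _ hr, zero_smul]
    · simp
  · rw [Finset.sum_eq_single q]
    · rw [coe_spTorus, Matrix.diagonal_apply_eq]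
    · intro r _ hr
      rw [coe_spTorus, Matrix.diagonal_apply_ne _ hr.symm, zero_smul]
    · simp

/-- The weight `wt p` with values in `F`. -/
def wtF (F : Type*) [Field F] (p : ι ⊕ ι) : ι → F := fun i => (wt p i : F)

theorem wtF_swap (p : ι ⊕ ι) : wtF F p.swap = -wtF F p := by
  ext i
  simp [wtF, wt_swap]

theorem spX_self (p : ι ⊕ ι) : spX F p p = spTorus F ι (wtF F p) := by
  apply Subtype.ext
  ext r s
  rw [spX_apply, coe_spTorus, Matrix.diagonal_apply]
  by_cases h : r = s
  · subst h
    simp only [and_self, sgn_mul_self, one_mul, if_true]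
    rcases p with i | i <;> rcases r with j | j <;>
      simp [wtF, wt, Pi.single_apply, eq_comm]
  · rw [if_neg h, if_neg, if_neg, mul_zero, sub_zero]
    · rintro ⟨rfl, rfl⟩; exact h rfl
    · rintro ⟨rfl, rfl⟩; exact h rfl

/-- The factor in the bracket of opposite root vectors. -/
def spκ (p q : ι ⊕ ι) : ℤ := if q = p.swap then 2 else 1

/-- For `q = p.swap`, a long root, the two matrix units making up `spX p q` coincide and the entry
is 2 instead of 1; this is the factor `spκ`. -/
theorem lie_spX_spX {p q : ι ⊕ ι} (hpq : p ≠ q) : ⁅spX F p q, spX F q p⁆ =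
    spTorus F ι ((spκ p q : F) • (wtF F p - wtF F q)) := by
  have hps : p.swap ≠ p := by cases p <;> simp
  have hqs : q ≠ q.swap := by cases q <;> simp
  rw [lie_spX, map_smul, map_sub, ← spX_self, ← spX_self, smul_sub, spκ]
  congr 1
  · rw [Finset.sum_eq_single p]
    · congr 1
      rw [spX_apply]
      by_cases h : q = p.swap
      · subst h
        simp
        norm_num
      · have : p.swap ≠ q := Ne.symm h
        simp [h, this]
    · intro r _ hr
      rw [spX_apply, if_neg (by rintro ⟨rfl, -⟩; exact hr rfl), if_neg, mul_zero, sub_zero,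
        zero_smul]
      rintro ⟨rfl, rfl⟩
      exact hr (by simp)
    · simp
  · rw [Finset.sum_eq_single q]
    · congr 1
      rw [spX_apply]
      by_cases h : q = p.swap
      · subst h
        simp
        norm_num
      · have : p.swap ≠ q := Ne.symm h
        simp [h, this]
    · intro r _ hr
      rw [spX_apply, if_neg (by rintro ⟨-, rfl⟩; exact hr rfl), if_neg, mul_zero, sub_zero,
        zero_smul]
      rintro ⟨rfl, rfl⟩
      exact hr (by simp)
    · simp

/-! #### The Casimir operator -/

variable {M : Type*} [AddCommGroup M] [Module F M] [LieRingModule (sp ι F) M]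
  [LieModule F (sp ι F) M]

/-- The Casimir operator. -/
def casimir (F ι M : Type*) [Field F] [Fintype ι] [DecidableEq ι] [AddCommGroup M] [Module F M]
    [LieRingModule (sp ι F) M] [LieModule F (sp ι F) M] : M →ₗ[F] M :=
  ∑ p : ι ⊕ ι, ∑ q : ι ⊕ ι, (LieModule.toEnd F (sp ι F) M (spX F p q)) ∘ₗ
    (LieModule.toEnd F (sp ι F) M (spX F q p))

theorem casimir_apply (m : M) :
    casimir F ι M m = ∑ p : ι ⊕ ι, ∑ q : ι ⊕ ι, ⁅spX F p q, ⁅spX F q p, m⁆⁆ := by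
  simp [casimir, LinearMap.sum_apply]

/-- The commutator with `g` differentiates each of the two factors. By `lie_spX` the resulting
triple sums cancel in pairs after the summation indices are renamed. -/
theorem casimir_lie (g : sp ι F) (m : M) : casimir F ι M ⁅g, m⁆ = ⁅g, casimir F ι M m⁆ := by
  have h1 : ∀ p q : ι ⊕ ι, ⁅g, ⁅spX F p q, ⁅spX F q p, m⁆⁆⁆ =
      ⁅spX F p q, ⁅spX F q p, ⁅g, m⁆⁆⁆ + (⁅⁅g, spX F p q⁆, ⁅spX F q p, m⁆⁆ +
        ⁅spX F p q, ⁅⁅g, spX F q p⁆, m⁆⁆) := by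
    intro p q
    rw [leibniz_lie g, leibniz_lie g, lie_add]
    abel
  rw [casimir_apply, casimir_apply, lie_sum]
  simp only [lie_sum, h1, Finset.sum_add_distrib]
  rw [left_eq_add]
  simp only [lie_spX, sub_lie, sum_lie, smul_lie, lie_sub, lie_sum, lie_smul,
    Finset.sum_sub_distrib]
  set B : ι ⊕ ι → ι ⊕ ι → ι ⊕ ι → ι ⊕ ι → M := fun a b c d => ⁅spX F a b, ⁅spX F c d, m⁆⁆
  have e1 : ∑ p, ∑ q, ∑ r, (g : Matrix (ι ⊕ ι) (ι ⊕ ι) F) r p • B r q q p =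
      ∑ p, ∑ q, ∑ r, (g : Matrix (ι ⊕ ι) (ι ⊕ ι) F) p r • B p q q r := by
    rw [Finset.sum_comm]
    conv_rhs => rw [Finset.sum_comm]
    refine Finset.sum_congr rfl fun q _ => ?_
    rw [Finset.sum_comm]
  have e2 : ∑ p, ∑ q, ∑ r, (g : Matrix (ι ⊕ ι) (ι ⊕ ι) F) q r • B p r q p =
      ∑ p, ∑ q, ∑ r, (g : Matrix (ι ⊕ ι) (ι ⊕ ι) F) r q • B p q r p := by
    refine Finset.sum_congr rfl fun p _ => ?_
    rw [Finset.sum_comm]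
  change (∑ p, ∑ q, ∑ r, (g : Matrix (ι ⊕ ι) (ι ⊕ ι) F) r p • B r q q p -
    ∑ p, ∑ q, ∑ r, (g : Matrix (ι ⊕ ι) (ι ⊕ ι) F) q r • B p r q p) +
    (∑ p, ∑ q, ∑ r, (g : Matrix (ι ⊕ ι) (ι ⊕ ι) F) r q • B p q r p -
    ∑ p, ∑ q, ∑ r, (g : Matrix (ι ⊕ ι) (ι ⊕ ι) F) p r • B p q q r) = 0
  rw [e1, e2]
  abel

end Symplectic

/-! ### Highest weights -/

section Heights

variable {ι : Type*}

/-- A system of heights: `o₁` and `o₂` carry the largest and the second largest height. -/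
structure IsHeight (a : ι → ℤ) (o₁ o₂ : ι) : Prop where
  pos : ∀ i, 0 < a i
  inj : Function.Injective a
  ne : o₁ ≠ o₂
  lt₁ : ∀ i, i ≠ o₁ → a i < a o₁
  lt₂ : ∀ i, i ≠ o₁ → i ≠ o₂ → a i < a o₂

/-- The height of an index. -/
def ht (a : ι → ℤ) : ι ⊕ ι → ℤ := Sum.elim a (-a)

@[simp] theorem ht_inl (a : ι → ℤ) (i : ι) : ht a (Sum.inl i) = a i := rfl

@[simp] theorem ht_inr (a : ι → ℤ) (i : ι) : ht a (Sum.inr i) = -a i := rfl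

@[simp] theorem ht_swap (a : ι → ℤ) (p : ι ⊕ ι) : ht a p.swap = -ht a p := by
  cases p <;> simp

theorem IsHeight.ht_injective {a : ι → ℤ} {o₁ o₂ : ι} (h : IsHeight a o₁ o₂) :
    Function.Injective (ht a) := by
  rintro (i | i) (j | j) hij
  · exact congrArg Sum.inl (h.inj hij)
  · have h1 := h.pos i
    have h2 := h.pos j
    simp only [ht_inl, ht_inr] at hij
    omega
  · have h1 := h.pos i
    have h2 := h.pos j
    simp only [ht_inl, ht_inr] at hij
    omega
  · simp only [ht_inr, neg_inj] at hij
    exact congrArg Sum.inr (h.inj hij)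

theorem IsHeight.ht_lt {a : ι → ℤ} {o₁ o₂ : ι} (h : IsHeight a o₁ o₂) {p : ι ⊕ ι}
    (hp : p ≠ Sum.inl o₁) : ht a p < a o₁ := by
  rcases p with i | i
  · exact h.lt₁ i fun e => hp (congrArg Sum.inl e)
  · have h1 := h.pos i
    have h2 := h.pos o₁
    rw [ht_inr]
    omega

theorem IsHeight.ht_lt₂ {a : ι → ℤ} {o₁ o₂ : ι} (h : IsHeight a o₁ o₂) {p : ι ⊕ ι}
    (hp : p ≠ Sum.inl o₁) (hp' : p ≠ Sum.inl o₂) : ht a p < a o₂ := by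
  rcases p with i | i
  · exact h.lt₂ i (fun e => hp (congrArg Sum.inl e)) fun e => hp' (congrArg Sum.inl e)
  · have h1 := h.pos i
    have h2 := h.pos o₂
    rw [ht_inr]
    omega

theorem exists_isHeight [Fintype ι] [DecidableEq ι] {o₁ o₂ : ι} (h : o₁ ≠ o₂) :
    ∃ a : ι → ℤ, IsHeight a o₁ o₂ := by
  let e := Fintype.equivFin ι
  let n := Fintype.card ι
  have hb : ∀ i, (e i : ℤ) < n := fun i => by exact_mod_cast (e i).2
  have hinj : ∀ i j, (e i : ℤ) = e j → i = j := fun i j h =>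
    e.injective (Fin.ext (by exact_mod_cast h))
  -- The other indices take values between 1 and `n`, which leaves `n + 1` and `n + 2` for the two
  -- distinguished ones.
  refine ⟨fun i => if i = o₁ then n + 2 else if i = o₂ then n + 1 else e i + 1, ?_, ?_, h, ?_, ?_⟩
  · intro i
    split_ifs <;> omega
  · intro i j hij
    have h1 := hb i
    have h2 := hb j
    have h3 := hinj i j
    dsimp only at hij
    split_ifs at hij with c1 c2 c3 c4 c5 c6 c7 c8
    all_goals first | omega | (subst_vars; rfl) | exact h3 (by omega)
  · intro i hi
    have h1 := hb i
    rw [if_neg hi, if_pos rfl]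
    split_ifs <;> omega
  · intro i hi hi'
    have h1 := hb i
    rw [if_neg hi, if_neg hi', if_neg h.symm, if_pos rfl]
    omega

variable [Fintype ι]

/-- The height of a weight. -/
def hgt (a : ι → ℤ) (μ : ι → ℤ) : ℤ := ∑ i, a i * μ i

theorem hgt_add (a μ ν : ι → ℤ) : hgt a (μ + ν) = hgt a μ + hgt a ν := by
  simp [hgt, mul_add, Finset.sum_add_distrib]

theorem hgt_sub (a μ ν : ι → ℤ) : hgt a (μ - ν) = hgt a μ - hgt a ν := by
  simp [hgt, mul_sub, Finset.sum_sub_distrib]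

theorem hgt_wt [DecidableEq ι] (a : ι → ℤ) (p : ι ⊕ ι) : hgt a (wt p) = ht a p := by
  cases p <;> simp [hgt, wt, Pi.single_apply]

/-- The value of a weight at an index. -/
def pr (μ : ι → ℤ) : ι ⊕ ι → ℤ := Sum.elim μ (-μ)

@[simp] theorem pr_inl (μ : ι → ℤ) (i : ι) : pr μ (Sum.inl i) = μ i := rfl

@[simp] theorem pr_inr (μ : ι → ℤ) (i : ι) : pr μ (Sum.inr i) = -μ i := rfl

variable [DecidableEq ι] {F : Type*} [Field F]

theorem wtEval_wtF (μ : ι → ℤ) (p : ι ⊕ ι) : wtEval μ (wtF F p) = (pr μ p : F) := by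
  cases p <;> simp [wtF, wt, wtEval, Pi.single_apply]

theorem pr_wt_self (p : ι ⊕ ι) : pr (wt p) p = 1 := by
  cases p <;> simp [wt]

theorem pr_wt_swap (p : ι ⊕ ι) : pr (wt p.swap) p = -1 := by
  cases p <;> simp [wt]

theorem pr_wt_ne {p q : ι ⊕ ι} (h : q ≠ p) (h' : q ≠ p.swap) : pr (wt q) p = 0 := by
  rcases p with i | i <;> rcases q with j | j <;> simp_all [wt, eq_comm]

theorem pr_sub (μ ν : ι → ℤ) (p : ι ⊕ ι) : pr (μ - ν) p = pr μ p - pr ν p := by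
  cases p <;> simp; abel

theorem wt_injective : Function.Injective (wt : ι ⊕ ι → ι → ℤ) := by
  intro p q h
  by_contra hne
  have h1 := pr_wt_self p
  rw [h] at h1
  by_cases h2 : q = p.swap
  · rw [h2, pr_wt_swap] at h1
    omega
  · rw [pr_wt_ne (Ne.symm hne) h2] at h1
    omega

theorem wt_sub_ne_zero {p q : ι ⊕ ι} (h : p ≠ q) : wt p - wt q ≠ 0 :=
  sub_ne_zero.2 fun e => h (wt_injective e)

theorem swap_ne_self (p : ι ⊕ ι) : p.swap ≠ p := by
  cases p <;> simp

theorem lOne_wt (p : ι ⊕ ι) : lOne (wt p) = 1 := by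
  cases p <;> simp [wt, lOne_neg, lOne_single]

/-- The value of the simple coroot-like element on a weight. -/
theorem wtEval_coroot (μ : ι → ℤ) (p q : ι ⊕ ι) :
    wtEval μ ((spκ p q : F) • (wtF F p - wtF F q)) = ((spκ p q * (pr μ p - pr μ q) : ℤ) : F) := by
  rw [wtEval_smul_right, wtEval_sub_right, wtEval_wtF, wtEval_wtF]
  push_cast
  ring

theorem pr_coroot {p q : ι ⊕ ι} (h : p ≠ q) :
    pr (wt p - wt q) p - pr (wt p - wt q) q = 2 * spκ p q := by
  rw [pr_sub, pr_sub, pr_wt_self, pr_wt_self, spκ]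
  split_ifs with hq
  · subst hq
    rw [pr_wt_swap]
    have := pr_wt_swap p.swap
    rw [Sum.swap_swap] at this
    rw [this]
    norm_num
  · rw [pr_wt_ne h.symm hq, pr_wt_ne h]
    · norm_num
    · rintro rfl
      exact hq (by simp)

end Heights

/-! ### Highest weight vectors and dominant weights. -/

section HighestWeight

open LieAlgebra.Symplectic

variable {F ι : Type*} [Field F] [CharZero F] [Fintype ι] [DecidableEq ι]
  {M : Type*} [AddCommGroup M] [Module F M] [LieRingModule (sp ι F) M] [LieModule F (sp ι F) M]
  {a : ι → ℤ} {o₁ o₂ : ι}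

/-- `m` is annihilated by the root vectors of positive height. -/
def IsHW (F : Type*) [Field F] {M : Type*} [AddCommGroup M] [Module F M]
    [LieRingModule (sp ι F) M] (a : ι → ℤ) (m : M) : Prop :=
  ∀ p q, ht a q < ht a p → ⁅spX F p q, m⁆ = 0

theorem lie_spX_mem {μ : ι → ℤ} {m : M} (hm : m ∈ wtSpace (spTorus F ι) M μ) (p q : ι ⊕ ι) :
    ⁅spX F p q, m⁆ ∈ wtSpace (spTorus F ι) M (μ + (wt p - wt q)) :=
  lie_mem_wtSpace' (spX_mem p q) hm (add_comm _ _)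

theorem lie_spX_self {μ : ι → ℤ} {m : M} (hm : m ∈ wtSpace (spTorus F ι) M μ) (p : ι ⊕ ι) :
    ⁅spX F p p, m⁆ = (pr μ p : F) • m := by
  rw [spX_self, hm, wtEval_wtF]

theorem lie_spX_lie_spX {μ : ι → ℤ} {m : M} (hm : m ∈ wtSpace (spTorus F ι) M μ) {p q : ι ⊕ ι}
    (h : p ≠ q) (h0 : ⁅spX F p q, m⁆ = 0) :
    ⁅spX F p q, ⁅spX F q p, m⁆⁆ = ((spκ p q * (pr μ p - pr μ q) : ℤ) : F) • m := by
  rw [leibniz_lie, lie_spX_spX h, h0, lie_zero, add_zero, hm, wtEval_coroot]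

/-- The submodule contains the weight components of its elements, and only finitely many weights are
available. A nonzero weight vector of maximal height is killed by the raising operators. Finite
dimension plays no role. -/
theorem IsWeightedBy.exists_isHW (hM : IsWeightedBy (spTorus F ι) M (weightsBC ι)) (a : ι → ℤ)
    (N : LieSubmodule F (sp ι F) M) (hN : N ≠ ⊥) :
    ∃ μ, ∃ m ∈ N, m ≠ 0 ∧ m ∈ wtSpace (spTorus F ι) M μ ∧ IsHW F a m := by
  classical
  let T := (weightsBC ι).filter fun μ => ∃ m ∈ N, m ≠ 0 ∧ m ∈ wtSpace (spTorus F ι) M μ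
  have hT : T.Nonempty := by
    obtain ⟨m, hm, hm0⟩ : ∃ m ∈ N, m ≠ 0 := by
      by_contra! h
      exact hN ((LieSubmodule.eq_bot_iff N).2 h)
    obtain ⟨x, hx, hs⟩ := hM.exists_sum m
    have hxN := wtComponent_mem (η := spTorus F ι) N.toSubmodule
      (fun c y hy => N.lie_mem hy) (weightsBC ι) x (fun μ _ => hx μ) (by rw [hs]; exact hm)
    by_contra hT
    rw [Finset.not_nonempty_iff_eq_empty] at hT
    apply hm0
    rw [← hs]
    refine Finset.sum_eq_zero fun μ hμ => ?_
    by_contra h0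
    have : μ ∈ T := Finset.mem_filter.2 ⟨hμ, x μ, hxN μ hμ, h0, hx μ⟩
    rw [hT] at this
    simp at this
  obtain ⟨μ, hμ, hmax⟩ := T.exists_max_image (hgt a) hT
  obtain ⟨-, m, hm, hm0, hmμ⟩ := Finset.mem_filter.1 hμ
  refine ⟨μ, m, hm, hm0, hmμ, fun p q hpq => ?_⟩
  by_contra h0
  have h1 := lie_spX_mem hmμ p q
  have h2 := hmax _ (Finset.mem_filter.2 ⟨hM.mem_of_ne_zero h1 h0, _, N.lie_mem hm, h0, h1⟩)
  rw [hgt_add, hgt_sub, hgt_wt, hgt_wt] at h2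
  omega

/-- The triple is not normalised: the root takes the value `2 * spκ p q ^ 2` on its torus element,
which is why `spκ` survives in the formula. -/
theorem IsHW.exists_string {S : Finset (ι → ℤ)} (hM : IsWeightedBy (spTorus F ι) M S) {μ : ι → ℤ}
    {m : M} (hm : m ∈ wtSpace (spTorus F ι) M μ) (hm0 : m ≠ 0) (h : IsHW F a m) {p q : ι ⊕ ι}
    (hpq : ht a q < ht a p) : ∃ k : ℕ, pr μ p - pr μ q = spκ p q * k ∧
      (fun y : M => ⁅spX F q p, y⁆)^[k + 1] m = 0 := by
  have hne : p ≠ q := by rintro rfl; exact lt_irrefl _ hpq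
  obtain ⟨k, hk, -, hk'⟩ := hM.exists_string (e := spX F p q) (f := spX F q p)
    (wt_sub_ne_zero hne) (by rw [neg_sub]; exact spX_mem q p) (lie_spX_spX hne) hm hm0 (h p q hpq)
  refine ⟨k, ?_, hk'⟩
  rw [wtEval_coroot, wtEval_coroot, pr_coroot hne] at hk
  have hk1 : 2 * (spκ p q * (pr μ p - pr μ q)) = k * (spκ p q * (2 * spκ p q)) := by
    exact_mod_cast hk
  have hκ : 0 < spκ p q := by rw [spκ]; split_ifs <;> norm_num
  have : (2 * spκ p q) * (pr μ p - pr μ q) = (2 * spκ p q) * (spκ p q * k) := by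
    rw [mul_assoc, hk1]; ring
  exact mul_left_cancel₀ (by omega) this

theorem IsHW.pr_le {S : Finset (ι → ℤ)} (hM : IsWeightedBy (spTorus F ι) M S) {μ : ι → ℤ}
    {m : M} (hm : m ∈ wtSpace (spTorus F ι) M μ) (hm0 : m ≠ 0) (h : IsHW F a m) {p q : ι ⊕ ι}
    (hpq : ht a q < ht a p) : pr μ q ≤ pr μ p := by
  obtain ⟨k, hk, -⟩ := h.exists_string hM hm hm0 hpq
  have hκ : 0 ≤ spκ p q * (k : ℤ) := by
    refine mul_nonneg ?_ (Int.natCast_nonneg k)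
    rw [spκ]; split_ifs <;> norm_num
  omega

/-- The dominant weights. -/
def IsDom (o₁ o₂ : ι) (μ : ι → ℤ) : Prop :=
  μ = Pi.single o₁ 2 ∨ μ = Pi.single o₁ 1 + Pi.single o₂ 1 ∨ μ = Pi.single o₁ 1

/-- Comparing an index with its opposite gives nonnegative coordinates, and comparing indices shows
that those at `o₁` and `o₂` are the largest. A third nonzero coordinate would then force norm at
least 3. -/
theorem IsHW.isDom (ha : IsHeight a o₁ o₂) (hM : IsWeightedBy (spTorus F ι) M (weightsBC ι))
    {μ : ι → ℤ} {m : M} (hm : m ∈ wtSpace (spTorus F ι) M μ) (hm0 : m ≠ 0) (h : IsHW F a m) :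
    μ = 0 ∨ IsDom o₁ o₂ μ := by
  have h2 : lOne μ ≤ 2 := mem_weightsBC.1 (hM.mem_of_ne_zero hm hm0)
  have hnn : ∀ i, 0 ≤ μ i := by
    intro i
    have h1 := ha.pos i
    have := h.pr_le hM hm hm0 (p := Sum.inl i) (q := Sum.inr i) (by simp; omega)
    simp only [pr_inl, pr_inr] at this
    omega
  have h12 : μ o₂ ≤ μ o₁ := h.pr_le hM hm hm0 (p := Sum.inl o₁) (q := Sum.inl o₂)
    (ha.lt₁ o₂ ha.ne.symm)
  have hi : ∀ i, i ≠ o₁ → i ≠ o₂ → μ i ≤ μ o₂ := fun i h1 h2 =>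
    h.pr_le hM hm hm0 (p := Sum.inl o₂) (q := Sum.inl i) (ha.lt₂ i h1 h2)
  have habs := abs_add_abs_le_lOne μ ha.ne
  rw [abs_of_nonneg (hnn _), abs_of_nonneg (hnn _)] at habs
  have hz : ∀ i, i ≠ o₁ → i ≠ o₂ → μ i = 0 := by
    intro i h1 h3
    have := abs_add_abs_add_abs_le_lOne μ ha.ne h1.symm h3.symm
    rw [abs_of_nonneg (hnn _), abs_of_nonneg (hnn _), abs_of_nonneg (hnn _)] at this
    have := hi i h1 h3
    have := hnn i
    omega
  have hμ : μ = Pi.single o₁ (μ o₁) + Pi.single o₂ (μ o₂) := by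
    ext i
    by_cases h1 : i = o₁
    · subst h1; simp [ha.ne]
    · by_cases h3 : i = o₂
      · subst h3; simp [h1]
      · simp [h1, h3, hz i h1 h3]
  have h5 := hnn o₁
  have h6 := hnn o₂
  have hc : (μ o₁ = 0 ∧ μ o₂ = 0) ∨ (μ o₁ = 2 ∧ μ o₂ = 0) ∨ (μ o₁ = 1 ∧ μ o₂ = 1) ∨
    (μ o₁ = 1 ∧ μ o₂ = 0) := by omega
  rcases hc with ⟨h7, h8⟩ | ⟨h7, h8⟩ | ⟨h7, h8⟩ | ⟨h7, h8⟩ <;> rw [h7, h8] at hμ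
  · left; simpa using hμ
  · right; left; simpa using hμ
  · right; right; left; exact hμ
  · right; right; right; simpa using hμ

/-- The weight of a nonzero vector killed by the positive root vectors vanishes only for
invariant vectors. -/
theorem IsHW.lie_eq_zero (ha : IsHeight a o₁ o₂) {S : Finset (ι → ℤ)}
    (hM : IsWeightedBy (spTorus F ι) M S) {m : M}
    (hm : m ∈ wtSpace (spTorus F ι) M 0) (h : IsHW F a m) (g : sp ι F) : ⁅g, m⁆ = 0 := by
  by_cases hm0 : m = 0
  · rw [hm0, lie_zero]
  refine (Submodule.mem_bot F).1 (sp_induction (bracketComap (sp ι F) m ⊥) (fun p q => ?_) g)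
  change ⁅spX F p q, m⁆ ∈ (⊥ : Submodule F M)
  rw [Submodule.mem_bot]
  rcases lt_trichotomy (ht a q) (ht a p) with hlt | heq | hgt
  · exact h p q hlt
  · obtain rfl := ha.ht_injective heq
    rw [lie_spX_self hm]
    cases q <;> simp
  · obtain ⟨k, hk, hk'⟩ := h.exists_string hM hm hm0 hgt
    have hκ : spκ q p ≠ 0 := by rw [spκ]; split_ifs <;> norm_num
    have h0 : ∀ r : ι ⊕ ι, pr (0 : ι → ℤ) r = 0 := by rintro (i | i) <;> simp
    rw [h0, h0, sub_zero, eq_comm, mul_eq_zero, or_iff_right hκ] at hk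
    obtain rfl : k = 0 := by exact_mod_cast hk
    simpa using hk'

/-- The eigenvalue of the Casimir operator on a highest weight vector. -/
def casEig (a μ : ι → ℤ) : ℤ := ∑ p, ∑ q, if ht a q = ht a p then pr μ p * pr μ p else
  if ht a q < ht a p then spκ p q * (pr μ p - pr μ q) else 0

/-- A term whose inner factor raises the height vanishes. If the outer factor raises it, the term
equals the action of the bracket of the two root vectors. The diagonal terms give squares. -/
theorem IsHW.casimir_eq (ha : IsHeight a o₁ o₂) {μ : ι → ℤ} {m : M}
    (hm : m ∈ wtSpace (spTorus F ι) M μ) (h : IsHW F a m) :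
    casimir F ι M m = (casEig a μ : F) • m := by
  rw [casimir_apply, casEig]
  push_cast
  rw [Finset.sum_smul]
  refine Finset.sum_congr rfl fun p _ => ?_
  rw [Finset.sum_smul]
  refine Finset.sum_congr rfl fun q _ => ?_
  rcases lt_trichotomy (ht a q) (ht a p) with hlt | heq | hgt
  · rw [if_neg hlt.ne, if_pos hlt, lie_spX_lie_spX hm (by rintro rfl; exact lt_irrefl _ hlt)
      (h p q hlt)]
    push_cast
    rfl
  · rw [if_pos heq]
    obtain rfl := ha.ht_injective heq
    rw [lie_spX_self hm, lie_smul, lie_spX_self hm, smul_smul]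
  · rw [if_neg hgt.ne', if_neg hgt.not_gt, h q p hgt, lie_zero, zero_smul]

end HighestWeight

/-! ### The eigenvalues of the Casimir operator -/

section CasimirEigenvalues

variable {ι : Type*} [Fintype ι] [DecidableEq ι] {a : ι → ℤ} {o₁ o₂ : ι}

/-- The contribution of an index to the eigenvalue of the Casimir operator. -/
def casRho (a : ι → ℤ) (p : ι ⊕ ι) : ℤ :=
  ∑ q, if ht a q < ht a p then spκ p q else if ht a p < ht a q then -spκ p q else 0

theorem spκ_comm (p q : ι ⊕ ι) : spκ p q = spκ q p := by
  have : q = p.swap ↔ p = q.swap := by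
    constructor <;> rintro rfl <;> simp
  simp only [spκ, this]

theorem spκ_swap (p q : ι ⊕ ι) : spκ p.swap q.swap = spκ p q := by
  have : q.swap = p.swap.swap ↔ q = p.swap := by
    rw [Sum.swap_swap]
    constructor
    · intro h
      rw [← h, Sum.swap_swap]
    · rintro rfl
      exact Sum.swap_swap p
  simp only [spκ, this]

theorem casRho_swap (a : ι → ℤ) (p : ι ⊕ ι) : casRho a p.swap = -casRho a p := by
  rw [casRho, casRho, ← (Equiv.sumComm ι ι).sum_comp, ← Finset.sum_neg_distrib]
  refine Finset.sum_congr rfl fun q _ => ?_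
  simp only [Equiv.sumComm_apply, ht_swap, spκ_swap, neg_lt_neg_iff]
  split_ifs with h1 h2 <;> omega

/-- This is the familiar `(μ, μ + 2ρ)`, up to a factor: interchanging the order of summation
collects the linear terms in `casRho`, which changes sign under `Sum.swap`. Dominant weights only
see its values at `o₁` and `o₂`. -/
theorem casEig_eq (ha : IsHeight a o₁ o₂) (μ : ι → ℤ) :
    casEig a μ = ∑ i, (2 * (μ i * μ i) + 2 * (μ i * casRho a (Sum.inl i))) := by
  have h1 : casEig a μ = ∑ p, (pr μ p * pr μ p + pr μ p * casRho a p) := by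
    have h2 : casEig a μ = ∑ p, ∑ q, (if ht a q = ht a p then pr μ p * pr μ p else 0) +
        (∑ p, ∑ q, (if ht a q < ht a p then spκ p q * pr μ p else 0) -
          ∑ p, ∑ q, if ht a q < ht a p then spκ p q * pr μ q else 0) := by
      rw [casEig]
      simp only [← Finset.sum_sub_distrib, ← Finset.sum_add_distrib]
      refine Finset.sum_congr rfl fun p _ => Finset.sum_congr rfl fun q _ => ?_
      by_cases h : ht a q = ht a p
      · rw [if_pos h, if_pos h, if_neg h.not_lt, if_neg h.not_lt]; ring
      · rw [if_neg h, if_neg h]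
        split_ifs <;> ring
    rw [h2, Finset.sum_comm (f := fun p q => if ht a q < ht a p then spκ p q * pr μ q else 0)]
    simp only [← Finset.sum_sub_distrib, ← Finset.sum_add_distrib]
    refine Finset.sum_congr rfl fun p _ => ?_
    rw [Finset.sum_add_distrib]
    congr 1
    · rw [Finset.sum_eq_single p, if_pos rfl]
      · intro q _ hq
        exact if_neg fun e => hq (ha.ht_injective e)
      · simp
    · rw [casRho, Finset.mul_sum]
      refine Finset.sum_congr rfl fun q _ => ?_
      rw [spκ_comm q p]
      rcases lt_trichotomy (ht a q) (ht a p) with h | h | h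
      · rw [if_pos h, if_neg h.not_gt, if_pos h]; ring
      · rw [if_neg h.not_lt, if_neg h.not_gt, if_neg h.not_lt, if_neg h.not_gt]; ring
      · rw [if_neg h.not_gt, if_pos h, if_neg h.not_gt, if_pos h]; ring
  rw [h1, Fintype.sum_sum_type, ← Finset.sum_add_distrib]
  refine Finset.sum_congr rfl fun i _ => ?_
  have := casRho_swap a (Sum.inl i)
  rw [Sum.swap_inl] at this
  rw [this, pr_inl, pr_inr]
  ring

theorem casRho_one (ha : IsHeight a o₁ o₂) : casRho a (Sum.inl o₁) = 2 * Fintype.card ι := by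
  have h : ∀ q : ι ⊕ ι, (if ht a q < ht a (Sum.inl o₁) then spκ (Sum.inl o₁) q else
      if ht a (Sum.inl o₁) < ht a q then -spκ (Sum.inl o₁) q else 0) =
      1 - (if q = Sum.inl o₁ then 1 else 0) + if q = Sum.inr o₁ then 1 else 0 := by
    intro q
    by_cases hq : q = Sum.inl o₁
    · subst hq; simp
    · have := ha.ht_lt hq
      rw [ht_inl, if_pos this, if_neg hq, spκ, Sum.swap_inl]
      split_ifs <;> norm_num
  rw [casRho, Finset.sum_congr rfl fun q _ => h q, Finset.sum_add_distrib, Finset.sum_sub_distrib,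
    Finset.sum_ite_eq' Finset.univ, Finset.sum_ite_eq' Finset.univ]
  simp
  ring

/-- Compared with `casRho_one`, the index `o₁` now lies above and contributes -1 instead of 1. -/
theorem casRho_two (ha : IsHeight a o₁ o₂) : casRho a (Sum.inl o₂) = 2 * Fintype.card ι - 2 := by
  have h : ∀ q : ι ⊕ ι, (if ht a q < ht a (Sum.inl o₂) then spκ (Sum.inl o₂) q else
      if ht a (Sum.inl o₂) < ht a q then -spκ (Sum.inl o₂) q else 0) =
      1 - (if q = Sum.inl o₂ then 1 else 0) + (if q = Sum.inr o₂ then 1 else 0) -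
        if q = Sum.inl o₁ then 2 else 0 := by
    intro q
    have h12 := ha.lt₁ o₂ ha.ne.symm
    by_cases hq : q = Sum.inl o₁
    · subst hq
      rw [ht_inl, ht_inl, if_neg h12.not_gt, if_pos h12, spκ]
      simp [ha.ne]
    by_cases hq' : q = Sum.inl o₂
    · subst hq'; simp [ha.ne.symm]
    · have := ha.ht_lt₂ hq hq'
      rw [ht_inl, if_pos this, if_neg hq, if_neg hq', spκ, Sum.swap_inl]
      split_ifs <;> norm_num
  rw [casRho, Finset.sum_congr rfl fun q _ => h q, Finset.sum_sub_distrib, Finset.sum_add_distrib,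
    Finset.sum_sub_distrib, Finset.sum_ite_eq' Finset.univ, Finset.sum_ite_eq' Finset.univ,
    Finset.sum_ite_eq' Finset.univ]
  simp
  ring

theorem casEig_zero (ha : IsHeight a o₁ o₂) : casEig a 0 = 0 := by
  simp [casEig_eq ha]

theorem casEig_single (ha : IsHeight a o₁ o₂) (t : ℤ) :
    casEig a (Pi.single o₁ t) = 2 * (t * t) + 4 * (t * Fintype.card ι) := by
  rw [casEig_eq ha, Finset.sum_eq_single o₁]
  · rw [casRho_one ha, Pi.single_eq_same]; ring
  · intro i _ hi
    simp [hi]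
  · simp

theorem casEig_add (ha : IsHeight a o₁ o₂) :
    casEig a (Pi.single o₁ 1 + Pi.single o₂ 1) = 8 * Fintype.card ι := by
  rw [casEig_eq ha, ← Finset.sum_subset (Finset.subset_univ {o₁, o₂}), Finset.sum_pair ha.ne,
    casRho_one ha, casRho_two ha]
  · simp [ha.ne, ha.ne.symm]
    ring
  · intro i _ hi
    simp only [Finset.mem_insert, Finset.mem_singleton, not_or] at hi
    simp [hi.1, hi.2]

theorem IsDom.casEig_pos (ha : IsHeight a o₁ o₂) {μ : ι → ℤ} (h : IsDom o₁ o₂ μ) :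
    0 < casEig a μ := by
  have : 0 < Fintype.card ι := Fintype.card_pos_iff.2 ⟨o₁⟩
  rcases h with rfl | rfl | rfl
  · rw [casEig_single ha]; omega
  · rw [casEig_add ha]; omega
  · rw [casEig_single ha]; omega

/-- With `n` indices the three eigenvalues are `8n + 8`, `8n` and `4n + 2`. Hence the Casimir
operator recognises the highest weight. -/
theorem IsDom.casEig_injective (ha : IsHeight a o₁ o₂) {μ ν : ι → ℤ} (h : IsDom o₁ o₂ μ)
    (h' : IsDom o₁ o₂ ν) (he : casEig a μ = casEig a ν) : μ = ν := by
  have hc : 0 < Fintype.card ι := Fintype.card_pos_iff.2 ⟨o₁⟩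
  rcases h with rfl | rfl | rfl <;> rcases h' with rfl | rfl | rfl <;> first
    | rfl
    | (exfalso; simp only [casEig_single ha, casEig_add ha] at he; omega)

end CasimirEigenvalues

/-! ### Modules generated by a highest weight vector. -/

section HighestWeightModules

open LieAlgebra.Symplectic

variable {F ι : Type*} [Field F] [CharZero F] [Fintype ι] [DecidableEq ι]
  {M : Type*} [AddCommGroup M] [Module F M] [LieRingModule (sp ι F) M] [LieModule F (sp ι F) M]
  {M' : Type*} [AddCommGroup M'] [Module F M'] [LieRingModule (sp ι F) M']
  [LieModule F (sp ι F) M'] {a : ι → ℤ} {o₁ o₂ : ι}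

/-- The vectors obtained from `x` by successively applying root vectors of negative height. -/
inductive LowMon (F : Type*) [Field F] {M : Type*} [AddCommGroup M] [Module F M]
    [LieRingModule (sp ι F) M] (a : ι → ℤ) (x : M) : M → Prop
  | base : LowMon F a x x
  | step (p q : ι ⊕ ι) (y : M) : ht a p < ht a q → LowMon F a x y → LowMon F a x ⁅spX F p q, y⁆

theorem LowMon.mem {x : M} {lam : ι → ℤ} (hx : x ∈ wtSpace (spTorus F ι) M lam) {y : M}
    (hy : LowMon F a x y) :
    y = x ∨ ∃ μ, hgt a μ < hgt a lam ∧ y ∈ wtSpace (spTorus F ι) M μ := by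
  induction hy with
  | base => exact Or.inl rfl
  | step p q y hpq _ ih =>
    right
    rcases ih with rfl | ⟨μ, hμ, hy⟩
    · refine ⟨_, ?_, lie_spX_mem hx p q⟩
      rw [hgt_add, hgt_sub, hgt_wt, hgt_wt]
      omega
    · refine ⟨_, ?_, lie_spX_mem hy p q⟩
      rw [hgt_add, hgt_sub, hgt_wt, hgt_wt]
      omega

theorem IsHW.lie_mem_span (ha : IsHeight a o₁ o₂) {x : M} {lam : ι → ℤ}
    (hx : x ∈ wtSpace (spTorus F ι) M lam) (h : IsHW F a x) {y : M} (hy : LowMon F a x y)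
    (g : sp ι F) : ⁅g, y⁆ ∈ Submodule.span F {y | LowMon F a x y} := by
  set U := Submodule.span F {y : M | LowMon F a x y}
  have hlow : ∀ p q : ι ⊕ ι, ht a p < ht a q → ∀ u ∈ U, ⁅spX F p q, u⁆ ∈ U := fun p q hpq u hu =>
    lie_mem_of_span (fun y hy => Submodule.subset_span (LowMon.step p q y hpq hy)) hu
  -- For a new lowering factor `f`, `[g, [f, y]] = [[g, f], y] + [f, [g, y]]`; the first term needs
  -- the hypothesis for `[g, f]`, so `g` must stay free.
  induction hy generalizing g with
  | base =>
    refine sp_induction (bracketComap (sp ι F) x U) (fun p q => ?_) g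
    change ⁅spX F p q, x⁆ ∈ U
    rcases lt_trichotomy (ht a q) (ht a p) with hlt | heq | hgt
    · rw [h p q hlt]
      exact U.zero_mem
    · obtain rfl := ha.ht_injective heq
      rw [lie_spX_self hx]
      exact U.smul_mem _ (Submodule.subset_span LowMon.base)
    · exact hlow p q hgt _ (Submodule.subset_span LowMon.base)
  | step p q y hpq hy ih =>
    rw [leibniz_lie]
    exact U.add_mem (ih _) (hlow p q hpq _ (ih g))

theorem IsHW.mem_span_lowMon (ha : IsHeight a o₁ o₂) {x : M} {lam : ι → ℤ}
    (hx : x ∈ wtSpace (spTorus F ι) M lam) (h : IsHW F a x) {y : M}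
    (hy : y ∈ LieSubmodule.lieSpan F (sp ι F) {x}) : y ∈ Submodule.span F {y | LowMon F a x y} := by
  let N : LieSubmodule F (sp ι F) M :=
    { Submodule.span F {y | LowMon F a x y} with
      lie_mem := fun {g m} hm => lie_mem_of_span (fun y hy => h.lie_mem_span ha hx hy g) hm }
  have : LieSubmodule.lieSpan F (sp ι F) {x} ≤ N := by
    rw [LieSubmodule.lieSpan_le, Set.singleton_subset_iff]
    exact Submodule.subset_span LowMon.base
  exact this hy

/-- A module generated by a highest weight vector is the sum of a line and of lower weight
spaces. -/
theorem IsHW.lieSpan_le (ha : IsHeight a o₁ o₂) {x : M} {lam : ι → ℤ}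
    (hM : IsWeightedBy (spTorus F ι) M (weightsBC ι))
    (hx : x ∈ wtSpace (spTorus F ι) M lam) (h : IsHW F a x) :
    (LieSubmodule.lieSpan F (sp ι F) {x}).toSubmodule ≤ Submodule.span F {x} ⊔
      ⨆ μ ∈ (weightsBC ι).filter fun μ => hgt a μ < hgt a lam, wtSpace (spTorus F ι) M μ := by
  have hle : Submodule.span F {y | LowMon F a x y} ≤ Submodule.span F {x} ⊔
      ⨆ μ ∈ (weightsBC ι).filter fun μ => hgt a μ < hgt a lam, wtSpace (spTorus F ι) M μ := by
    rw [Submodule.span_le]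
    intro z hz
    rcases LowMon.mem hx hz with rfl | ⟨μ, hμ, hzμ⟩
    · exact Submodule.mem_sup_left (Submodule.mem_span_singleton_self _)
    · by_cases hz0 : z = 0
      · rw [hz0]; exact Submodule.zero_mem _
      · exact Submodule.mem_sup_right (mem_iSup_wtSpace
          (Finset.mem_filter.2 ⟨hM.mem_of_ne_zero hzμ hz0, hμ⟩) hzμ)
  exact fun y hy => hle (h.mem_span_lowMon ha hx hy)

/-- The component of top weight. -/
theorem mem_of_mem_sup_lower {P : Submodule F M} {lam : ι → ℤ}
    (hP : P ≤ wtSpace (spTorus F ι) M lam) {y : M} (hyl : y ∈ wtSpace (spTorus F ι) M lam)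
    (hy : y ∈ P ⊔ ⨆ μ ∈ (weightsBC ι).filter fun μ => hgt a μ < hgt a lam,
      wtSpace (spTorus F ι) M μ) : y ∈ P := by
  obtain ⟨u, hu, z, hz, rfl⟩ := Submodule.mem_sup.1 hy
  have hzl : z ∈ wtSpace (spTorus F ι) M lam := (Submodule.add_mem_iff_right _ (hP hu)).1 hyl
  rw [eq_zero_of_mem_wtSpace_of_mem_iSup (by simp) hzl hz, add_zero]
  exact hu

/-- The top weight space of a module generated by a highest weight vector is a line. -/
theorem IsHW.exists_smul (ha : IsHeight a o₁ o₂) {x : M} {lam : ι → ℤ}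
    (hM : IsWeightedBy (spTorus F ι) M (weightsBC ι))
    (hx : x ∈ wtSpace (spTorus F ι) M lam) (h : IsHW F a x) {y : M}
    (hy : y ∈ LieSubmodule.lieSpan F (sp ι F) {x}) (hyl : y ∈ wtSpace (spTorus F ι) M lam) :
    ∃ c : F, y = c • x := by
  obtain ⟨c, hc⟩ := Submodule.mem_span_singleton.1 (mem_of_mem_sup_lower
    ((Submodule.span_singleton_le_iff_mem _ _).2 hx) hyl (h.lieSpan_le ha hM hx hy))
  exact ⟨c, hc.symm⟩

/-- An eigenspace of the Casimir operator. -/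
def casimirEigen (F ι M : Type*) [Field F] [Fintype ι] [DecidableEq ι] [AddCommGroup M]
    [Module F M] [LieRingModule (sp ι F) M] [LieModule F (sp ι F) M] (c : F) :
    LieSubmodule F (sp ι F) M :=
  { Module.End.eigenspace (casimir F ι M) c with
    lie_mem := by
      intro g m hm
      change m ∈ Module.End.eigenspace (casimir F ι M) c at hm
      change ⁅g, m⁆ ∈ Module.End.eigenspace (casimir F ι M) c
      rw [Module.End.mem_eigenspace_iff] at hm ⊢
      rw [casimir_lie, hm, lie_smul] }

theorem mem_casimirEigen {c : F} {m : M} :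
    m ∈ casimirEigen F ι M c ↔ casimir F ι M m = c • m :=
  Module.End.mem_eigenspace_iff

theorem IsHW.lieSpan_le_casimirEigen (ha : IsHeight a o₁ o₂) {x : M} {lam : ι → ℤ}
    (hx : x ∈ wtSpace (spTorus F ι) M lam) (h : IsHW F a x) :
    LieSubmodule.lieSpan F (sp ι F) {x} ≤ casimirEigen F ι M (casEig a lam : F) := by
  rw [LieSubmodule.lieSpan_le, Set.singleton_subset_iff]
  exact mem_casimirEigen.2 (h.casimir_eq ha hx)

/-- A module generated by a highest weight vector is irreducible. -/
theorem IsHW.mem_of_ne_bot (ha : IsHeight a o₁ o₂)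
    (hM : IsWeightedBy (spTorus F ι) M (weightsBC ι)) {x : M} {lam : ι → ℤ}
    (hlam : IsDom o₁ o₂ lam) (hx : x ∈ wtSpace (spTorus F ι) M lam) (h : IsHW F a x)
    {N : LieSubmodule F (sp ι F) M} (hN : N ≠ ⊥) (hle : N ≤ LieSubmodule.lieSpan F (sp ι F) {x}) :
    x ∈ N := by
  -- A highest weight vector of `N` has the Casimir eigenvalue of `x`, hence the weight of `x`; and
  -- in the generated module the space of that weight is the line of `x`.
  obtain ⟨μ, m, hm, hm0, hmμ, hmhw⟩ := hM.exists_isHW a N hN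
  have h1 := mem_casimirEigen.1 (h.lieSpan_le_casimirEigen ha hx (hle hm))
  rw [hmhw.casimir_eq ha hmμ] at h1
  have h2 : casEig a μ = casEig a lam := by
    have := smul_left_injective F hm0 h1
    exact_mod_cast this
  have h3 : μ = lam := by
    rcases hmhw.isDom ha hM hmμ hm0 with rfl | h4
    · have := hlam.casEig_pos ha
      rw [casEig_zero ha] at h2
      omega
    · exact h4.casEig_injective ha hlam h2
  subst h3
  obtain ⟨c, rfl⟩ := h.exists_smul ha hM hx (hle hm) hmμ
  exact (N.toSubmodule.smul_mem_iff (left_ne_zero_of_smul hm0)).1 hm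

theorem IsHW.eq_lieSpan (ha : IsHeight a o₁ o₂)
    (hM : IsWeightedBy (spTorus F ι) M (weightsBC ι)) {x : M} {lam : ι → ℤ}
    (hlam : IsDom o₁ o₂ lam) (hx : x ∈ wtSpace (spTorus F ι) M lam) (h : IsHW F a x)
    {N : LieSubmodule F (sp ι F) M} (hN : N ≠ ⊥) (hle : N ≤ LieSubmodule.lieSpan F (sp ι F) {x}) :
    N = LieSubmodule.lieSpan F (sp ι F) {x} :=
  le_antisymm hle (by
    rw [LieSubmodule.lieSpan_le, Set.singleton_subset_iff]
    exact h.mem_of_ne_bot ha hM hlam hx hN hle)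

/-! #### Comparison of two modules -/

/-- The product of two Lie modules. -/
instance prodLieRingModule {K M M' : Type*} [LieRing K] [AddCommGroup M] [AddCommGroup M']
    [LieRingModule K M] [LieRingModule K M'] : LieRingModule K (M × M') where
  bracket g m := (⁅g, m.1⁆, ⁅g, m.2⁆)
  add_lie g g' m := Prod.ext (add_lie g g' m.1) (add_lie g g' m.2)
  lie_add g m m' := Prod.ext (lie_add g m.1 m'.1) (lie_add g m.2 m'.2)
  leibniz_lie g g' m := Prod.ext (leibniz_lie g g' m.1) (leibniz_lie g g' m.2)

instance prodLieModule {F K M M' : Type*} [CommRing F] [LieRing K] [LieAlgebra F K]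
    [AddCommGroup M] [AddCommGroup M'] [Module F M] [Module F M']
    [LieRingModule K M] [LieRingModule K M'] [LieModule F K M] [LieModule F K M'] :
    LieModule F K (M × M') where
  smul_lie c g m := Prod.ext (smul_lie c g m.1) (smul_lie c g m.2)
  lie_smul c g m := Prod.ext (lie_smul c g m.1) (lie_smul c g m.2)

theorem prod_lie {K M M' : Type*} [LieRing K] [AddCommGroup M] [AddCommGroup M']
    [LieRingModule K M] [LieRingModule K M'] (g : K) (m : M × M') :
    ⁅g, m⁆ = (⁅g, m.1⁆, ⁅g, m.2⁆) := rfl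

theorem mem_wtSpace_prod_iff {μ : ι → ℤ} {m : M × M'} :
    m ∈ wtSpace (spTorus F ι) (M × M') μ ↔
      m.1 ∈ wtSpace (spTorus F ι) M μ ∧ m.2 ∈ wtSpace (spTorus F ι) M' μ := by
  simp only [mem_wtSpace, prod_lie, Prod.ext_iff, Prod.smul_fst, Prod.smul_snd, forall_and]

theorem isWeightedBy_prod {S : Finset (ι → ℤ)} (hM : IsWeightedBy (spTorus F ι) M S)
    (hM' : IsWeightedBy (spTorus F ι) M' S) : IsWeightedBy (spTorus F ι) (M × M') S := by
  rintro ⟨m, m'⟩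
  have h1 : ((m, 0) : M × M') ∈ ⨆ μ ∈ S, wtSpace (spTorus F ι) (M × M') μ :=
    hM.mem_of_forall ((⨆ μ ∈ S, wtSpace (spTorus F ι) (M × M') μ).comap
      (LinearMap.inl F M M')) (fun μ hμ x hx =>
        mem_iSup_wtSpace hμ (mem_wtSpace_prod_iff.2 ⟨hx, zero_mem _⟩)) m
  have h2 : ((0, m') : M × M') ∈ ⨆ μ ∈ S, wtSpace (spTorus F ι) (M × M') μ :=
    hM'.mem_of_forall ((⨆ μ ∈ S, wtSpace (spTorus F ι) (M × M') μ).comap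
      (LinearMap.inr F M M')) (fun μ hμ x hx =>
        mem_iSup_wtSpace hμ (mem_wtSpace_prod_iff.2 ⟨zero_mem _, hx⟩)) m'
  simpa using add_mem h1 h2

/-- The first projection. -/
def lieFst (F K M M' : Type*) [CommRing F] [LieRing K] [AddCommGroup M] [AddCommGroup M']
    [Module F M] [Module F M'] [LieRingModule K M] [LieRingModule K M'] : M × M' →ₗ⁅F, K⁆ M :=
  { LinearMap.fst F M M' with map_lie' := rfl }

/-- The second projection. -/
def lieSnd (F K M M' : Type*) [CommRing F] [LieRing K] [AddCommGroup M] [AddCommGroup M']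
    [Module F M] [Module F M'] [LieRingModule K M] [LieRingModule K M'] : M × M' →ₗ⁅F, K⁆ M' :=
  { LinearMap.snd F M M' with map_lie' := rfl }

/-- A bijective homomorphism of Lie modules is an isomorphism. -/
noncomputable def lieModuleEquivOfBijective {F K M M' : Type*} [CommRing F] [LieRing K] [AddCommGroup M]
    [AddCommGroup M'] [Module F M] [Module F M'] [LieRingModule K M] [LieRingModule K M']
    (f : M →ₗ⁅F, K⁆ M') (hf : Function.Bijective f) : M ≃ₗ⁅F, K⁆ M' :=
  { f with
    invFun := (LinearEquiv.ofBijective (f : M →ₗ[F] M') hf).symm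
    left_inv := (LinearEquiv.ofBijective (f : M →ₗ[F] M') hf).left_inv
    right_inv := (LinearEquiv.ofBijective (f : M →ₗ[F] M') hf).right_inv }

/-- A homomorphism restricts to an isomorphism between modules generated by highest weight
vectors. -/
theorem IsHW.exists_equiv_of_hom (ha : IsHeight a o₁ o₂)
    (hM : IsWeightedBy (spTorus F ι) M (weightsBC ι)) {x : M} {lam : ι → ℤ}
    (hlam : IsDom o₁ o₂ lam) (hx : x ∈ wtSpace (spTorus F ι) M lam) (h : IsHW F a x)
    (f : M →ₗ⁅F, sp ι F⁆ M') (hf : f x ≠ 0) :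
    Nonempty (LieSubmodule.lieSpan F (sp ι F) {x} ≃ₗ⁅F, sp ι F⁆
      LieSubmodule.lieSpan F (sp ι F) {f x}) := by
  have hmap : (LieSubmodule.lieSpan F (sp ι F) {x}).map f =
      LieSubmodule.lieSpan F (sp ι F) {f x} := by
    apply le_antisymm
    · rw [LieSubmodule.map_le_iff_le_comap, LieSubmodule.lieSpan_le, Set.singleton_subset_iff]
      exact LieSubmodule.subset_lieSpan rfl
    · rw [LieSubmodule.lieSpan_le, Set.singleton_subset_iff]
      exact LieSubmodule.mem_map_of_mem (LieSubmodule.subset_lieSpan rfl)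
  let N := LieSubmodule.lieSpan F (sp ι F) {x}
  let f' : N →ₗ⁅F, sp ι F⁆ LieSubmodule.lieSpan F (sp ι F) {f x} :=
    { toFun := fun y => ⟨f y, by rw [← hmap]; exact LieSubmodule.mem_map_of_mem y.2⟩
      map_add' := fun y z => Subtype.ext (map_add f _ _)
      map_smul' := fun c y => Subtype.ext (map_smul f _ _)
      map_lie' := fun {g y} => Subtype.ext (LieModuleHom.map_lie f _ _) }
  -- A nonzero submodule of `N` contains `x`, and `f x ≠ 0`.
  have hker : N ⊓ f.ker = ⊥ := by
    by_contra hne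
    exact hf (h.mem_of_ne_bot ha hM hlam hx hne inf_le_left).2
  have hbij : Function.Bijective f' := by
    constructor
    · rw [injective_iff_map_eq_zero f']
      rintro ⟨y, hy⟩ h0
      have h1 : y ∈ N ⊓ f.ker := ⟨hy, (LieModuleHom.mem_ker (f := f)).2 (congrArg Subtype.val h0)⟩
      rw [hker] at h1
      exact Subtype.ext h1
    · rintro ⟨z, hz⟩
      rw [← hmap] at hz
      obtain ⟨y, hy, rfl⟩ := (LieSubmodule.mem_map _).1 hz
      exact ⟨⟨y, hy⟩, rfl⟩
  exact ⟨lieModuleEquivOfBijective f' hbij⟩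

/-- Modules generated by highest weight vectors of the same weight are isomorphic. -/
theorem IsHW.nonempty_equiv (ha : IsHeight a o₁ o₂)
    (hM : IsWeightedBy (spTorus F ι) M (weightsBC ι))
    (hM' : IsWeightedBy (spTorus F ι) M' (weightsBC ι)) {x : M} {x' : M'} {lam : ι → ℤ}
    (hlam : IsDom o₁ o₂ lam) (hx : x ∈ wtSpace (spTorus F ι) M lam) (h : IsHW F a x) (hx0 : x ≠ 0)
    (hx' : x' ∈ wtSpace (spTorus F ι) M' lam) (h' : IsHW F a x') (hx0' : x' ≠ 0) :
    Nonempty (LieSubmodule.lieSpan F (sp ι F) {x} ≃ₗ⁅F, sp ι F⁆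
      LieSubmodule.lieSpan F (sp ι F) {x'}) := by
  -- The pair `(x, x')` is a highest weight vector of the product, and the module it generates is
  -- the graph of an isomorphism: both projections restrict to isomorphisms.
  have hp : ((x, x') : M × M') ∈ wtSpace (spTorus F ι) (M × M') lam :=
    mem_wtSpace_prod_iff.2 ⟨hx, hx'⟩
  have hhw : IsHW F a ((x, x') : M × M') := fun p q hpq => Prod.ext (h p q hpq) (h' p q hpq)
  have hw := isWeightedBy_prod hM hM'
  obtain ⟨e⟩ := hhw.exists_equiv_of_hom ha hw hlam hp (lieFst F (sp ι F) M M') hx0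
  obtain ⟨e'⟩ := hhw.exists_equiv_of_hom ha hw hlam hp (lieSnd F (sp ι F) M M') hx0'
  exact ⟨e.symm.trans e'⟩

/-- A module with a unique highest weight line, of nonzero weight, has no proper submodule. -/
theorem IsWeightedBy.eq_top (ha : IsHeight a o₁ o₂)
    (hM : IsWeightedBy (spTorus F ι) M (weightsBC ι)) {x : M} {lam : ι → ℤ}
    (hx : x ∈ wtSpace (spTorus F ι) M lam) (h : IsHW F a x)
    (hline : ∀ y ∈ wtSpace (spTorus F ι) M lam, ∃ c : F, y = c • x)
    (huniq : ∀ μ, ∀ y ∈ wtSpace (spTorus F ι) M μ, y ≠ 0 → IsHW F a y → μ = lam)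
    (hlam : IsDom o₁ o₂ lam)
    {N : LieSubmodule F (sp ι F) M} (hN : N ≠ ⊥) : N = ⊤ := by
  -- Every nonzero submodule has a highest weight vector, which by uniqueness is a multiple of `x`.
  have hxN : ∀ N : LieSubmodule F (sp ι F) M, N ≠ ⊥ → x ∈ N := by
    intro N hN
    obtain ⟨μ, m, hm, hm0, hmμ, hmhw⟩ := hM.exists_isHW a N hN
    obtain rfl := huniq μ m hmμ hm0 hmhw
    obtain ⟨c, rfl⟩ := hline m hmμ
    exact (N.toSubmodule.smul_mem_iff (left_ne_zero_of_smul hm0)).1 hm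
  -- The difference of the Casimir operator and the scalar is a module endomorphism killing the
  -- space of weight `lam`. If it were nonzero, its range would contain `x`, which would be the
  -- image of a vector of weight `lam`.
  have hcas : casimirEigen F ι M (casEig a lam : F) = ⊤ := by
    let f : M →ₗ⁅F, sp ι F⁆ M :=
      { casimir F ι M - (casEig a lam : F) • LinearMap.id with
        map_lie' := by
          intro g m
          change casimir F ι M ⁅g, m⁆ - (casEig a lam : F) • ⁅g, m⁆ =
            ⁅g, casimir F ι M m - (casEig a lam : F) • m⁆
          rw [casimir_lie, lie_sub, lie_smul] }
    have hf : ∀ m, f m = casimir F ι M m - (casEig a lam : F) • m := fun m => rfl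
    by_contra hne
    have hr : f.range ≠ ⊥ := by
      intro h0
      apply hne
      rw [eq_top_iff]
      intro m _
      rw [mem_casimirEigen, ← sub_eq_zero, ← hf]
      have : f m ∈ f.range := (LieModuleHom.mem_range f _).2 ⟨m, rfl⟩
      rwa [h0] at this
    obtain ⟨y, hy⟩ := (LieModuleHom.mem_range f _).1 (hxN _ hr)
    obtain ⟨z, hz, rfl⟩ := hM.exists_sum y
    have hfz : ∀ μ, f (z μ) ∈ wtSpace (spTorus F ι) M μ := by
      intro μ c
      rw [← LieModuleHom.map_lie, hz μ c, map_smul]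
    by_cases hx0 : x = 0
    · obtain ⟨μ, m, hm, hm0, hmμ, hmhw⟩ := hM.exists_isHW a _ hr
      obtain rfl := huniq μ m hmμ hm0 hmhw
      obtain ⟨c, rfl⟩ := hline m hmμ
      exact hm0 (by rw [hx0, smul_zero])
    · have hml := hM.mem_of_ne_zero hx hx0
      have h1 := sum_wt_eq_zero (η := spTorus F ι) (s := weightsBC ι)
        (x := fun μ => f (z μ) - if μ = lam then x else 0) (fun μ _ => by
          by_cases hμ : μ = lam
          · subst hμ; simpa using sub_mem (hfz μ) hx
          · simpa [hμ] using hfz μ) (by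
          rw [Finset.sum_sub_distrib, ← map_sum, hy, Finset.sum_ite_eq' (weightsBC ι), if_pos hml,
            sub_self]) lam hml
      rw [if_pos rfl, sub_eq_zero] at h1
      obtain ⟨c, hc⟩ := hline _ (hz lam)
      rw [hc, map_smul, hf, h.casimir_eq ha hx, sub_self, smul_zero] at h1
      exact hx0 h1.symm
  by_contra hne
  -- A highest weight vector of the quotient need not lift to one of `M`, but the Casimir operator
  -- is scalar on the quotient, so its weight is `lam`. Then it is the image of a multiple of `x`,
  -- and `x` lies in `N`.
  let π : M →ₗ⁅F, sp ι F⁆ M ⧸ N := LieSubmodule.Quotient.mk' N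
  have hπ : Function.Surjective π := LieSubmodule.Quotient.surjective_mk' N
  have hwQ : IsWeightedBy (spTorus F ι) (M ⧸ N) (weightsBC ι) := by
    intro y
    obtain ⟨m, rfl⟩ := hπ y
    refine hM.mem_of_forall ((⨆ μ ∈ weightsBC ι, wtSpace (spTorus F ι) (M ⧸ N) μ).comap
      (π : M →ₗ[F] M ⧸ N)) (fun μ hμ z hz => ?_) m
    refine mem_iSup_wtSpace hμ fun c => ?_
    change ⁅_, π z⁆ = _ • π z
    rw [← LieModuleHom.map_lie, hz c, map_smul]
  have htop : (⊤ : LieSubmodule F (sp ι F) (M ⧸ N)) ≠ ⊥ := by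
    intro h0
    apply hne
    rw [eq_top_iff]
    intro m _
    have : π m ∈ (⊤ : LieSubmodule F (sp ι F) (M ⧸ N)) := trivial
    rw [h0, LieSubmodule.mem_bot] at this
    exact (LieSubmodule.Quotient.mk_eq_zero' (N := N)).1 this
  obtain ⟨μ, y, -, hy0, hyμ, hyhw⟩ := hwQ.exists_isHW a ⊤ htop
  have hcy : casimir F ι (M ⧸ N) y = (casEig a lam : F) • y := by
    obtain ⟨m, rfl⟩ := hπ y
    have h1 : m ∈ casimirEigen F ι M (casEig a lam : F) := by rw [hcas]; trivial
    rw [mem_casimirEigen, casimir_apply] at h1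
    rw [casimir_apply, ← map_smul, ← h1, map_sum]
    refine Finset.sum_congr rfl fun p _ => ?_
    rw [map_sum]
    refine Finset.sum_congr rfl fun q _ => ?_
    rw [LieModuleHom.map_lie, LieModuleHom.map_lie]
  rw [hyhw.casimir_eq ha hyμ] at hcy
  have h2 : casEig a μ = casEig a lam := by
    have := smul_left_injective F hy0 hcy
    exact_mod_cast this
  have h3 : μ = lam := by
    rcases hyhw.isDom ha hwQ hyμ hy0 with rfl | h4
    · have := hlam.casEig_pos ha
      rw [casEig_zero ha] at h2
      omega
    · exact h4.casEig_injective ha hlam h2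
  subst h3
  obtain ⟨m, rfl⟩ := hπ y
  obtain ⟨z, hz, hzs⟩ := hM.exists_sum m
  have hπz : ∀ ν, π (z ν) ∈ wtSpace (spTorus F ι) (M ⧸ N) ν := by
    intro ν c
    rw [← LieModuleHom.map_lie, hz ν c, map_smul]
  have hml := hwQ.mem_of_ne_zero hyμ hy0
  have h1 := sum_wt_eq_zero (η := spTorus F ι) (s := weightsBC ι)
    (x := fun ν => π (z ν) - if ν = μ then π m else 0) (fun ν _ => by
      by_cases hν : ν = μ
      · subst hν; simpa using sub_mem (hπz ν) hyμ
      · simpa [hν] using hπz ν) (by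
      rw [Finset.sum_sub_distrib, ← map_sum, hzs, Finset.sum_ite_eq' (weightsBC ι), if_pos hml,
        sub_self]) μ hml
  rw [if_pos rfl, sub_eq_zero] at h1
  obtain ⟨c, hc⟩ := hline _ (hz μ)
  apply hy0
  rw [← h1, hc, map_smul, show π x = 0 from
    (LieSubmodule.Quotient.mk_eq_zero' (N := N)).2 (hxN N hN), smul_zero]

end HighestWeightModules

/-! ### The three irreducible modules -/

section Models

open LieAlgebra.Symplectic

variable {F ι : Type*} [Field F] [CharZero F] [Fintype ι] [DecidableEq ι]
  {M : Type*} [AddCommGroup M] [Module F M] [LieRingModule (sp ι F) M] [LieModule F (sp ι F) M]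
  {M' : Type*} [AddCommGroup M'] [Module F M'] [LieRingModule (sp ι F) M']
  [LieModule F (sp ι F) M'] {a : ι → ℤ} {o₁ o₂ : ι}

/-- `M` is generated by a highest weight vector of weight `lam`. -/
structure IsHWModule (F : Type*) [Field F] [CharZero F] (M : Type*) [AddCommGroup M] [Module F M]
    [LieRingModule (sp ι F) M] [LieModule F (sp ι F) M] (a lam : ι → ℤ) : Prop where
  weighted : IsWeightedBy (spTorus F ι) M (weightsBC ι)
  exists_gen : ∃ x ∈ wtSpace (spTorus F ι) M lam, x ≠ 0 ∧ IsHW F a x ∧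
    LieSubmodule.lieSpan F (sp ι F) {x} = ⊤

/-- To recognise a model it suffices to exclude all other highest weights and to find one coordinate
that is injective on the space of weight `lam`. -/
theorem isHWModule_of (ha : IsHeight a o₁ o₂) {lam : ι → ℤ} (hlam : IsDom o₁ o₂ lam)
    (hM : IsWeightedBy (spTorus F ι) M (weightsBC ι)) (hnt : ∃ m : M, m ≠ 0)
    (huniq : ∀ μ, ∀ y ∈ wtSpace (spTorus F ι) M μ, y ≠ 0 → IsHW F a y → μ = lam)
    (ℓ : M →ₗ[F] F) (hℓ : ∀ y ∈ wtSpace (spTorus F ι) M lam, ℓ y = 0 → y = 0) :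
    IsHWModule F M a lam := by
  have htop : (⊤ : LieSubmodule F (sp ι F) M) ≠ ⊥ := by
    intro h
    obtain ⟨m, hm⟩ := hnt
    have : m ∈ (⊤ : LieSubmodule F (sp ι F) M) := trivial
    rw [h] at this
    exact hm this
  obtain ⟨μ, x, -, hx0, hx, hhw⟩ := hM.exists_isHW a ⊤ htop
  obtain rfl := huniq μ x hx hx0 hhw
  refine ⟨hM, x, hx, hx0, hhw, hM.eq_top ha hx hhw (fun y hy => ?_) huniq hlam fun h => hx0 ?_⟩
  · have h1 : ℓ x ≠ 0 := fun h => hx0 (hℓ x hx h)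
    refine ⟨ℓ y / ℓ x, ?_⟩
    rw [← sub_eq_zero]
    refine hℓ _ (sub_mem hy (Submodule.smul_mem _ _ hx)) ?_
    rw [map_sub, map_smul, smul_eq_mul, div_mul_cancel₀ _ h1, sub_self]
  · have : x ∈ LieSubmodule.lieSpan F (sp ι F) {x} := LieSubmodule.subset_lieSpan rfl
    rw [h] at this
    exact this

/-- Highest weight vectors generate copies of the models. -/
theorem IsHWModule.nonempty_equiv (ha : IsHeight a o₁ o₂) {lam : ι → ℤ} (hlam : IsDom o₁ o₂ lam)
    (hM' : IsHWModule F M' a lam) (hM : IsWeightedBy (spTorus F ι) M (weightsBC ι)) {x : M}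
    (hx : x ∈ wtSpace (spTorus F ι) M lam) (hx0 : x ≠ 0) (h : IsHW F a x) :
    Nonempty (LieSubmodule.lieSpan F (sp ι F) {x} ≃ₗ⁅F, sp ι F⁆ M') := by
  obtain ⟨x', hx', hx0', h', htop⟩ := hM'.exists_gen
  obtain ⟨e⟩ := h.nonempty_equiv ha hM hM'.weighted hlam hx hx0 hx' h' hx0'
  rw [htop] at e
  exact ⟨e.trans (LieModuleEquiv.ofTop F (sp ι F) M')⟩

theorem IsHWModule.eq_bot_or_eq_top (ha : IsHeight a o₁ o₂) {lam : ι → ℤ}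
    (hlam : IsDom o₁ o₂ lam) (hM : IsHWModule F M a lam) (N : LieSubmodule F (sp ι F) M) :
    N = ⊥ ∨ N = ⊤ := by
  obtain ⟨x, hx, hx0, h, htop⟩ := hM.exists_gen
  refine or_iff_not_imp_left.2 fun hN => ?_
  rw [← htop]
  exact h.eq_lieSpan ha hM.weighted hlam hx hN (by rw [htop]; exact le_top)

/-! #### Entries of weight vectors -/

/-- A root occurs at exactly two matrix positions, exchanged by the adjoint; for a long root they
coincide. This locates the support of a matrix of given weight. -/
theorem wt_sub_wt_eq {p q r s : ι ⊕ ι} (hrs : r ≠ s) (h : wt p - wt q = wt r - wt s) :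
    (p = r ∧ q = s) ∨ (p = s.swap ∧ q = r.swap) := by
  by_cases hp : p = r
  · subst hp
    exact Or.inl ⟨rfl, wt_injective (sub_right_injective h)⟩
  · have h1 := congrArg (fun μ => pr μ r) h
    simp only [pr_sub, pr_wt_self] at h1
    have hs : pr (wt s) r ≤ 0 := by
      by_cases h2 : s = r.swap
      · rw [h2, pr_wt_swap]; norm_num
      · rw [pr_wt_ne hrs.symm h2]
    have hp' : pr (wt p) r ≤ 0 := by
      by_cases h2 : p = r.swap
      · rw [h2, pr_wt_swap]; norm_num
      · rw [pr_wt_ne hp h2]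
    have hq : q = r.swap := by
      by_contra h2
      by_cases h3 : q = r
      · rw [h3, pr_wt_self] at h1; omega
      · rw [pr_wt_ne h3 h2] at h1; omega
    subst hq
    refine Or.inr ⟨wt_injective ?_, rfl⟩
    rw [wt_swap] at h ⊢
    rw [sub_neg_eq_add, sub_eq_neg_add, add_comm] at h
    rw [add_comm] at h
    linear_combination h

/-- The sum of the coordinates of `wt p - wt q` is even. -/
theorem wt_sub_wt_ne_single (p q : ι ⊕ ι) (o : ι) : wt p - wt q ≠ Pi.single o 1 := by
  intro h
  have h1 := congrArg (hgt (fun _ => 1)) h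
  have h2 : hgt (fun _ => 1) (Pi.single o 1 : ι → ℤ) = 1 := by simp [hgt]
  rw [hgt_sub, hgt_wt, hgt_wt, h2] at h1
  rcases p with i | i <;> rcases q with j | j <;> simp at h1

theorem torus_mul_sub (c : ι → F) (A : Matrix (ι ⊕ ι) (ι ⊕ ι) F) (p q : ι ⊕ ι) :
    ((spTorus F ι c : Matrix (ι ⊕ ι) (ι ⊕ ι) F) * A -
      A * (spTorus F ι c : Matrix (ι ⊕ ι) (ι ⊕ ι) F)) p q = wtEval (wt p - wt q) c * A p q := by
  rw [coe_spTorus, Matrix.sub_apply, Matrix.diagonal_mul, Matrix.mul_diagonal, wtEval_sub,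
    wtEval_wt, wtEval_wt]
  ring

theorem wt_sub_wt_of_ne_zero {A : Matrix (ι ⊕ ι) (ι ⊕ ι) F} {μ : ι → ℤ}
    (h : ∀ c, (spTorus F ι c : Matrix (ι ⊕ ι) (ι ⊕ ι) F) * A -
      A * (spTorus F ι c : Matrix (ι ⊕ ι) (ι ⊕ ι) F) = wtEval μ c • A) {p q : ι ⊕ ι}
    (hpq : A p q ≠ 0) : wt p - wt q = μ := by
  by_contra hne
  obtain ⟨c, hc⟩ := exists_wtEval_ne (F := F) hne
  have h1 := congrFun (congrFun (h c) p) q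
  rw [torus_mul_sub, Matrix.smul_apply, smul_eq_mul] at h1
  exact hc (mul_right_cancel₀ hpq h1)

/-- A matrix commuting with the symplectic Lie algebra is scalar. -/
theorem eq_diagonal_of_commute {A : Matrix (ι ⊕ ι) (ι ⊕ ι) F}
    (h : ∀ g : sp ι F, (g : Matrix (ι ⊕ ι) (ι ⊕ ι) F) * A -
      A * (g : Matrix (ι ⊕ ι) (ι ⊕ ι) F) = 0) (r : ι ⊕ ι) :
    A = Matrix.diagonal fun _ => A r r := by
  have h1 : ∀ p q, p ≠ q → A p q = 0 := by
    intro p q hpq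
    by_contra h0
    exact wt_sub_ne_zero hpq (wt_sub_wt_of_ne_zero (μ := 0)
      (fun c => by rw [h, wtEval_zero, zero_smul]) h0)
  have h2 : ∀ p q, A p p = A q q := by
    intro p q
    by_cases hpq : p = q
    · rw [hpq]
    have h3 := congrFun (congrFun (h (spX F p q)) p) q
    rw [Matrix.sub_apply, Matrix.mul_apply, Matrix.mul_apply, Finset.sum_eq_single q,
      Finset.sum_eq_single p, mul_comm, ← sub_mul, Matrix.zero_apply, mul_eq_zero] at h3
    · rcases h3 with h3 | h3
      · exact (sub_eq_zero.1 h3).symm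
      · exfalso
        rw [spX_apply, if_pos ⟨rfl, rfl⟩] at h3
        split_ifs at h3 with h4
        · rw [← h4.2, sgn_swap] at h3
          have := sgn_mul_self (F := F) p
          have h5 : (2 : F) = 0 := by linear_combination h3 - this
          exact two_ne_zero h5
        · simp at h3
    · intro b _ hb; rw [h1 p b (Ne.symm hb), zero_mul]
    · simp
    · intro b _ hb; rw [h1 b q hb, mul_zero]
    · simp
  ext p q
  rw [Matrix.diagonal_apply]
  split_ifs with hpq
  · rw [hpq]; exact h2 q r
  · exact h1 p q hpq

/-! #### The adjoint module -/

theorem lOne_wt_sub_wt (p q : ι ⊕ ι) : lOne (wt p - wt q) ≤ 2 := by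
  have := lOne_add_le (wt p) (-wt q)
  rw [lOne_neg, lOne_wt, lOne_wt, ← sub_eq_add_neg] at this
  exact this

theorem isWeightedBy_sp : IsWeightedBy (spTorus F ι) (sp ι F) (weightsBC ι) := fun g =>
  sp_induction _ (fun p q =>
    mem_iSup_wtSpace (mem_weightsBC.2 (lOne_wt_sub_wt p q)) (spX_mem p q)) g

theorem wt_sub_of_sp {A : sp ι F} {μ : ι → ℤ} (h : A ∈ wtSpace (spTorus F ι) (sp ι F) μ)
    {p q : ι ⊕ ι} (hpq : (A : Matrix (ι ⊕ ι) (ι ⊕ ι) F) p q ≠ 0) : wt p - wt q = μ :=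
  wt_sub_wt_of_ne_zero (fun c => by rw [← coe_sp_lie, h c, coe_sp_smul]) hpq

theorem single_two_eq (o : ι) : (Pi.single o 2 : ι → ℤ) = wt (Sum.inl o) - wt (Sum.inr o) := by
  simp [wt, ← Pi.single_add]

theorem single_add_eq (o₁ o₂ : ι) : (Pi.single o₁ 1 + Pi.single o₂ 1 : ι → ℤ) =
    wt (Sum.inl o₁) - wt (Sum.inr o₂) := by
  simp [wt]

/-- The entry functional. -/
def entry (F : Type*) [Field F] (p q : ι ⊕ ι) : Matrix (ι ⊕ ι) (ι ⊕ ι) F →ₗ[F] F where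
  toFun A := A p q
  map_add' _ _ := rfl
  map_smul' _ _ := rfl

/-- The inclusion of the symplectic Lie algebra into the matrices. -/
def spCoe (F ι : Type*) [Field F] [Fintype ι] [DecidableEq ι] :
    sp ι F →ₗ[F] Matrix (ι ⊕ ι) (ι ⊕ ι) F where
  toFun A := A
  map_add' _ _ := rfl
  map_smul' _ _ := rfl

/-- The other dominant weights are excluded in turn: for weight 0 the matrix would be scalar and
skew-adjoint, `ε₁ + ε₂` fails to be killed by the root `ε₁ - ε₂`, and `ε₁` has odd coordinate sum.
-/
theorem isHWModule_sp (ha : IsHeight a o₁ o₂) : IsHWModule F (sp ι F) a (Pi.single o₁ 2) := by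
  refine isHWModule_of ha (Or.inl rfl) isWeightedBy_sp ?_ ?_
    ((entry F (Sum.inl o₁) (Sum.inr o₁)).comp (spCoe F ι)) ?_
  · refine ⟨spX F (Sum.inl o₁) (Sum.inl o₂), fun h => ?_⟩
    have h1 : (spX F (Sum.inl o₁) (Sum.inl o₂) : Matrix (ι ⊕ ι) (ι ⊕ ι) F) (Sum.inl o₁)
      (Sum.inl o₂) = 0 := by rw [h]; rfl
    rw [spX_apply] at h1
    simp at h1
  · intro μ A hA hA0 hhw
    rcases hhw.isDom ha isWeightedBy_sp hA hA0 with rfl | rfl | rfl | rfl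
    · exfalso
      apply hA0
      have h1 := eq_diagonal_of_commute (A := (A : Matrix (ι ⊕ ι) (ι ⊕ ι) F)) (fun g => by
        rw [← coe_sp_lie, hhw.lie_eq_zero ha isWeightedBy_sp hA]; rfl) (Sum.inl o₁)
      have h2 := congrFun (congrFun (mem_sp_iff.1 A.2) (Sum.inl o₁)) (Sum.inl o₁)
      have h3 : (A : Matrix (ι ⊕ ι) (ι ⊕ ι) F) (Sum.inl o₁) (Sum.inl o₁) = 0 := by
        rw [spAdj_apply, Matrix.neg_apply, sgn_mul_self, one_mul] at h2
        generalize (A : Matrix (ι ⊕ ι) (ι ⊕ ι) F) (Sum.inl o₁) (Sum.inl o₁) = t at h1 h2 ⊢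
        rw [h1, Matrix.diagonal_apply_eq] at h2
        have : (2 : F) * t = 0 := by linear_combination h2
        exact (mul_eq_zero.1 this).resolve_left two_ne_zero
      apply Subtype.ext
      rw [h1, h3]
      exact Matrix.diagonal_zero
    · rfl
    · exfalso
      -- Skew-adjointness makes the two possible entries equal, while the bracket with `spX F
      -- (Sum.inl o₁) (Sum.inl o₂)` has their sum as an entry. So both vanish.
      have hsupp : ∀ p q, (A : Matrix (ι ⊕ ι) (ι ⊕ ι) F) p q ≠ 0 →
          (p = Sum.inl o₁ ∧ q = Sum.inr o₂) ∨ (p = Sum.inl o₂ ∧ q = Sum.inr o₁) := by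
        intro p q hpq
        have h1 := wt_sub_of_sp hA hpq
        rw [single_add_eq] at h1
        simpa using wt_sub_wt_eq (by simp) h1
      have h1 := congrArg Subtype.val (hhw (Sum.inl o₁) (Sum.inl o₂) (ha.lt₁ o₂ ha.ne.symm))
      rw [coe_sp_lie] at h1
      have h2 := congrFun (congrFun h1 (Sum.inl o₁)) (Sum.inr o₁)
      rw [Matrix.sub_apply, Matrix.mul_apply, Matrix.mul_apply,
        Finset.sum_eq_single (Sum.inl o₂), Finset.sum_eq_single (Sum.inr o₂), spX_apply,
        spX_apply] at h2
      · have h3 := congrFun (congrFun (mem_sp_iff.1 A.2) (Sum.inl o₁)) (Sum.inr o₂)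
        rw [spAdj_apply, Matrix.neg_apply] at h3
        simp [sgn] at h2 h3
        have h4 : (A : Matrix (ι ⊕ ι) (ι ⊕ ι) F) (Sum.inl o₁) (Sum.inr o₂) = 0 := by
          have : (2 : F) * (A : Matrix (ι ⊕ ι) (ι ⊕ ι) F) (Sum.inl o₁) (Sum.inr o₂) = 0 := by
            linear_combination h2 - h3
          exact (mul_eq_zero.1 this).resolve_left two_ne_zero
        rw [h4] at h3
        apply hA0
        apply Subtype.ext
        ext p q
        by_contra hpq
        rcases hsupp p q hpq with ⟨rfl, rfl⟩ | ⟨rfl, rfl⟩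
        · exact hpq h4
        · exact hpq h3
      · intro b _ hb
        by_cases h0 : (A : Matrix (ι ⊕ ι) (ι ⊕ ι) F) (Sum.inl o₁) b = 0
        · rw [h0, zero_mul]
        · rcases hsupp _ _ h0 with ⟨-, h⟩ | ⟨h, -⟩
          · exact absurd h hb
          · exact absurd (Sum.inl_injective h) ha.ne
      · simp
      · intro b _ hb
        by_cases h0 : (A : Matrix (ι ⊕ ι) (ι ⊕ ι) F) b (Sum.inr o₁) = 0
        · rw [h0, mul_zero]
        · rcases hsupp _ _ h0 with ⟨-, h⟩ | ⟨h, -⟩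
          · exact absurd (Sum.inr_injective h) ha.ne
          · exact absurd h hb
      · simp
    · exfalso
      apply hA0
      apply Subtype.ext
      ext p q
      by_contra hpq
      exact wt_sub_wt_ne_single p q o₁ (wt_sub_of_sp hA hpq)
  · intro A hA h0
    apply Subtype.ext
    ext p q
    by_contra hpq
    have h1 := wt_sub_of_sp hA hpq
    rw [single_two_eq] at h1
    have h2 := wt_sub_wt_eq (by simp) h1
    simp at h2
    obtain ⟨rfl, rfl⟩ := h2
    exact hpq h0

/-! #### The module of self-adjoint trace zero matrices -/

theorem lie_mem_spS (g : sp ι F) {A : Matrix (ι ⊕ ι) (ι ⊕ ι) F} (hA : A ∈ spS ι F) :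
    (g : Matrix (ι ⊕ ι) (ι ⊕ ι) F) * A - A * (g : Matrix (ι ⊕ ι) (ι ⊕ ι) F) ∈ spS ι F := by
  rw [mem_spS_iff] at hA ⊢
  refine ⟨?_, ?_⟩
  · rw [map_sub, spAdj_mul, spAdj_mul, hA.1, mem_sp_iff.1 g.2]
    noncomm_ring
  · rw [Matrix.trace_sub, Matrix.trace_mul_comm, sub_self]

instance spSLieRingModule : LieRingModule (sp ι F) (spS ι F) where
  bracket g A := ⟨(g : Matrix (ι ⊕ ι) (ι ⊕ ι) F) * (A : Matrix (ι ⊕ ι) (ι ⊕ ι) F) -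
    (A : Matrix (ι ⊕ ι) (ι ⊕ ι) F) * (g : Matrix (ι ⊕ ι) (ι ⊕ ι) F), lie_mem_spS g A.2⟩
  add_lie g g' A := Subtype.ext (by
    simp only [coe_sp_add, Submodule.coe_add]; noncomm_ring)
  lie_add g A A' := Subtype.ext (by
    simp only [Submodule.coe_add]; noncomm_ring)
  leibniz_lie g g' A := Subtype.ext (by
    simp only [coe_sp_lie, Submodule.coe_add]; noncomm_ring)

theorem coe_spS_lie (g : sp ι F) (A : spS ι F) : ((⁅g, A⁆ : spS ι F) : Matrix (ι ⊕ ι) (ι ⊕ ι) F) =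
    (g : Matrix (ι ⊕ ι) (ι ⊕ ι) F) * (A : Matrix (ι ⊕ ι) (ι ⊕ ι) F) -
      (A : Matrix (ι ⊕ ι) (ι ⊕ ι) F) * (g : Matrix (ι ⊕ ι) (ι ⊕ ι) F) := rfl

instance spSLieModule : LieModule F (sp ι F) (spS ι F) where
  smul_lie c g A := Subtype.ext (by
    rw [coe_spS_lie, coe_sp_smul, Submodule.coe_smul, coe_spS_lie, Matrix.smul_mul,
      Matrix.mul_smul, smul_sub])
  lie_smul c g A := Subtype.ext (by
    rw [coe_spS_lie, Submodule.coe_smul, Submodule.coe_smul, coe_spS_lie, Matrix.smul_mul,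
      Matrix.mul_smul, smul_sub])

theorem wt_sub_of_spS {A : spS ι F} {μ : ι → ℤ} (h : A ∈ wtSpace (spTorus F ι) (spS ι F) μ)
    {p q : ι ⊕ ι} (hpq : (A : Matrix (ι ⊕ ι) (ι ⊕ ι) F) p q ≠ 0) : wt p - wt q = μ :=
  wt_sub_wt_of_ne_zero (fun c => by rw [← coe_spS_lie, h c, Submodule.coe_smul]) hpq

/-- The self-adjoint part of a matrix (up to a factor). -/
theorem add_spAdj_mem {A : Matrix (ι ⊕ ι) (ι ⊕ ι) F} (hA : A.trace = 0) :
    A + spAdj A ∈ spS ι F := by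
  rw [mem_spS_iff, map_add, spAdj_spAdj, add_comm, Matrix.trace_add, hA, zero_add]
  refine ⟨rfl, ?_⟩
  rw [← hA, Matrix.trace, Matrix.trace, ← (Equiv.sumComm ι ι).sum_comp]
  refine Finset.sum_congr rfl fun p _ => ?_
  rw [Matrix.diag_apply, Matrix.diag_apply, spAdj_apply, sgn_mul_self, one_mul,
    Equiv.sumComm_apply, Sum.swap_swap]

theorem torus_lie_of_diag (c : ι → F) (A : Matrix (ι ⊕ ι) (ι ⊕ ι) F) {μ : ι → ℤ}
    (h : ∀ p q, A p q ≠ 0 → wt p - wt q = μ) :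
    (spTorus F ι c : Matrix (ι ⊕ ι) (ι ⊕ ι) F) * A -
      A * (spTorus F ι c : Matrix (ι ⊕ ι) (ι ⊕ ι) F) = wtEval μ c • A := by
  ext p q
  rw [torus_mul_sub, Matrix.smul_apply, smul_eq_mul]
  by_cases h0 : A p q = 0
  · rw [h0, mul_zero, mul_zero]
  · rw [h p q h0]

theorem isWeightedBy_spS : IsWeightedBy (spTorus F ι) (spS ι F) (weightsBC ι) := by
  intro A
  -- the component of weight `μ`
  let B : (ι → ℤ) → spS ι F := fun μ =>
    ⟨Matrix.of fun p q => if wt p - wt q = μ then (A : Matrix (ι ⊕ ι) (ι ⊕ ι) F) p q else 0, by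
      obtain ⟨h1, h2⟩ := mem_spS_iff.1 A.2
      rw [mem_spS_iff]
      constructor
      · ext r s
        have h3 := congrFun (congrFun h1 r) s
        rw [spAdj_apply] at h3
        rw [spAdj_apply, Matrix.of_apply, Matrix.of_apply, wt_swap, wt_swap, neg_sub_neg]
        split_ifs
        · exact h3
        · exact mul_zero _
      · rw [Matrix.trace] at h2 ⊢
        simp only [Matrix.diag_apply, Matrix.of_apply, sub_self] at h2 ⊢
        split_ifs
        · exact h2
        · simp⟩
  have hB : ∀ μ, B μ ∈ wtSpace (spTorus F ι) (spS ι F) μ := by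
    intro μ c
    apply Subtype.ext
    rw [coe_spS_lie, Submodule.coe_smul]
    refine torus_lie_of_diag c _ fun p q hpq => ?_
    by_contra h
    exact hpq (if_neg h)
  have hs : A = ∑ μ ∈ weightsBC ι, B μ := by
    apply Subtype.ext
    ext p q
    rw [Submodule.coe_sum, Matrix.sum_apply, Finset.sum_eq_single (wt p - wt q)]
    · exact (if_pos rfl).symm
    · intro μ _ hμ
      exact if_neg hμ.symm
    · exact fun h => absurd (mem_weightsBC.2 (lOne_wt_sub_wt p q)) h
  rw [hs]
  exact Submodule.sum_mem _ fun μ hμ => mem_iSup_wtSpace hμ (hB μ)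

/-- Weight 0 is excluded by the trace condition on scalar matrices. Weight `2ε₁` is excluded because
self-adjointness changes the sign of the only possible entry, and `ε₁` by parity. -/
theorem isHWModule_spS (ha : IsHeight a o₁ o₂) :
    IsHWModule F (spS ι F) a (Pi.single o₁ 1 + Pi.single o₂ 1) := by
  refine isHWModule_of ha (Or.inr (Or.inl rfl)) isWeightedBy_spS ?_ ?_
    ((entry F (Sum.inl o₁) (Sum.inr o₂)).comp (spS ι F).subtype) ?_
  · refine ⟨⟨_, add_spAdj_mem (A := Matrix.single (Sum.inl o₁) (Sum.inl o₂) 1)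
      (Matrix.trace_single_eq_of_ne _ _ _ (by simpa using ha.ne))⟩, fun h => ?_⟩
    have h1 := congrFun (congrFun (congrArg Subtype.val h) (Sum.inl o₁)) (Sum.inl o₂)
    change (Matrix.single (Sum.inl o₁) (Sum.inl o₂) 1 + spAdj _ : Matrix _ _ F) _ _ = 0 at h1
    rw [Matrix.add_apply, spAdj_single, Matrix.smul_apply] at h1
    simp at h1
  · intro μ A hA hA0 hhw
    rcases hhw.isDom ha isWeightedBy_spS hA hA0 with rfl | rfl | rfl | rfl
    · exfalso
      apply hA0
      have h1 := eq_diagonal_of_commute (A := (A : Matrix (ι ⊕ ι) (ι ⊕ ι) F)) (fun g => by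
        rw [← coe_spS_lie, hhw.lie_eq_zero ha isWeightedBy_spS hA]; rfl) (Sum.inl o₁)
      have h2 := (mem_spS_iff.1 A.2).2
      have h3 : (A : Matrix (ι ⊕ ι) (ι ⊕ ι) F) (Sum.inl o₁) (Sum.inl o₁) = 0 := by
        generalize (A : Matrix (ι ⊕ ι) (ι ⊕ ι) F) (Sum.inl o₁) (Sum.inl o₁) = t at h1 ⊢
        rw [h1, Matrix.trace_diagonal, Finset.sum_const, Finset.card_univ, nsmul_eq_mul] at h2
        have : Nonempty (ι ⊕ ι) := ⟨Sum.inl o₁⟩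
        exact (mul_eq_zero.1 h2).resolve_left (Nat.cast_ne_zero.2 Fintype.card_ne_zero)
      apply Subtype.ext
      rw [h1, h3]
      exact Matrix.diagonal_zero
    · exfalso
      apply hA0
      apply Subtype.ext
      ext p q
      by_contra hpq
      have h1 := wt_sub_of_spS hA hpq
      rw [single_two_eq] at h1
      have h2 := wt_sub_wt_eq (by simp) h1
      simp at h2
      obtain ⟨rfl, rfl⟩ := h2
      have h3 := congrFun (congrFun (mem_spS_iff.1 A.2).1 (Sum.inl o₁)) (Sum.inr o₁)
      rw [spAdj_apply] at h3
      simp [sgn] at h3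
      have : (2 : F) * (A : Matrix (ι ⊕ ι) (ι ⊕ ι) F) (Sum.inl o₁) (Sum.inr o₁) = 0 := by
        linear_combination -h3
      exact hpq ((mul_eq_zero.1 this).resolve_left two_ne_zero)
    · rfl
    · exfalso
      apply hA0
      apply Subtype.ext
      ext p q
      by_contra hpq
      exact wt_sub_wt_ne_single p q o₁ (wt_sub_of_spS hA hpq)
  · intro A hA h0
    apply Subtype.ext
    ext p q
    by_contra hpq
    have h1 := wt_sub_of_spS hA hpq
    rw [single_add_eq] at h1
    have h2 := wt_sub_wt_eq (by simp) h1
    simp at h2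
    rcases h2 with ⟨rfl, rfl⟩ | ⟨rfl, rfl⟩
    · exact hpq h0
    · have h3 := congrFun (congrFun (mem_spS_iff.1 A.2).1 (Sum.inl o₂)) (Sum.inr o₁)
      rw [spAdj_apply] at h3
      apply hpq
      rw [← h3]
      change _ * (A : Matrix (ι ⊕ ι) (ι ⊕ ι) F) (Sum.inl o₁) (Sum.inr o₂) = 0
      change (A : Matrix (ι ⊕ ι) (ι ⊕ ι) F) (Sum.inl o₁) (Sum.inr o₂) = 0 at h0
      rw [h0, mul_zero]

/-! #### The natural module -/

/-- The natural module of column vectors. -/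
def spV (ι F : Type*) := ι ⊕ ι → F

instance : AddCommGroup (spV ι F) := inferInstanceAs (AddCommGroup (ι ⊕ ι → F))

instance : Module F (spV ι F) := inferInstanceAs (Module F (ι ⊕ ι → F))

instance spVLieRingModule : LieRingModule (sp ι F) (spV ι F) where
  bracket g v := Matrix.mulVec (g : Matrix (ι ⊕ ι) (ι ⊕ ι) F) v
  add_lie g g' v := Matrix.add_mulVec _ _ _
  lie_add g v v' := Matrix.mulVec_add _ _ _
  leibniz_lie g g' v := by
    have h : ∀ w : ι ⊕ ι → F, Matrix.mulVec (g : Matrix (ι ⊕ ι) (ι ⊕ ι) F)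
        (Matrix.mulVec (g' : Matrix (ι ⊕ ι) (ι ⊕ ι) F) w) =
        Matrix.mulVec ((⁅g, g'⁆ : sp ι F) : Matrix (ι ⊕ ι) (ι ⊕ ι) F) w +
          Matrix.mulVec (g' : Matrix (ι ⊕ ι) (ι ⊕ ι) F)
            (Matrix.mulVec (g : Matrix (ι ⊕ ι) (ι ⊕ ι) F) w) := fun w => by
      rw [coe_sp_lie, Matrix.sub_mulVec, Matrix.mulVec_mulVec, Matrix.mulVec_mulVec,
        sub_add_cancel]
    exact h v

instance spVLieModule : LieModule F (sp ι F) (spV ι F) where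
  smul_lie c _ _ := Matrix.smul_mulVec c _ _
  lie_smul c _ _ := Matrix.mulVec_smul _ c _

theorem lie_spV (g : sp ι F) (v : spV ι F) :
    ⁅g, v⁆ = Matrix.mulVec (g : Matrix (ι ⊕ ι) (ι ⊕ ι) F) v := rfl

theorem torus_lie_spV (c : ι → F) (v : spV ι F) (p : ι ⊕ ι) :
    (⁅spTorus F ι c, v⁆ : spV ι F) p = wtEval (wt p) c * v p := by
  rw [lie_spV, coe_spTorus, wtEval_wt]
  exact Matrix.mulVec_diagonal _ _ _

theorem wt_of_spV {v : spV ι F} {μ : ι → ℤ} (h : v ∈ wtSpace (spTorus F ι) (spV ι F) μ)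
    {p : ι ⊕ ι} (hp : v p ≠ 0) : wt p = μ := by
  by_contra hne
  obtain ⟨c, hc⟩ := exists_wtEval_ne (F := F) hne
  have h1 := congrFun (h c) p
  rw [torus_lie_spV] at h1
  exact hc (mul_right_cancel₀ hp h1)

theorem isWeightedBy_spV : IsWeightedBy (spTorus F ι) (spV ι F) (weightsBC ι) := by
  intro v
  let w : ι ⊕ ι → spV ι F := fun p => (Pi.single p (v p) : ι ⊕ ι → F)
  have hs : v = ∑ p, w p := (Finset.univ_sum_single (v : ι ⊕ ι → F)).symm
  rw [hs]
  refine Submodule.sum_mem _ fun p _ => mem_iSup_wtSpace (μ := wt p)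
    (mem_weightsBC.2 (by rw [lOne_wt]; norm_num)) fun c => ?_
  funext q
  rw [torus_lie_spV]
  change wtEval (wt q) c * (Pi.single p (v p) : ι ⊕ ι → F) q =
    wtEval (wt p) c * (Pi.single p (v p) : ι ⊕ ι → F) q
  by_cases hq : q = p
  · rw [hq]
  · rw [Pi.single_eq_of_ne hq, mul_zero, mul_zero]

/-- All weights of column vectors have norm 1, which leaves `ε₁` as the only possible highest
weight. -/
theorem isHWModule_spV (ha : IsHeight a o₁ o₂) : IsHWModule F (spV ι F) a (Pi.single o₁ 1) := by
  have h1 : (Pi.single o₁ 1 : ι → ℤ) = wt (Sum.inl o₁) := rfl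
  refine isHWModule_of ha (Or.inr (Or.inr rfl)) isWeightedBy_spV
    ⟨(Pi.single (Sum.inl o₁) 1 : ι ⊕ ι → F), fun h => ?_⟩ ?_
    (LinearMap.proj (R := F) (φ := fun _ : ι ⊕ ι => F) (Sum.inl o₁)) ?_
  · have := congrFun h (Sum.inl o₁)
    change (Pi.single (Sum.inl o₁) 1 : ι ⊕ ι → F) (Sum.inl o₁) = 0 at this
    rw [Pi.single_eq_same] at this
    exact one_ne_zero this
  · intro μ v hv hv0 hhw
    obtain ⟨p, hp⟩ : ∃ p, v p ≠ 0 := by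
      by_contra! h
      exact hv0 (funext h)
    have h2 := wt_of_spV hv hp
    have h3 : lOne μ = 1 := by rw [← h2, lOne_wt]
    rcases hhw.isDom ha isWeightedBy_spV hv hv0 with rfl | rfl | rfl | rfl
    · simp [lOne] at h3
    · simp [lOne_single] at h3
    · rw [lOne_single_add_single ha.ne] at h3
      norm_num at h3
    · rfl
  · intro v hv h0
    funext p
    by_contra hp
    have h2 := wt_injective ((wt_of_spV hv hp).trans h1)
    subst h2
    exact hp h0

end Models

/-! ### The symplectic Lie algebra is of type C; dimensions of the three modules. -/

section SymplecticTypeC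

open LieAlgebra.Symplectic

variable {F ι : Type*} [Field F] [CharZero F] [Fintype ι] [DecidableEq ι]

theorem spX_ne_zero (p q : ι ⊕ ι) : spX F p q ≠ 0 := by
  intro h
  have h3 : (spX F p q : Matrix (ι ⊕ ι) (ι ⊕ ι) F) p q = 0 := by rw [h]; rfl
  rw [spX_apply, if_pos ⟨rfl, rfl⟩] at h3
  split_ifs at h3 with h4
  · rw [← h4.2, sgn_swap] at h3
    have := sgn_mul_self (F := F) p
    have h5 : (2 : F) = 0 := by linear_combination h3 - this
    exact two_ne_zero h5
  · simp at h3

theorem wt_sub_wt_mem_weightsC (p q : ι ⊕ ι) : wt p - wt q ∈ weightsC ι := by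
  rw [mem_weightsC]
  have h1 := lOne_wt_sub_wt p q
  have h2 := lOne_nonneg (wt p - wt q)
  have h3 : lOne (wt p - wt q) ≠ 1 := by
    intro h
    obtain ⟨i, t, rfl | rfl, h4⟩ := exists_single_of_lOne_one h
    · exact wt_sub_wt_ne_single p q i h4
    · refine wt_sub_wt_ne_single q p i ?_
      rw [← neg_sub, h4, ← Pi.single_neg, neg_neg]
  omega

theorem exists_wt_eq (i : ι) {t : ℤ} (ht : t = 1 ∨ t = -1) :
    ∃ p : ι ⊕ ι, wt p = Pi.single i t := by
  rcases ht with rfl | rfl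
  · exact ⟨Sum.inl i, rfl⟩
  · exact ⟨Sum.inr i, by simp [wt, ← Pi.single_neg]⟩

/-- Simplicity is the irreducibility of the adjoint module, already known from its highest weight.
-/
theorem isTypeC_spTorus {o₁ o₂ : ι} (h : o₁ ≠ o₂) : IsTypeC (spTorus F ι) where
  simple J := by
    obtain ⟨a, ha⟩ := exists_isHeight h
    exact (isHWModule_sp (F := F) ha).eq_bot_or_eq_top ha (Or.inl rfl) J
  inj c d hcd := by
    funext i
    have h1 := congrFun (congrFun (congrArg Subtype.val hcd) (Sum.inl i)) (Sum.inl i)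
    rw [coe_spTorus, coe_spTorus, Matrix.diagonal_apply_eq, Matrix.diagonal_apply_eq] at h1
    exact h1
  comm c d := by
    apply Subtype.ext
    rw [coe_sp_lie, coe_spTorus, coe_spTorus, Matrix.diagonal_mul_diagonal,
      Matrix.diagonal_mul_diagonal, sub_eq_zero.2]
    · rfl
    · exact congrArg Matrix.diagonal (funext fun p => mul_comm _ _)
  weighted g := sp_induction _ (fun p q =>
    mem_iSup_wtSpace (wt_sub_wt_mem_weightsC p q) (spX_mem p q)) g
  zero x hx := by
    refine ⟨fun i => (x : Matrix (ι ⊕ ι) (ι ⊕ ι) F) (Sum.inl i) (Sum.inl i), ?_⟩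
    apply Subtype.ext
    ext p q
    rw [coe_spTorus, Matrix.diagonal_apply]
    split_ifs with hpq
    · subst hpq
      rcases p with i | i
      · rfl
      · have h1 := congrFun (congrFun (mem_sp_iff.1 x.2) (Sum.inr i)) (Sum.inr i)
        rw [spAdj_apply, sgn_mul_self, one_mul, Matrix.neg_apply] at h1
        exact neg_eq_iff_eq_neg.2 h1
    · by_contra h0
      exact wt_sub_ne_zero hpq (wt_sub_of_sp hx (Ne.symm h0))
  nonzero μ hμ := by
    have key : ∃ p q : ι ⊕ ι, wt p - wt q = μ := by
      rcases weightsC_cases hμ with ⟨i, t, ht, rfl⟩ | ⟨i, j, -, t, u, ht, hu, rfl⟩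
      · obtain ⟨p, hp⟩ := exists_wt_eq i ht
        refine ⟨p, p.swap, ?_⟩
        rw [wt_swap, hp, sub_neg_eq_add, ← Pi.single_add, two_mul]
      · obtain ⟨p, hp⟩ := exists_wt_eq i ht
        obtain ⟨q, hq⟩ := exists_wt_eq j hu
        exact ⟨p, q.swap, by rw [wt_swap, hp, hq, sub_neg_eq_add]⟩
    obtain ⟨p, q, rfl⟩ := key
    exact ⟨_, spX_mem p q, spX_ne_zero p q⟩

/-! #### Dimensions -/

instance : FiniteDimensional F (sp ι F) :=
  FiniteDimensional.of_injective (spCoe F ι) Subtype.val_injective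

instance : FiniteDimensional F (spV ι F) := inferInstanceAs (FiniteDimensional F (ι ⊕ ι → F))

theorem finrank_spV : Module.finrank F (spV ι F) = 2 * Fintype.card ι := by
  have : Module.finrank F (ι ⊕ ι → F) = 2 * Fintype.card ι := by
    rw [Module.finrank_fintype_fun_eq_card, Fintype.card_sum, two_mul]
  exact this

/-- Every matrix is uniquely the sum of a skew-adjoint one, a self-adjoint one of trace zero, and a
scalar. -/
theorem finrank_sp_add [Nonempty ι] : Module.finrank F (sp ι F) +
    (Module.finrank F (spS ι F) + 1) = 4 * (Fintype.card ι * Fintype.card ι) := by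
  let f : (sp ι F × (spS ι F × F)) →ₗ[F] Matrix (ι ⊕ ι) (ι ⊕ ι) F :=
    (spCoe F ι).coprod ((spS ι F).subtype.coprod (LinearMap.toSpanSingleton F _ 1))
  have hf : ∀ x y t, f (x, (y, t)) = (x : Matrix (ι ⊕ ι) (ι ⊕ ι) F) + (y + t • 1) := by
    intro x y t
    rfl
  have h1 : spAdj (1 : Matrix (ι ⊕ ι) (ι ⊕ ι) F) = 1 := by
    ext r s
    rw [spAdj_apply, Matrix.one_apply, Matrix.one_apply]
    by_cases h : r = s
    · subst h; simp
    · rw [if_neg h, if_neg, mul_zero]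
      intro e
      exact h (by simpa using (congrArg Sum.swap e).symm)
  have hn : (Fintype.card (ι ⊕ ι) : F) ≠ 0 := Nat.cast_ne_zero.2 Fintype.card_ne_zero
  have hbij : Function.Bijective f := by
    constructor
    · rw [injective_iff_map_eq_zero]
      rintro ⟨x, y, t⟩ h
      rw [hf] at h
      have h2 := congrArg spAdj h
      rw [map_add, map_add, map_smul, h1, mem_sp_iff.1 x.2, (mem_spS_iff.1 y.2).1, map_zero] at h2
      have h3 : (x : Matrix (ι ⊕ ι) (ι ⊕ ι) F) = 0 := by
        have : (2 : F) • (x : Matrix (ι ⊕ ι) (ι ⊕ ι) F) =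
            (x : Matrix (ι ⊕ ι) (ι ⊕ ι) F) + ((y : Matrix (ι ⊕ ι) (ι ⊕ ι) F) + t • 1) -
            (-(x : Matrix (ι ⊕ ι) (ι ⊕ ι) F) + ((y : Matrix (ι ⊕ ι) (ι ⊕ ι) F) + t • 1)) := by
          rw [two_smul]; abel
        rw [h, h2, sub_zero] at this
        exact (smul_eq_zero.1 this).resolve_left two_ne_zero
      rw [h3, zero_add] at h
      have h4 := congrArg Matrix.trace h
      rw [Matrix.trace_add, (mem_spS_iff.1 y.2).2, Matrix.trace_smul, Matrix.trace_one, zero_add,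
        Matrix.trace_zero, smul_eq_mul, mul_eq_zero, or_iff_left hn] at h4
      rw [h4, zero_smul, add_zero] at h
      exact Prod.ext (Subtype.ext h3) (Prod.ext (Subtype.ext h) h4)
    · intro A
      let c : F := A.trace / Fintype.card (ι ⊕ ι)
      have hc : (A - c • 1).trace = 0 := by
        rw [Matrix.trace_sub, Matrix.trace_smul, Matrix.trace_one, smul_eq_mul,
          div_mul_cancel₀ _ hn, sub_self]
      refine ⟨((2 : F)⁻¹ • spProj A, ((2 : F)⁻¹ • ⟨_, add_spAdj_mem hc⟩, c)), ?_⟩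
      rw [hf, coe_sp_smul, coe_spProj]
      change (2 : F)⁻¹ • (A - spAdj A) +
        ((2 : F)⁻¹ • ((A - c • 1) + spAdj (A - c • 1)) + c • 1) = A
      rw [map_sub, map_smul, h1]
      module
  have h := (LinearEquiv.ofBijective f hbij).finrank_eq
  rw [Module.finrank_prod, Module.finrank_prod, Module.finrank_self, Module.finrank_matrix,
    Module.finrank_self, Fintype.card_sum] at h
  rw [h]
  ring

/-- A matrix supported on the upper left block. -/
def upperBlock (B : Matrix ι ι F) : Matrix (ι ⊕ ι) (ι ⊕ ι) F := Matrix.fromBlocks B 0 0 0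

theorem spAdj_upperBlock (B : Matrix ι ι F) (i j : ι) :
    spAdj (upperBlock B) (Sum.inl i) (Sum.inl j) = 0 := by
  rw [spAdj_apply]
  exact mul_zero _

/-- The upper left block of a skew-adjoint matrix is arbitrary. This crude bound and the one for
`spS`, with the sum of the dimensions, suffice to tell the modules apart. -/
theorem card_sq_le_finrank_sp : Fintype.card ι * Fintype.card ι ≤ Module.finrank F (sp ι F) := by
  let f : sp ι F →ₗ[F] Matrix ι ι F :=
    { toFun := fun A => (A : Matrix (ι ⊕ ι) (ι ⊕ ι) F).toBlocks₁₁
      map_add' := fun _ _ => rfl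
      map_smul' := fun _ _ => rfl }
  have hf : Function.Surjective f := by
    intro B
    refine ⟨spProj (upperBlock B), ?_⟩
    ext i j
    change (spProj (upperBlock B) : Matrix (ι ⊕ ι) (ι ⊕ ι) F) (Sum.inl i) (Sum.inl j) = _
    rw [coe_spProj, Matrix.sub_apply, spAdj_upperBlock, sub_zero]
    rfl
  have := LinearMap.finrank_le_finrank_of_surjective hf
  rwa [Module.finrank_matrix, Module.finrank_self, mul_one] at this

theorem card_sq_le_finrank_spS [Nonempty ι] :
    Fintype.card ι * Fintype.card ι ≤ Module.finrank F (spS ι F) + 1 := by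
  let f : (spS ι F × F) →ₗ[F] Matrix ι ι F :=
    { toFun := fun A => (A.1 : Matrix (ι ⊕ ι) (ι ⊕ ι) F).toBlocks₁₁ + A.2 • 1
      map_add' := fun A B => by
        change (A.1 : Matrix (ι ⊕ ι) (ι ⊕ ι) F).toBlocks₁₁ +
          (B.1 : Matrix (ι ⊕ ι) (ι ⊕ ι) F).toBlocks₁₁ + (A.2 + B.2) • 1 = _
        rw [add_smul]
        abel
      map_smul' := fun c A => by
        change c • (A.1 : Matrix (ι ⊕ ι) (ι ⊕ ι) F).toBlocks₁₁ + (c * A.2) • 1 = _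
        rw [RingHom.id_apply, smul_add, smul_smul] }
  have hn : (Fintype.card ι : F) ≠ 0 := Nat.cast_ne_zero.2 Fintype.card_ne_zero
  have hf : Function.Surjective f := by
    intro B
    let c : F := B.trace / Fintype.card ι
    have hc : (upperBlock (B - c • 1)).trace = 0 := by
      have h1 : (B - c • 1).trace = 0 := by
        rw [Matrix.trace_sub, Matrix.trace_smul, Matrix.trace_one, smul_eq_mul,
          div_mul_cancel₀ _ hn, sub_self]
      rw [Matrix.trace, Fintype.sum_sum_type]
      change (B - c • 1).trace + ∑ i : ι, (0 : F) = 0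
      rw [h1, Finset.sum_const_zero, add_zero]
    refine ⟨(⟨_, add_spAdj_mem hc⟩, c), ?_⟩
    ext i j
    change (upperBlock (B - c • 1) + spAdj (upperBlock (B - c • 1)) :
      Matrix (ι ⊕ ι) (ι ⊕ ι) F) (Sum.inl i) (Sum.inl j) +
      (c • (1 : Matrix ι ι F)) i j = _
    rw [Matrix.add_apply, spAdj_upperBlock, add_zero]
    change (B - c • (1 : Matrix ι ι F)) i j + (c • (1 : Matrix ι ι F)) i j = _
    rw [Matrix.sub_apply, sub_add_cancel]
  have := LinearMap.finrank_le_finrank_of_surjective hf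
  rwa [Module.finrank_matrix, Module.finrank_self, mul_one, Module.finrank_prod,
    Module.finrank_self] at this

end SymplecticTypeC

/-! ### Decomposition of a module with weights of type `BC` -/

/-- Independence can be checked within the eigenspaces of an endomorphism. -/
theorem iSupIndep_of_le_eigenspace {F M J : Type*} [Field F] [AddCommGroup M] [Module F M]
    (T : Module.End F M) (f : J → Submodule F M) (c : J → F) (h : ∀ j, f j ≤ T.eigenspace (c j))
    (h' : ∀ j, Disjoint (f j) (⨆ k, ⨆ (_ : k ≠ j ∧ c k = c j), f k)) : iSupIndep f := by
  intro j
  rw [Submodule.disjoint_def]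
  intro x hx hx'
  -- Summands with another eigenvalue are absorbed into the other eigenspaces, which are independent
  -- of the one for `c j`.
  have hle : (⨆ k, ⨆ (_ : k ≠ j), f k) ≤ (⨆ k, ⨆ (_ : k ≠ j ∧ c k = c j), f k) ⊔
      ⨆ e, ⨆ (_ : e ≠ c j), T.eigenspace e := by
    refine iSup₂_le fun k hk => ?_
    by_cases hc : c k = c j
    · exact le_sup_of_le_left (le_iSup₂_of_le k ⟨hk, hc⟩ le_rfl)
    · exact le_sup_of_le_right (le_iSup₂_of_le (c k) hc (h k))
  obtain ⟨y, hy, z, hz, rfl⟩ := Submodule.mem_sup.1 (hle hx')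
  have hy' : y ∈ T.eigenspace (c j) :=
    (iSup₂_le fun k hk => hk.2 ▸ h k :
      (⨆ k, ⨆ (_ : k ≠ j ∧ c k = c j), f k) ≤ T.eigenspace (c j)) hy
  have hz' : z ∈ T.eigenspace (c j) := (Submodule.add_mem_iff_right _ hy').1 (h j hx)
  have hz0 : z = 0 := (Submodule.disjoint_def.1 (T.eigenspaces_iSupIndep (c j))) z hz' hz
  rw [hz0, add_zero] at hx ⊢
  exact Submodule.disjoint_def.1 (h' j) y hx hy

section Decomposition

open LieAlgebra.Symplectic

variable {F ι : Type*} [Field F] [CharZero F] [Fintype ι] [DecidableEq ι]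
  {M : Type*} [AddCommGroup M] [Module F M] [LieRingModule (sp ι F) M] [LieModule F (sp ι F) M]
  {a : ι → ℤ} {o₁ o₂ : ι}

/-- Modules generated by independent highest weight vectors, and the invariants, are
independent. -/
theorem iSupIndep_lieSpan (ha : IsHeight a o₁ o₂)
    (hM : IsWeightedBy (spTorus F ι) M (weightsBC ι)) {K : Type*} {x : K → M} {lam : K → ι → ℤ}
    (hlam : ∀ k, IsDom o₁ o₂ (lam k)) (hx : ∀ k, x k ∈ wtSpace (spTorus F ι) M (lam k))
    (hhw : ∀ k, IsHW F a (x k)) (hind : LinearIndependent F x) :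
    iSupIndep (Sum.elim (fun k => (LieSubmodule.lieSpan F (sp ι F) {x k}).toSubmodule)
      fun _ : Unit => (casimirEigen F ι M 0).toSubmodule) := by
  refine iSupIndep_of_le_eigenspace (casimir F ι M) _
    (Sum.elim (fun k => (casEig a (lam k) : F)) fun _ => 0) ?_ ?_
  · rintro (k | _)
    · exact (hhw k).lieSpan_le_casimirEigen ha (hx k)
    · exact le_rfl
  · have hne : ∀ k, (casEig a (lam k) : F) ≠ 0 := fun k =>
      Int.cast_ne_zero.2 ((hlam k).casEig_pos ha).ne'
    rintro (j | _)
    -- A nonzero intersection with the other modules of the same highest weight would contain `x j`.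
    -- Comparing components of top weight puts `x j` in the span of the other `x k`, against linear
    -- independence.
    · let W : LieSubmodule F (sp ι F) M := ⨆ k : K, ⨆ (_ : k ≠ j ∧ lam k = lam j),
        LieSubmodule.lieSpan F (sp ι F) {x k}
      have hW : (⨆ k, ⨆ (_ : k ≠ Sum.inl j ∧ Sum.elim (fun k => (casEig a (lam k) : F))
          (fun _ => 0) k = Sum.elim (fun k => (casEig a (lam k) : F)) (fun _ : Unit => 0)
            (Sum.inl j)), Sum.elim (fun k => (LieSubmodule.lieSpan F (sp ι F) {x k}).toSubmodule)
              (fun _ : Unit => (casimirEigen F ι M 0).toSubmodule) k) ≤ W.toSubmodule := by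
        refine iSup₂_le ?_
        rintro (k | _) ⟨h1, h2⟩
        · have h3 : lam k = lam j :=
            (hlam k).casEig_injective ha (hlam j) (Int.cast_injective (α := F) h2)
          have h4 : LieSubmodule.lieSpan F (sp ι F) {x k} ≤ W :=
            le_iSup₂_of_le k ⟨fun e => h1 (congrArg _ e), h3⟩ le_rfl
          exact h4
        · exact absurd h2.symm (hne j)
      refine Disjoint.mono_right hW ?_
      rw [Sum.elim_inl]
      refine LieSubmodule.disjoint_toSubmodule.2 ?_
      rw [disjoint_iff]
      by_contra hbot
      have hxW : x j ∈ W := ((hhw j).mem_of_ne_bot ha hM (hlam j) (hx j) hbot inf_le_left).2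
      have hle : W.toSubmodule ≤ Submodule.span F (x '' {k | k ≠ j ∧ lam k = lam j}) ⊔
          ⨆ μ ∈ (weightsBC ι).filter fun μ => hgt a μ < hgt a (lam j),
            wtSpace (spTorus F ι) M μ := by
        simp only [W, LieSubmodule.iSup_toSubmodule]
        refine iSup₂_le fun k hk => ?_
        have h1 := (hhw k).lieSpan_le ha hM (hx k)
        rw [hk.2] at h1
        refine h1.trans (sup_le_sup_right ?_ _)
        rw [Submodule.span_singleton_le_iff_mem]
        exact Submodule.subset_span ⟨k, hk, rfl⟩
      have hmem := mem_of_mem_sup_lower (by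
        rw [Submodule.span_le]
        rintro _ ⟨k, hk, rfl⟩
        have := hx k
        rw [hk.2] at this
        exact this) (hx j) (hle hxW)
      exact (hind.notMem_span_image (s := {k | k ≠ j ∧ lam k = lam j}) (by simp)) hmem
    · rw [disjoint_iff, eq_bot_iff]
      refine inf_le_right.trans (iSup₂_le ?_)
      rintro (k | _) ⟨h1, h2⟩
      · exact absurd h2 (hne k)
      · exact absurd rfl h1

theorem disjoint_casimirEigen_zero (ha : IsHeight a o₁ o₂)
    (hM : IsWeightedBy (spTorus F ι) M (weightsBC ι)) {K : Type*} {x : K → M} {lam : K → ι → ℤ}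
    (hlam : ∀ k, IsDom o₁ o₂ (lam k)) (hx : ∀ k, x k ∈ wtSpace (spTorus F ι) M (lam k))
    (hhw : ∀ k, IsHW F a (x k)) (hind : LinearIndependent F x) {m : M}
    (hm : m ∈ casimirEigen F ι M 0)
    (hm' : m ∈ ⨆ k, LieSubmodule.lieSpan F (sp ι F) {x k}) : m = 0 := by
  have h := iSupIndep_lieSpan ha hM hlam hx hhw hind (Sum.inr ())
  refine Submodule.disjoint_def.1 h m hm ?_
  rw [← LieSubmodule.mem_toSubmodule, LieSubmodule.iSup_toSubmodule] at hm'
  refine (iSup_le fun k => ?_ : (⨆ k, (LieSubmodule.lieSpan F (sp ι F) {x k}).toSubmodule) ≤ _) hm'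
  exact le_iSup₂_of_le (Sum.inl k) (by simp) le_rfl

/-- If a submodule contains all nonzero weight spaces, the quotient is trivial. -/
theorem lie_mem_of_wtSpace_le (hM : IsWeightedBy (spTorus F ι) M (weightsBC ι)) {N : LieSubmodule F (sp ι F) M}
    (hN : ∀ μ ≠ 0, ∀ m ∈ wtSpace (spTorus F ι) M μ, m ∈ N) (g : sp ι F) (m : M) : ⁅g, m⁆ ∈ N := by
  refine sp_induction (bracketComap (sp ι F) m N.toSubmodule) (fun p q => ?_) g
  refine hM.mem_of_forall (lieComap (spX F p q) N.toSubmodule) (fun μ _ y hy => ?_) m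
  change ⁅spX F p q, y⁆ ∈ N
  by_cases h0 : μ = 0
  · subst h0
    by_cases hpq : p = q
    · subst hpq
      rw [lie_spX_self hy]
      have : pr (0 : ι → ℤ) p = 0 := by cases p <;> simp
      rw [this, Int.cast_zero, zero_smul]
      exact N.zero_mem
    · exact hN _ (by rw [zero_add]; exact wt_sub_ne_zero hpq) _ (lie_spX_mem hy p q)
  · exact N.lie_mem (hN μ h0 y hy)

/-- `[g, m]` lies in the kernel of the Casimir operator, which is a submodule, and also in the sum
of the generated modules, which contains `[g, M]`. These two meet only in 0. -/
theorem casimirEigen_zero_trivial (ha : IsHeight a o₁ o₂)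
    (hM : IsWeightedBy (spTorus F ι) M (weightsBC ι)) {K : Type*} {x : K → M} {lam : K → ι → ℤ}
    (hlam : ∀ k, IsDom o₁ o₂ (lam k)) (hx : ∀ k, x k ∈ wtSpace (spTorus F ι) M (lam k))
    (hhw : ∀ k, IsHW F a (x k)) (hind : LinearIndependent F x)
    (hN : ∀ μ ≠ 0, ∀ m ∈ wtSpace (spTorus F ι) M μ,
      m ∈ ⨆ k, LieSubmodule.lieSpan F (sp ι F) {x k}) (g : sp ι F) {m : M}
    (hm : m ∈ casimirEigen F ι M 0) : ⁅g, m⁆ = 0 :=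
  disjoint_casimirEigen_zero ha hM hlam hx hhw hind ((casimirEigen F ι M 0).lie_mem hm)
    (lie_mem_of_wtSpace_le hM hN g m)

/-- The Casimir operator maps `M` into the sum `N` of the generated modules, and maps `N` onto
itself because its eigenvalues there are nonzero. So every vector differs from one of `N` by an
element of the kernel. -/
theorem iSup_lieSpan_eq_top (ha : IsHeight a o₁ o₂)
    (hM : IsWeightedBy (spTorus F ι) M (weightsBC ι)) {K : Type*} {x : K → M} {lam : K → ι → ℤ}
    (hlam : ∀ k, IsDom o₁ o₂ (lam k)) (hx : ∀ k, x k ∈ wtSpace (spTorus F ι) M (lam k))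
    (hhw : ∀ k, IsHW F a (x k))
    (hN : ∀ μ ≠ 0, ∀ m ∈ wtSpace (spTorus F ι) M μ,
      m ∈ ⨆ k, LieSubmodule.lieSpan F (sp ι F) {x k}) :
    (⨆ j, Sum.elim (fun k => (LieSubmodule.lieSpan F (sp ι F) {x k}).toSubmodule)
      (fun _ : Unit => (casimirEigen F ι M 0).toSubmodule) j) = ⊤ := by
  set N := ⨆ k, LieSubmodule.lieSpan F (sp ι F) {x k} with hNdef
  have hNs : N.toSubmodule = ⨆ k, (LieSubmodule.lieSpan F (sp ι F) {x k}).toSubmodule :=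
    LieSubmodule.iSup_toSubmodule _
  have hcas : ∀ m : M, casimir F ι M m ∈ N := by
    intro m
    rw [casimir_apply]
    exact N.toSubmodule.sum_mem fun p _ => N.toSubmodule.sum_mem fun q _ =>
      lie_mem_of_wtSpace_le hM hN _ _
  have hsurj : N.toSubmodule ≤ N.toSubmodule.map (casimir F ι M) := by
    conv_lhs => rw [hNs]
    refine iSup_le fun k y hy => ?_
    have h1 := mem_casimirEigen.1 ((hhw k).lieSpan_le_casimirEigen ha (hx k) hy)
    have hne : (casEig a (lam k) : F) ≠ 0 := Int.cast_ne_zero.2 ((hlam k).casEig_pos ha).ne'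
    refine ⟨(casEig a (lam k) : F)⁻¹ • y, N.toSubmodule.smul_mem _ ?_, ?_⟩
    · rw [hNs]
      exact Submodule.mem_iSup_of_mem k hy
    · rw [map_smul, h1, smul_smul, inv_mul_cancel₀ hne, one_smul]
  rw [iSup_sum, eq_top_iff]
  intro m _
  obtain ⟨n, hn, hmn⟩ := hsurj (hcas m)
  have h2 : m - n ∈ casimirEigen F ι M 0 := by
    rw [mem_casimirEigen, map_sub, hmn, sub_self, zero_smul]
  rw [← sub_add_cancel m n]
  refine Submodule.add_mem _ (Submodule.mem_sup_right ?_) (Submodule.mem_sup_left ?_)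
  · exact Submodule.mem_iSup_of_mem () h2
  · rw [SetLike.mem_coe, hNs] at hn
    exact hn

/-- A submodule containing the nonzero weight spaces supported on a large set of indices contains
all nonzero weight spaces. -/
theorem wtSpace_le_of_support (hM : IsWeightedBy (spTorus F ι) M (weightsBC ι)) (I₀ : Finset ι)
    (hI₀ : 2 < I₀.card) (N : LieSubmodule F (sp ι F) M)
    (hN : ∀ μ ≠ 0, (∀ i ∉ I₀, μ i = 0) → ∀ m ∈ wtSpace (spTorus F ι) M μ, m ∈ N)
    (μ : ι → ℤ) (hμ : μ ≠ 0) (m : M) (hm : m ∈ wtSpace (spTorus F ι) M μ) : m ∈ N := by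
  obtain ⟨n, hn⟩ : ∃ n : ℕ, ∑ i ∈ I₀ᶜ, (μ i).natAbs = n := ⟨_, rfl⟩
  induction n using Nat.strong_induction_on generalizing μ m with
  | _ n ih =>
  by_cases hsupp : ∀ i ∉ I₀, μ i = 0
  · exact hN μ hμ hsupp m hm
  push Not at hsupp
  obtain ⟨i, hi, hμi⟩ := hsupp
  by_cases hm0 : m = 0
  · rw [hm0]; exact N.zero_mem
  have hl : lOne μ ≤ 2 := mem_weightsBC.1 (hM.mem_of_ne_zero hm hm0)
  -- A weight of norm at most 2 cannot be nonzero at all of more than two indices.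
  obtain ⟨r, hr, hμr⟩ : ∃ r ∈ I₀, μ r = 0 := by
    by_contra! hne
    have h1 : ∑ r ∈ I₀, (1 : ℤ) ≤ ∑ r ∈ I₀, |μ r| :=
      Finset.sum_le_sum fun r hr => Int.one_le_abs (hne r hr)
    have h2 : ∑ r ∈ I₀, |μ r| ≤ lOne μ :=
      Finset.sum_le_sum_of_subset_of_nonneg (Finset.subset_univ _) fun _ _ _ => abs_nonneg _
    rw [Finset.sum_const, nsmul_eq_mul, mul_one] at h1
    have : (2 : ℤ) < I₀.card := by exact_mod_cast hI₀
    omega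
  have hir : i ≠ r := by rintro rfl; exact hi hr
  -- The sign of `p` is chosen so that `spX F (Sum.inl r) p` moves one unit of `|μ i|` from `i` to
  -- the index `r` of `I₀`. This lowers the total weight outside `I₀`, on which the induction runs,
  -- and the opposite root vector brings the result back to a nonzero multiple of `m`.
  obtain ⟨p, hp, hwi, hwj⟩ : ∃ p : ι ⊕ ι, (p = Sum.inl i ∨ p = Sum.inr i) ∧ 0 < wt p i * μ i ∧
      |wt p i| = 1 := by
    rcases lt_or_gt_of_ne hμi with h | h
    · exact ⟨Sum.inr i, Or.inr rfl, by simp [wt]; omega, by simp [wt]⟩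
    · exact ⟨Sum.inl i, Or.inl rfl, by simp [wt]; omega, by simp [wt]⟩
  have hwne : ∀ j, j ≠ i → wt p j = 0 := by
    intro j hj
    rcases hp with rfl | rfl <;> simp [wt, hj]
  have hpr : 0 < pr μ p := by
    rcases hp with rfl | rfl <;> simp [wt] at hwi ⊢ <;> omega
  have hpq : p ≠ Sum.inl r := by
    rcases hp with rfl | rfl <;> simp [hir]
  have hκ : spκ p (Sum.inl r) = 1 := by
    rw [spκ, if_neg]
    rcases hp with rfl | rfl <;> simp [hir.symm]
  have hwr : ∀ j, wt (Sum.inl r : ι ⊕ ι) j = if j = r then 1 else 0 := fun j => by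
    simp [wt, Pi.single_apply]
  have hwpi : (wt p i = 1 ∧ 0 < μ i) ∨ (wt p i = -1 ∧ μ i < 0) := by
    rcases (abs_eq (zero_le_one' ℤ)).1 hwj with h | h
    · left; rw [h] at hwi; exact ⟨h, by omega⟩
    · right; rw [h] at hwi; exact ⟨h, by omega⟩
  -- The resulting weight would have absolute value at least 2 at `i` and 1 at `r`.
  have h0 : ⁅spX F p (Sum.inl r), m⁆ = 0 := by
    by_contra hne
    have h1 := mem_weightsBC.1 (hM.mem_of_ne_zero (lie_spX_mem hm p (Sum.inl r)) hne)
    have h2 := abs_add_abs_le_lOne (μ + (wt p - wt (Sum.inl r))) hir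
    simp only [Pi.add_apply, Pi.sub_apply, hwr, if_neg hir, if_pos, hwne r hir.symm, hμr] at h2
    have h3 : (2 : ℤ) ≤ |μ i + (wt p i - 0)| := by
      rcases hwpi with ⟨h, h'⟩ | ⟨h, h'⟩
      · rw [h]; exact le_abs.2 (Or.inl (by omega))
      · rw [h]; exact le_abs.2 (Or.inr (by omega))
    norm_num at h2
    rw [sub_zero] at h3
    omega
  have h1 := lie_spX_lie_spX hm hpq h0
  rw [hκ, pr_inl, hμr, one_mul, sub_zero] at h1
  have h2 : ⁅spX F (Sum.inl r) p, m⁆ ∈ N := by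
    refine ih _ ?_ _ ?_ _ (lie_spX_mem hm (Sum.inl r) p) rfl
    · rw [← hn]
      refine Finset.sum_lt_sum (fun j hj => ?_) ⟨i, by simpa using hi, ?_⟩
      · have hjr : j ≠ r := by rintro rfl; simp [hr] at hj
        rw [Pi.add_apply, Pi.sub_apply, hwr, if_neg hjr]
        by_cases hji : j = i
        · subst hji
          omega
        · rw [hwne j hji]; simp
      · rw [Pi.add_apply, Pi.sub_apply, hwr, if_neg hir]
        omega
    · intro h
      have := congrFun h r
      rw [Pi.add_apply, Pi.sub_apply, hwr, if_pos rfl, hwne r hir.symm, hμr] at this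
      simp at this
  have h3 : ((pr μ p : ℤ) : F) • m ∈ N := by
    rw [← h1]
    exact N.lie_mem h2
  exact (N.toSubmodule.smul_mem_iff (Int.cast_ne_zero.2 hpr.ne')).1 h3

end Decomposition

/-! ### Embeddings of symplectic Lie algebras -/

section Embedding

open LieAlgebra.Symplectic

variable {F ι κ : Type*} [Field F] [Fintype ι] [DecidableEq ι] [Fintype κ] [DecidableEq κ]

/-- The matrix of the inclusion of coordinate spaces. -/
def inclMat (F : Type*) [Field F] {ι κ : Type*} [DecidableEq ι] (j : κ → ι) :
    Matrix (ι ⊕ ι) (κ ⊕ κ) F := Matrix.of fun r p => if r = Sum.map j j p then 1 else 0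

theorem inclMat_apply (j : κ → ι) (r : ι ⊕ ι) (p : κ ⊕ κ) :
    inclMat F j r p = if r = Sum.map j j p then 1 else 0 := rfl

theorem sumMap_injective {j : κ → ι} (hj : Function.Injective j) :
    Function.Injective (Sum.map j j) := hj.sumMap hj

theorem transpose_mul_inclMat {j : κ → ι} (hj : Function.Injective j) :
    (inclMat F j).transpose * inclMat F j = 1 := by
  ext p q
  rw [Matrix.mul_apply, Finset.sum_eq_single (Sum.map j j p), Matrix.transpose_apply,
    inclMat_apply, inclMat_apply, if_pos rfl, one_mul, Matrix.one_apply]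
  · simp only [(sumMap_injective hj).eq_iff]
  · intro r _ hr
    rw [Matrix.transpose_apply, inclMat_apply, if_neg hr, zero_mul]
  · simp

/-- Extension of matrices by zero. -/
def embMat (j : κ → ι) : Matrix (κ ⊕ κ) (κ ⊕ κ) F →ₗ[F] Matrix (ι ⊕ ι) (ι ⊕ ι) F where
  toFun A := inclMat F j * A * (inclMat F j).transpose
  map_add' A B := by rw [Matrix.mul_add, Matrix.add_mul]
  map_smul' c A := by rw [Matrix.mul_smul, Matrix.smul_mul, RingHom.id_apply]

theorem embMat_apply (j : κ → ι) (A : Matrix (κ ⊕ κ) (κ ⊕ κ) F) :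
    embMat j A = inclMat F j * A * (inclMat F j).transpose := rfl

theorem embMat_mul {j : κ → ι} (hj : Function.Injective j) (A B : Matrix (κ ⊕ κ) (κ ⊕ κ) F) :
    embMat j (A * B) = embMat j A * embMat j B := by
  have : inclMat F j * A * (inclMat F j).transpose *
      (inclMat F j * B * (inclMat F j).transpose) =
      inclMat F j * A * ((inclMat F j).transpose * inclMat F j) * B *
        (inclMat F j).transpose := by
    simp only [Matrix.mul_assoc]
  rw [embMat_apply, embMat_apply, embMat_apply, this, transpose_mul_inclMat hj, Matrix.mul_one]
  simp only [Matrix.mul_assoc]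

theorem embMat_single (j : κ → ι) (p q : κ ⊕ κ) : embMat j (Matrix.single p q (1 : F)) =
    Matrix.single (Sum.map j j p) (Sum.map j j q) 1 := by
  ext r s
  rw [embMat_apply, Matrix.mul_apply, Finset.sum_eq_single q]
  · rw [Matrix.mul_single_apply_same, Matrix.transpose_apply, inclMat_apply, inclMat_apply,
      Matrix.single_apply, mul_one]
    by_cases h1 : r = Sum.map j j p <;> by_cases h2 : s = Sum.map j j q <;>
      simp [h1, h2, eq_comm]
  · intro t _ ht
    rw [Matrix.mul_single_apply_of_ne _ _ _ _ _ ht, zero_mul]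
  · simp

theorem linearMap_ext_single {N : Type*} [AddCommGroup N] [Module F N]
    {f g : Matrix (κ ⊕ κ) (κ ⊕ κ) F →ₗ[F] N}
    (h : ∀ p q, f (Matrix.single p q 1) = g (Matrix.single p q 1)) : f = g := by
  ext A : 1
  rw [Matrix.matrix_eq_sum_single A, map_sum, map_sum]
  refine Finset.sum_congr rfl fun p _ => ?_
  rw [map_sum, map_sum]
  refine Finset.sum_congr rfl fun q _ => ?_
  have : Matrix.single p q (A p q) = A p q • Matrix.single p q (1 : F) := by
    rw [Matrix.smul_single, smul_eq_mul, mul_one]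
  rw [this, map_smul, map_smul, h]

theorem swap_sumMap (j : κ → ι) (p : κ ⊕ κ) : (Sum.map j j p).swap = Sum.map j j p.swap := by
  cases p <;> rfl

theorem sgn_sumMap (j : κ → ι) (p : κ ⊕ κ) : sgn F (Sum.map j j p) = sgn F p := by
  cases p <;> rfl

theorem spAdj_embMat (j : κ → ι) (A : Matrix (κ ⊕ κ) (κ ⊕ κ) F) :
    spAdj (embMat j A) = embMat j (spAdj A) := by
  have : spAdj ∘ₗ embMat j = embMat j ∘ₗ (spAdj (F := F)) := by
    refine linearMap_ext_single fun p q => ?_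
    rw [LinearMap.comp_apply, LinearMap.comp_apply, embMat_single, spAdj_single, spAdj_single,
      map_smul, embMat_single, swap_sumMap, swap_sumMap, sgn_sumMap, sgn_sumMap]
  exact LinearMap.congr_fun this A

/-- The embedding of symplectic Lie algebras. -/
def spEmb (F : Type*) [Field F] {ι κ : Type*} [Fintype ι] [DecidableEq ι] [Fintype κ]
    [DecidableEq κ] (j : κ → ι) (hj : Function.Injective j) : sp κ F →ₗ⁅F⁆ sp ι F where
  toFun A := ⟨embMat j (A : Matrix (κ ⊕ κ) (κ ⊕ κ) F), by
    rw [mem_sp_iff, spAdj_embMat, mem_sp_iff.1 A.2, map_neg]⟩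
  map_add' A B := Subtype.ext (map_add (embMat j) _ _)
  map_smul' c A := Subtype.ext (map_smul (embMat j) _ _)
  map_lie' := fun {A B} => Subtype.ext (by
    change embMat j ((A : Matrix (κ ⊕ κ) (κ ⊕ κ) F) * (B : Matrix (κ ⊕ κ) (κ ⊕ κ) F) -
      (B : Matrix (κ ⊕ κ) (κ ⊕ κ) F) * (A : Matrix (κ ⊕ κ) (κ ⊕ κ) F)) =
      embMat j (A : Matrix (κ ⊕ κ) (κ ⊕ κ) F) * embMat j (B : Matrix (κ ⊕ κ) (κ ⊕ κ) F) -
      embMat j (B : Matrix (κ ⊕ κ) (κ ⊕ κ) F) * embMat j (A : Matrix (κ ⊕ κ) (κ ⊕ κ) F)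
    rw [map_sub, embMat_mul hj, embMat_mul hj])

theorem spEmb_spX (j : κ → ι) (hj : Function.Injective j) (p q : κ ⊕ κ) :
    spEmb F j hj (spX F p q) = spX F (Sum.map j j p) (Sum.map j j q) := by
  apply Subtype.ext
  change embMat j (spX F p q : Matrix (κ ⊕ κ) (κ ⊕ κ) F) = _
  rw [spX, spX, coe_spProj, coe_spProj, map_sub, ← spAdj_embMat, embMat_single]

theorem spTorus_eq_sum (c : ι → F) :
    spTorus F ι c = ∑ i, c i • spX F (Sum.inl i) (Sum.inl i) := by
  simp only [spX_self]
  simp only [← map_smul, ← map_sum]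
  congr 1
  funext k
  rw [Finset.sum_apply, Finset.sum_eq_single k]
  · simp [wtF, wt]
  · intro i _ hi
    simp [wtF, wt, hi.symm]
  · simp

variable [CharZero F] {M : Type*} [AddCommGroup M] [Module F M] [LieRingModule (sp ι F) M]
  [LieModule F (sp ι F) M] [LieRingModule (sp κ F) M] [LieModule F (sp κ F) M]
  {j : κ → ι} {hj : Function.Injective j}

theorem mem_wtSpace_comp (hc : ∀ (A : sp κ F) (m : M), ⁅A, m⁆ = ⁅spEmb F j hj A, m⁆)
    {μ : ι → ℤ} {m : M} (hm : m ∈ wtSpace (spTorus F ι) M μ) :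
    m ∈ wtSpace (spTorus F κ) M (μ ∘ j) := by
  intro c
  rw [spTorus_eq_sum, sum_lie, wtEval, Finset.sum_smul]
  refine Finset.sum_congr rfl fun i _ => ?_
  rw [smul_lie, hc, spEmb_spX, lie_spX_self hm, smul_smul, mul_comm]
  rfl

/-- The smaller torus determines the coordinates in the range of `j`; for the others it has to be
known that their torus elements kill `m`. -/
theorem mem_wtSpace_of_comp (hc : ∀ (A : sp κ F) (m : M), ⁅A, m⁆ = ⁅spEmb F j hj A, m⁆)
    {μ : ι → ℤ} {m : M} (hm : m ∈ wtSpace (spTorus F κ) M (μ ∘ j))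
    (h0 : ∀ i, i ∉ Set.range j → ⁅spX F (Sum.inl i) (Sum.inl i), m⁆ = 0)
    (hμ : ∀ i, i ∉ Set.range j → μ i = 0) : m ∈ wtSpace (spTorus F ι) M μ := by
  intro c
  rw [spTorus_eq_sum, sum_lie, wtEval, Finset.sum_smul]
  refine Finset.sum_congr rfl fun i _ => ?_
  rw [smul_lie, mul_comm, ← smul_smul]
  congr 1
  by_cases hi : i ∈ Set.range j
  · obtain ⟨k, rfl⟩ := hi
    have := lie_spX_self hm (Sum.inl k)
    rw [hc, spEmb_spX] at this
    exact this
  · rw [h0 i hi, hμ i hi, Int.cast_zero, zero_smul]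

theorem lOne_comp_le (hj : Function.Injective j) (μ : ι → ℤ) : lOne (μ ∘ j) ≤ lOne μ := by
  simp only [lOne, Function.comp_apply]
  rw [← Finset.sum_image (s := Finset.univ) (g := j) (f := fun i => |μ i|)
    (fun x _ y _ h => hj h)]
  exact Finset.sum_le_sum_of_subset_of_nonneg (Finset.subset_univ _) fun _ _ _ => abs_nonneg _

theorem isWeightedBy_comp (hc : ∀ (A : sp κ F) (m : M), ⁅A, m⁆ = ⁅spEmb F j hj A, m⁆)
    (hM : IsWeightedBy (spTorus F ι) M (weightsBC ι)) :
    IsWeightedBy (spTorus F κ) M (weightsBC κ) := fun m =>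
  hM.mem_of_forall _ (fun μ hμ _ hx => mem_iSup_wtSpace (μ := μ ∘ j)
    (mem_weightsBC.2 ((lOne_comp_le hj μ).trans (mem_weightsBC.1 hμ)))
    (mem_wtSpace_comp hc hx)) m

theorem IsHeight.comp {a : ι → ℤ} {o₁ o₂ : κ} (ha : IsHeight a (j o₁) (j o₂))
    (hj : Function.Injective j) : IsHeight (a ∘ j) o₁ o₂ where
  pos i := ha.pos (j i)
  inj := ha.inj.comp hj
  ne h := ha.ne (congrArg j h)
  lt₁ _ hi := ha.lt₁ _ fun h => hi (hj h)
  lt₂ _ hi hi' := ha.lt₂ _ (fun h => hi (hj h)) fun h => hi' (hj h)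

theorem lOne_single_add {i : ι} {t : ℤ} {α : ι → ℤ} (ht : 0 ≤ t) (hα : 0 ≤ α i) :
    lOne (Pi.single i t + α) = t + lOne α := by
  have h : Function.update (Pi.single i t + α) i 0 = Function.update α i 0 := by
    ext k
    by_cases hk : k = i
    · subst hk; simp
    · simp [hk]
  rw [lOne_eq_abs_add _ i, lOne_eq_abs_add α i, h, Pi.add_apply, Pi.single_eq_same,
    abs_of_nonneg (add_nonneg ht hα), abs_of_nonneg hα, add_assoc]

/-- The positive roots that can be added to a dominant weight. -/
theorem IsDom.root_cases {a : ι → ℤ} {o₁ o₂ : ι} (ha : IsHeight a o₁ o₂) {μ : ι → ℤ}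
    (hμ : IsDom o₁ o₂ μ) {p q : ι ⊕ ι} (hpq : ht a q < ht a p)
    (hl : lOne (μ + (wt p - wt q)) ≤ 2) :
    (p = Sum.inl o₁ ∧ q = Sum.inl o₂) ∨ (p = Sum.inr o₂ ∧ q = Sum.inr o₁) := by
  have hne : p ≠ q := by rintro rfl; exact lt_irrefl _ hpq
  have hα : lOne (wt p - wt q) = 2 := (mem_weightsC.1 (wt_sub_wt_mem_weightsC p q)).resolve_left
    fun h => wt_sub_ne_zero hne (eq_zero_of_lOne h)
  have hentry : ∀ (r : ι ⊕ ι) (i : ι), (r ≠ Sum.inr i → 0 ≤ wt r i) ∧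
      (r ≠ Sum.inl i → wt r i ≤ 0) := by
    rintro (k | k) i <;> by_cases hk : i = k <;> simp [wt, hk]
  have hq1 : q ≠ Sum.inl o₁ := by
    rintro rfl
    have := ha.ht_lt hne
    simp only [ht_inl] at hpq
    omega
  have hp1 : p ≠ Sum.inr o₁ := by
    rintro rfl
    have : q.swap ≠ Sum.inl o₁ := by
      intro e
      exact hne (by rw [← Sum.swap_swap q, e]; rfl)
    have := ha.ht_lt this
    rw [ht_swap] at this
    simp only [ht_inr] at hpq
    omega
  -- A positive root is nonnegative at `o₁`. Adding it to a weight positive there adds the norms, so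
  -- 2 is exceeded unless the root is negative at `o₂` and the weight is `ε₁ + ε₂`; this leaves `ε₁
  -- - ε₂`, in its two presentations.
  have h1 : 0 ≤ (wt p - wt q) o₁ := by
    have := (hentry p o₁).1 hp1
    have := (hentry q o₁).2 hq1
    rw [Pi.sub_apply]
    omega
  rcases hμ with rfl | rfl | rfl
  · rw [lOne_single_add (by norm_num) h1] at hl
    omega
  · by_cases hq2 : q = Sum.inl o₂
    · left
      refine ⟨?_, hq2⟩
      by_contra hp
      have := ha.ht_lt₂ hp (by rw [← hq2]; exact hne)
      rw [hq2] at hpq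
      simp only [ht_inl] at hpq
      omega
    by_cases hp2 : p = Sum.inr o₂
    · right
      refine ⟨hp2, ?_⟩
      by_contra hq
      have h3 : q.swap ≠ Sum.inl o₁ := by
        intro e
        exact hq (by rw [← Sum.swap_swap q, e]; rfl)
      have h4 : q.swap ≠ Sum.inl o₂ := by
        intro e
        exact hne (by rw [← Sum.swap_swap q, e, hp2]; rfl)
      have := ha.ht_lt₂ h3 h4
      rw [ht_swap] at this
      rw [hp2] at hpq
      simp only [ht_inr] at hpq
      omega
    · exfalso
      have h2 : 0 ≤ (wt p - wt q) o₂ := by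
        have := (hentry p o₂).1 hp2
        have := (hentry q o₂).2 hq2
        rw [Pi.sub_apply]
        omega
      rw [add_assoc, lOne_single_add (by norm_num), lOne_single_add (by norm_num) h2] at hl
      · omega
      · rw [Pi.add_apply, Pi.single_eq_of_ne ha.ne, zero_add]
        exact h1
  · rw [lOne_single_add (by norm_num) h1] at hl
    omega

/-- By `IsDom.root_cases` every positive root of the large system except `ε₁ - ε₂` leads out of the
weights of type BC. The exception belongs to the small system, whose positive root vectors kill `m`
by assumption. -/
theorem IsHW.of_comp (hc : ∀ (A : sp κ F) (m : M), ⁅A, m⁆ = ⁅spEmb F j hj A, m⁆)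
    (hM : IsWeightedBy (spTorus F ι) M (weightsBC ι)) {a : ι → ℤ} {o₁ o₂ : κ}
    (ha : IsHeight a (j o₁) (j o₂)) {μ : ι → ℤ} (hμ : IsDom (j o₁) (j o₂) μ) {m : M}
    (hm : m ∈ wtSpace (spTorus F ι) M μ) (h : IsHW F (a ∘ j) m) : IsHW F a m := by
  intro p q hpq
  by_contra hne
  have hl := mem_weightsBC.1 (hM.mem_of_ne_zero (lie_spX_mem hm p q) hne)
  have hlt := ha.lt₁ _ ha.ne.symm
  rcases hμ.root_cases ha hpq hl with ⟨rfl, rfl⟩ | ⟨rfl, rfl⟩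
  · have := h (Sum.inl o₁) (Sum.inl o₂) hlt
    rw [hc, spEmb_spX] at this
    exact hne this
  · have := h (Sum.inr o₂) (Sum.inr o₁) (neg_lt_neg hlt)
    rw [hc, spEmb_spX] at this
    exact hne this

theorem single_comp (hj : Function.Injective j) (o : κ) (t : ℤ) :
    (Pi.single (j o) t : ι → ℤ) ∘ j = Pi.single o t := by
  ext k
  simp only [Function.comp_apply, Pi.single_apply, hj.eq_iff]

theorem IsDom.eq_zero_of_notMem {o₁ o₂ : κ} {μ : ι → ℤ} (h : IsDom (j o₁) (j o₂) μ) {i : ι}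
    (hi : i ∉ Set.range j) : μ i = 0 := by
  have h0 : ∀ (o : κ) (t : ℤ), (Pi.single (j o) t : ι → ℤ) i = 0 :=
    fun o t => by rw [Pi.single_eq_of_ne (fun e => hi ⟨o, e.symm⟩)]
  rcases h with rfl | rfl | rfl
  · exact h0 o₁ 2
  · rw [Pi.add_apply, h0 o₁ 1, h0 o₂ 1, add_zero]
  · exact h0 o₁ 1

end Embedding

/-! ### Recognising the highest weight of an irreducible submodule by its dimension. -/

section Recognition

open LieAlgebra.Symplectic

variable {F ι : Type*} [Field F] [CharZero F] [Fintype ι] [DecidableEq ι]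
  {M : Type*} [AddCommGroup M] [Module F M] [LieRingModule (sp ι F) M] [LieModule F (sp ι F) M]
  {a : ι → ℤ} {o₁ o₂ : ι}

/-- A minimal submodule of dimension at least two is generated by a highest weight vector. -/
theorem exists_isHW_lieSpan_eq (ha : IsHeight a o₁ o₂)
    (hM : IsWeightedBy (spTorus F ι) M (weightsBC ι)) {N : LieSubmodule F (sp ι F) M}
    (hN : ∀ N' ≤ N, N' = ⊥ ∨ N' = N) (hbot : N ≠ ⊥) (hdim : Module.finrank F N ≠ 1) :
    ∃ lam, IsDom o₁ o₂ lam ∧ ∃ x ∈ wtSpace (spTorus F ι) M lam, x ≠ 0 ∧ IsHW F a x ∧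
      LieSubmodule.lieSpan F (sp ι F) {x} = N := by
  obtain ⟨lam, x, hxN, hx0, hx, hhw⟩ := hM.exists_isHW a N hbot
  rcases hhw.isDom ha hM hx hx0 with rfl | hlam
  · exfalso
    let N' : LieSubmodule F (sp ι F) M :=
      { Submodule.span F {x} with
        lie_mem := by
          intro g m hm
          obtain ⟨c, rfl⟩ := Submodule.mem_span_singleton.1 hm
          rw [lie_smul, hhw.lie_eq_zero ha hM hx, smul_zero]
          exact Submodule.zero_mem _ }
    have hxN' : x ∈ N' := Submodule.mem_span_singleton_self x
    rcases hN N' ((Submodule.span_singleton_le_iff_mem x N.toSubmodule).2 hxN) with h | h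
    · rw [h] at hxN'
      exact hx0 hxN'
    · apply hdim
      rw [← h]
      exact finrank_span_singleton hx0
  · have hle : LieSubmodule.lieSpan F (sp ι F) {x} ≤ N := by
      rwa [LieSubmodule.lieSpan_le, Set.singleton_subset_iff]
    refine ⟨lam, hlam, x, hx, hx0, hhw, (hN _ hle).resolve_left fun h => hx0 ?_⟩
    have : x ∈ LieSubmodule.lieSpan F (sp ι F) {x} := LieSubmodule.subset_lieSpan rfl
    rw [h] at this
    exact this

theorem finrank_lieSpan {M' : Type*} [AddCommGroup M'] [Module F M'] [LieRingModule (sp ι F) M']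
    [LieModule F (sp ι F) M'] (ha : IsHeight a o₁ o₂) {lam : ι → ℤ} (hlam : IsDom o₁ o₂ lam)
    (hM' : IsHWModule F M' a lam) (hM : IsWeightedBy (spTorus F ι) M (weightsBC ι)) {x : M}
    (hx : x ∈ wtSpace (spTorus F ι) M lam) (hx0 : x ≠ 0) (h : IsHW F a x) :
    Module.finrank F (LieSubmodule.lieSpan F (sp ι F) {x}) = Module.finrank F M' := by
  obtain ⟨e⟩ := hM'.nonempty_equiv ha hlam hM hx hx0 h
  exact (e : _ ≃ₗ[F] M').finrank_eq

/-- The highest weight of a minimal submodule is determined by its dimension. -/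
theorem exists_isHW_of_finrank (hcard : 3 < Fintype.card ι) (ha : IsHeight a o₁ o₂)
    (hM : IsWeightedBy (spTorus F ι) M (weightsBC ι)) {N : LieSubmodule F (sp ι F) M}
    (hN : ∀ N' ≤ N, N' = ⊥ ∨ N' = N) (hbot : N ≠ ⊥) :
    (Module.finrank F N = Module.finrank F (sp ι F) →
      ∃ x ∈ wtSpace (spTorus F ι) M (Pi.single o₁ 2), x ≠ 0 ∧ IsHW F a x ∧
        LieSubmodule.lieSpan F (sp ι F) {x} = N) ∧
    (Module.finrank F N = Module.finrank F (spS ι F) →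
      ∃ x ∈ wtSpace (spTorus F ι) M (Pi.single o₁ 1 + Pi.single o₂ 1), x ≠ 0 ∧ IsHW F a x ∧
        LieSubmodule.lieSpan F (sp ι F) {x} = N) ∧
    (Module.finrank F N = Module.finrank F (spV ι F) →
      ∃ x ∈ wtSpace (spTorus F ι) M (Pi.single o₁ 1), x ≠ 0 ∧ IsHW F a x ∧
        LieSubmodule.lieSpan F (sp ι F) {x} = N) := by
  have : Nonempty ι := ⟨o₁⟩
  -- With `n` indices, equal dimensions for `sp` and `spS` are impossible, as `2 * dim + 1 = 4n²`
  -- fails modulo 2. The dimension `2n` of the natural module is smaller than both `n²` and `n² -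
  -- 1`, since `4n ≤ n²`.
  have h1 := finrank_sp_add (F := F) (ι := ι)
  have h2 := card_sq_le_finrank_sp (F := F) (ι := ι)
  have h3 := card_sq_le_finrank_spS (F := F) (ι := ι)
  have h4 := finrank_spV (F := F) (ι := ι)
  have h5 : 4 * Fintype.card ι ≤ Fintype.card ι * Fintype.card ι := Nat.mul_le_mul_right _ hcard
  have key : Module.finrank F N ≠ 1 → ∃ lam, IsDom o₁ o₂ lam ∧
      ∃ x ∈ wtSpace (spTorus F ι) M lam, x ≠ 0 ∧ IsHW F a x ∧
        LieSubmodule.lieSpan F (sp ι F) {x} = N := exists_isHW_lieSpan_eq ha hM hN hbot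
  have e1 : ∀ x ∈ wtSpace (spTorus F ι) M (Pi.single o₁ 2), x ≠ 0 → IsHW F a x →
      LieSubmodule.lieSpan F (sp ι F) {x} = N → Module.finrank F N = Module.finrank F (sp ι F) := by
    rintro x hx hx0 h rfl
    exact finrank_lieSpan ha (Or.inl rfl) (isHWModule_sp ha) hM hx hx0 h
  have e2 : ∀ x ∈ wtSpace (spTorus F ι) M (Pi.single o₁ 1 + Pi.single o₂ 1), x ≠ 0 → IsHW F a x →
      LieSubmodule.lieSpan F (sp ι F) {x} = N →
        Module.finrank F N = Module.finrank F (spS ι F) := by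
    rintro x hx hx0 h rfl
    exact finrank_lieSpan ha (Or.inr (Or.inl rfl)) (isHWModule_spS ha) hM hx hx0 h
  have e3 : ∀ x ∈ wtSpace (spTorus F ι) M (Pi.single o₁ 1), x ≠ 0 → IsHW F a x →
      LieSubmodule.lieSpan F (sp ι F) {x} = N →
        Module.finrank F N = Module.finrank F (spV ι F) := by
    rintro x hx hx0 h rfl
    exact finrank_lieSpan ha (Or.inr (Or.inr rfl)) (isHWModule_spV ha) hM hx hx0 h
  refine ⟨fun hd => ?_, fun hd => ?_, fun hd => ?_⟩ <;>
    obtain ⟨lam, rfl | rfl | rfl, x, hx, hx0, h, hs⟩ := key (by omega)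
  · exact ⟨x, hx, hx0, h, hs⟩
  · have := e2 x hx hx0 h hs
    omega
  · have := e3 x hx hx0 h hs
    omega
  · have := e1 x hx hx0 h hs
    omega
  · exact ⟨x, hx, hx0, h, hs⟩
  · have := e3 x hx hx0 h hs
    omega
  · have := e1 x hx hx0 h hs
    omega
  · have := e2 x hx hx0 h hs
    omega
  · exact ⟨x, hx, hx0, h, hs⟩

end Recognition

/-! ### Root graded Lie algebras of type `BC` -/

section RootSystem

variable {I : Type*} [Fintype I] [DecidableEq I]

/-- The integral combinations of the vectors `ε i`. -/
def wtComb {U : Type*} [AddCommGroup U] (ε : I → U) (μ : I → ℤ) : U := ∑ i, μ i • ε i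

theorem wtComb_add {U : Type*} [AddCommGroup U] (ε : I → U) (μ ν : I → ℤ) :
    wtComb ε (μ + ν) = wtComb ε μ + wtComb ε ν := by
  simp [wtComb, add_smul, Finset.sum_add_distrib]

theorem wtComb_neg {U : Type*} [AddCommGroup U] (ε : I → U) (μ : I → ℤ) :
    wtComb ε (-μ) = -wtComb ε μ := by
  simp [wtComb]

theorem wtComb_single {U : Type*} [AddCommGroup U] (ε : I → U) (i : I) (t : ℤ) :
    wtComb ε (Pi.single i t) = t • ε i := by
  rw [wtComb, Finset.sum_eq_single i]
  · rw [Pi.single_eq_same]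
  · intro k _ hk
    rw [Pi.single_eq_of_ne hk, zero_smul]
  · simp

theorem wtComb_zero {U : Type*} [AddCommGroup U] (ε : I → U) : wtComb ε 0 = 0 := by
  simp [wtComb]

/-- This translates the root system into integer vectors. `Nonempty I` is needed for the root 0,
which is written as `ε i - ε i`. -/
theorem mem_rootsBC_iff [Nonempty I] {U : Type*} [AddCommGroup U] (ε : I → U) {α : U} :
    α ∈ rootsBC ε ↔ ∃ μ, lOne μ ≤ 2 ∧ α = wtComb ε μ := by
  constructor
  · have two : ∀ (i j : I) (t u : ℤ), |t| = 1 → |u| = 1 →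
        ∃ μ, lOne μ ≤ 2 ∧ t • ε i + u • ε j = wtComb ε μ := fun i j t u ht hu =>
      ⟨Pi.single i t + Pi.single j u, by
        have := lOne_add_le (Pi.single i t) (Pi.single j u : I → ℤ)
        rw [lOne_single, lOne_single, ht, hu] at this
        exact this, by rw [wtComb_add, wtComb_single, wtComb_single]⟩
    have one : ∀ (i : I) (t : ℤ), |t| ≤ 2 → ∃ μ, lOne μ ≤ 2 ∧ t • ε i = wtComb ε μ :=
      fun i t ht => ⟨Pi.single i t, by rwa [lOne_single], by rw [wtComb_single]⟩
    have hD : α ∈ rootsD ε → ∃ μ, lOne μ ≤ 2 ∧ α = wtComb ε μ := by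
      rintro (⟨i, j, rfl⟩ | ⟨i, j, -, rfl | rfl⟩)
      · have := two i j 1 (-1) (by simp) (by simp)
        rwa [one_smul, neg_one_smul, ← sub_eq_add_neg] at this
      · have := two i j 1 1 (by simp) (by simp)
        rwa [one_smul, one_smul] at this
      · have := two i j (-1) (-1) (by simp) (by simp)
        rwa [neg_one_smul, neg_one_smul, ← neg_add] at this
    rintro ((h | ⟨i, rfl | rfl⟩) | (h | ⟨i, rfl | rfl⟩))
    · exact hD h
    · have := one i 1 (by simp)
      rwa [one_smul] at this
    · have := one i (-1) (by simp)
      rwa [neg_one_smul] at this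
    · exact hD h
    · have := one i 2 (by simp)
      rwa [two_zsmul, ← two_nsmul] at this
    · have := one i (-2) (by simp)
      rwa [neg_smul, two_zsmul, ← two_nsmul] at this
  · rintro ⟨μ, hμ, rfl⟩
    have h0 := lOne_nonneg μ
    rcases (show lOne μ = 0 ∨ lOne μ = 1 ∨ lOne μ = 2 by omega) with h | h | h
    · obtain ⟨i⟩ := ‹Nonempty I›
      rw [eq_zero_of_lOne h, wtComb_zero]
      exact Or.inl (Or.inl (Or.inl ⟨i, i, (sub_self _).symm⟩))
    · obtain ⟨i, t, rfl | rfl, rfl⟩ := exists_single_of_lOne_one h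
      · rw [wtComb_single, one_smul]
        exact Or.inl (Or.inr ⟨i, Or.inl rfl⟩)
      · rw [wtComb_single, neg_one_smul]
        exact Or.inl (Or.inr ⟨i, Or.inr rfl⟩)
    · rcases weightsC_cases h with ⟨i, t, rfl | rfl, rfl⟩ |
        ⟨i, j, hij, t, u, rfl | rfl, rfl | rfl, rfl⟩
      · rw [wtComb_single, mul_one, two_zsmul, ← two_nsmul]
        exact Or.inr (Or.inr ⟨i, Or.inl rfl⟩)
      · rw [wtComb_single, mul_neg_one, neg_smul, two_zsmul, ← two_nsmul]
        exact Or.inr (Or.inr ⟨i, Or.inr rfl⟩)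
      · rw [wtComb_add, wtComb_single, wtComb_single, one_smul, one_smul]
        exact Or.inl (Or.inl (Or.inr ⟨i, j, hij, Or.inl rfl⟩))
      · rw [wtComb_add, wtComb_single, wtComb_single, one_smul, neg_one_smul, ← sub_eq_add_neg]
        exact Or.inl (Or.inl (Or.inl ⟨i, j, rfl⟩))
      · rw [wtComb_add, wtComb_single, wtComb_single, one_smul, neg_one_smul, neg_add_eq_sub]
        exact Or.inl (Or.inl (Or.inl ⟨j, i, rfl⟩))
      · rw [wtComb_add, wtComb_single, wtComb_single, neg_one_smul, neg_one_smul, ← neg_add]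
        exact Or.inl (Or.inl (Or.inr ⟨i, j, hij, Or.inr rfl⟩))

variable {F U : Type*} [Field F] [CharZero F] [AddCommGroup U] [Module F U] {ε : I → U}

theorem wtComb_injective (hε : LinearIndependent F ε) : Function.Injective (wtComb ε) := by
  intro μ ν h
  have h1 : ∑ i, ((μ i - ν i : ℤ) : F) • ε i = 0 := by
    rw [← sub_eq_zero, wtComb, wtComb, ← Finset.sum_sub_distrib] at h
    rw [← h]
    refine Finset.sum_congr rfl fun i _ => ?_
    rw [Int.cast_smul_eq_zsmul, sub_smul]
  funext i
  have := Fintype.linearIndependent_iff.1 hε _ h1 i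
  exact sub_eq_zero.1 (Int.cast_eq_zero.1 this)

/-- Doubling a root doubles its norm, so the nonzero roots whose double is a root are those of norm
1. -/
theorem mem_semiDiv_rootsBC_iff [Nonempty I] (hε : LinearIndependent F ε) {α : U} :
    α ∈ semiDiv (rootsBC ε) ↔ ∃ μ, (lOne μ = 0 ∨ lOne μ = 2) ∧ α = wtComb ε μ := by
  have hdouble : ∀ μ : I → ℤ, (2 : ℕ) • wtComb ε μ = wtComb ε (μ + μ) := fun μ => by
    rw [two_nsmul, wtComb_add]
  constructor
  · rintro (⟨h1, h2⟩ | h)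
    · obtain ⟨μ, hμ, rfl⟩ := (mem_rootsBC_iff ε).1 h1
      refine ⟨μ, ?_, rfl⟩
      have h3 : lOne μ ≠ 1 := by
        intro h
        refine h2 ⟨h1, ?_⟩
        rw [hdouble]
        exact (mem_rootsBC_iff ε).2 ⟨_, by rw [lOne_add_self, h]; norm_num, rfl⟩
      have := lOne_nonneg μ
      omega
    · exact ⟨0, Or.inl (by simp [lOne]), by rw [wtComb_zero]; exact h⟩
  · rintro ⟨μ, h | h, rfl⟩
    · rw [eq_zero_of_lOne h, wtComb_zero]
      exact Or.inr rfl
    · refine Or.inl ⟨(mem_rootsBC_iff ε).2 ⟨μ, h.le, rfl⟩, fun h2 => ?_⟩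
      obtain ⟨ν, hν, h3⟩ := (mem_rootsBC_iff ε).1 h2.2
      rw [hdouble] at h3
      have h4 := wtComb_injective hε h3
      have h5 := lOne_add_self μ
      rw [h4] at h5
      omega

end RootSystem

/-! ### The grading subalgebra is of type C. -/

section RootGraded

variable {F L I : Type*} [Field F] [CharZero F] [LieRing L] [LieAlgebra F L] [Fintype I]
  [DecidableEq I] {𝔤 𝔥 : LieSubalgebra F L} {ε : I → Module.Dual F 𝔥}

theorem wtComb_apply (ε : I → Module.Dual F 𝔥) (μ : I → ℤ) (h : 𝔥) :
    wtComb ε μ h = wtEval μ fun i => ε i h := by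
  rw [wtComb, wtEval, LinearMap.sum_apply]
  refine Finset.sum_congr rfl fun i _ => ?_
  rw [← Int.cast_smul_eq_zsmul F, LinearMap.smul_apply, smul_eq_mul]

/-- Such an `h` has value 0 under all roots, so it is central in `𝔤`, and a simple Lie algebra has
no centre. -/
theorem IsRootGraded.eq_zero_of_forall [Nonempty I] (hε : LinearIndependent F ε)
    (hL : IsRootGraded 𝔤 𝔥 (rootsBC ε)) (h : 𝔥) (h0 : ∀ i, ε i h = 0) : h = 0 := by
  have hlie : ∀ x ∈ 𝔤, ⁅(h : L), x⁆ = 0 := by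
    have hle : 𝔤.toSubmodule ≤ LinearMap.ker (LieAlgebra.ad F L (h : L)) := by
      rw [← hL.iSup_rootSub_sub]
      refine iSup_le fun α x hx => ?_
      by_cases hbot : 𝔤.toSubmodule ⊓ rootSub 𝔥 α = ⊥
      · rw [hbot, Submodule.mem_bot] at hx
        rw [hx]
        exact Submodule.zero_mem _
      · have hα : α ∈ semiDiv (rootsBC ε) := by rw [← hL.roots_sub]; exact hbot
        obtain ⟨μ, -, rfl⟩ := (mem_semiDiv_rootsBC_iff hε).1 hα
        rw [LinearMap.mem_ker, LieAlgebra.ad_apply, hx.2 h, wtComb_apply]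
        simp [h0, wtEval]
    exact fun x hx => hle hx
  have hc : (⟨h, hL.le h.2⟩ : 𝔤) ∈ LieAlgebra.center F 𝔤 := by
    rw [LieModule.mem_maxTrivSubmodule]
    intro x
    apply Subtype.ext
    rw [LieSubalgebra.coe_bracket, ← lie_skew, hlie x x.2, neg_zero]
    rfl
  have hb : LieAlgebra.center F 𝔤 = ⊥ := by
    have := hL.simple
    exact LieAlgebra.center_eq_bot F 𝔤
  rw [hb, LieSubmodule.mem_bot] at hc
  exact Subtype.ext (congrArg (fun x : 𝔤 => (x : L)) hc)

/-- The coordinates on `𝔥` given by the vectors `ε i`. -/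
theorem IsRootGraded.exists_coord [Nonempty I] (hε : LinearIndependent F ε)
    (hL : IsRootGraded 𝔤 𝔥 (rootsBC ε)) : ∃ e : 𝔥 ≃ₗ[F] (I → F), ∀ h i, e h i = ε i h := by
  let f : 𝔥 →ₗ[F] (I → F) := LinearMap.pi ε
  have hf : Function.Injective f := by
    rw [injective_iff_map_eq_zero]
    exact fun h h0 => hL.eq_zero_of_forall hε h fun i => congrFun h0 i
  have : FiniteDimensional F 𝔥 := FiniteDimensional.of_injective f hf
  -- Independence of the `ε i` bounds the dimension of `𝔥` from below, injectivity of the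
  -- coordinates from above.
  have h1 : Fintype.card I ≤ Module.finrank F 𝔥 := by
    have := hε.fintype_card_le_finrank
    rwa [Subspace.dual_finrank_eq] at this
  have h2 : Module.finrank F 𝔥 = Module.finrank F (I → F) := by
    have := LinearMap.finrank_le_finrank_of_injective hf
    rw [Module.finrank_fintype_fun_eq_card] at this ⊢
    omega
  exact ⟨LinearEquiv.ofInjectiveOfFinrankEq f hf h2, fun _ _ => rfl⟩

/-- The torus of `𝔤`. -/
def gTorus (hle : 𝔥 ≤ 𝔤) (e : 𝔥 ≃ₗ[F] (I → F)) : (I → F) →ₗ[F] 𝔤 where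
  toFun c := ⟨e.symm c, hle (e.symm c).2⟩
  map_add' c d := Subtype.ext (by simp)
  map_smul' r c := Subtype.ext (by simp)

theorem coe_gTorus (hle : 𝔥 ≤ 𝔤) (e : 𝔥 ≃ₗ[F] (I → F)) (c : I → F) :
    (gTorus hle e c : L) = e.symm c := rfl

theorem mem_rootSub_wtComb {e : 𝔥 ≃ₗ[F] (I → F)} (he : ∀ h i, e h i = ε i h) {μ : I → ℤ}
    {x : L} : x ∈ rootSub 𝔥 (wtComb ε μ) ↔
      ∀ c, ⁅((e.symm c : 𝔥) : L), x⁆ = wtEval μ c • x := by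
  have h1 : ∀ c, wtComb ε μ (e.symm c) = wtEval μ c := by
    intro c
    rw [wtComb_apply]
    congr 1
    funext i
    rw [← he, e.apply_symm_apply]
  constructor
  · intro h c
    rw [h, h1]
  · intro h y
    have := h (e y)
    rw [e.symm_apply_apply] at this
    rw [this, ← h1, e.symm_apply_apply]

theorem mem_wtSpace_gTorus (hle : 𝔥 ≤ 𝔤) {e : 𝔥 ≃ₗ[F] (I → F)} (he : ∀ h i, e h i = ε i h)
    {μ : I → ℤ} {x : 𝔤} :
    x ∈ wtSpace (gTorus hle e) 𝔤 μ ↔ (x : L) ∈ rootSub 𝔥 (wtComb ε μ) := by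
  rw [mem_rootSub_wtComb he]
  constructor
  · intro h c
    exact congrArg Subtype.val (h c)
  · intro h c
    exact Subtype.ext (h c)

theorem IsRootGraded.isTypeC [Nonempty I] (hε : LinearIndependent F ε)
    (hL : IsRootGraded 𝔤 𝔥 (rootsBC ε)) {e : 𝔥 ≃ₗ[F] (I → F)} (he : ∀ h i, e h i = ε i h) :
    IsTypeC (gTorus hL.le e) where
  simple J := by
    have := hL.simple
    exact LieAlgebra.IsSimple.eq_bot_or_eq_top J
  inj c d h := e.symm.injective (Subtype.ext (congrArg (fun x : 𝔤 => (x : L)) h))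
  comm c d := by
    apply Subtype.ext
    have h1 : ((e.symm d : 𝔥) : L) ∈ 𝔤.toSubmodule ⊓ rootSub 𝔥 0 := by
      rw [hL.rootSub_zero_sub]
      exact (e.symm d).2
    have h2 := h1.2 (e.symm c)
    rw [LinearMap.zero_apply, zero_smul] at h2
    exact h2
  weighted x := by
    have hle : 𝔤.toSubmodule ≤ (⨆ μ ∈ weightsC I, wtSpace (gTorus hL.le e) 𝔤 μ).map
        𝔤.toSubmodule.subtype := by
      conv_lhs => rw [← hL.iSup_rootSub_sub]
      refine iSup_le fun α x hx => ?_
      by_cases hbot : 𝔤.toSubmodule ⊓ rootSub 𝔥 α = ⊥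
      · rw [hbot, Submodule.mem_bot] at hx
        rw [hx]
        exact Submodule.zero_mem _
      · have hα : α ∈ semiDiv (rootsBC ε) := by rw [← hL.roots_sub]; exact hbot
        obtain ⟨μ, hμ, rfl⟩ := (mem_semiDiv_rootsBC_iff hε).1 hα
        exact ⟨⟨x, hx.1⟩, mem_iSup_wtSpace (mem_weightsC.2 hμ)
          ((mem_wtSpace_gTorus hL.le he).2 hx.2), rfl⟩
    obtain ⟨y, hy, hyx⟩ := hle x.2
    rwa [← Subtype.ext hyx]
  zero x hx := by
    have h1 := (mem_wtSpace_gTorus hL.le he).1 hx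
    rw [wtComb_zero] at h1
    have h2 : (x : L) ∈ 𝔥.toSubmodule := by
      rw [← hL.rootSub_zero_sub]
      exact ⟨x.2, h1⟩
    exact ⟨e ⟨x, h2⟩, Subtype.ext (by rw [coe_gTorus, e.symm_apply_apply])⟩
  nonzero μ hμ := by
    have h1 : wtComb ε μ ∈ semiDiv (rootsBC ε) :=
      (mem_semiDiv_rootsBC_iff hε).2 ⟨μ, Or.inr hμ, rfl⟩
    rw [← hL.roots_sub] at h1
    obtain ⟨x, hx, hx0⟩ := Submodule.exists_mem_ne_zero_of_ne_bot h1
    exact ⟨⟨x, hx.1⟩, (mem_wtSpace_gTorus hL.le he).2 hx.2,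
      fun h => hx0 (congrArg (fun y : 𝔤 => (y : L)) h)⟩

end RootGraded

/-! ### Transport of submodules along homomorphisms of Lie algebras. -/

section Transfer

variable {F K K' M P : Type*} [Field F] [LieRing K] [LieAlgebra F K] [LieRing K']
  [LieAlgebra F K'] [AddCommGroup M] [Module F M] [LieRingModule K M] [LieModule F K M]
  [AddCommGroup P] [Module F P] [LieRingModule K' P] [LieModule F K' P]

/-- Modules over isomorphic Lie algebras have the same submodules. -/
theorem eq_bot_or_eq_top_of_equiv (θ : K ≃ₗ⁅F⁆ K') (f : M ≃ₗ[F] P)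
    (hf : ∀ x m, f ⁅x, m⁆ = ⁅θ x, f m⁆) (hP : ∀ Q : LieSubmodule F K' P, Q = ⊥ ∨ Q = ⊤)
    (N : LieSubmodule F K M) : N = ⊥ ∨ N = ⊤ := by
  let Q : LieSubmodule F K' P :=
    { N.toSubmodule.comap (f.symm : P →ₗ[F] M) with
      lie_mem := by
        intro y p hp
        have h1 : f.symm ⁅y, p⁆ = ⁅θ.symm y, f.symm p⁆ := by
          rw [LinearEquiv.symm_apply_eq, hf, LieEquiv.apply_symm_apply, LinearEquiv.apply_symm_apply]
        change f.symm ⁅y, p⁆ ∈ N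
        rw [h1]
        exact N.lie_mem hp }
  have hQ : ∀ m, f m ∈ Q ↔ m ∈ N := by
    intro m
    change f.symm (f m) ∈ N ↔ m ∈ N
    rw [f.symm_apply_apply]
  rcases hP Q with h | h
  · left
    rw [LieSubmodule.eq_bot_iff]
    intro m hm
    have := (hQ m).2 hm
    rw [h, LieSubmodule.mem_bot] at this
    exact f.map_eq_zero_iff.1 this
  · right
    rw [eq_top_iff]
    intro m _
    rw [← hQ, h]
    trivial

theorem eq_bot_or_eq_of_equiv (θ : K ≃ₗ⁅F⁆ K') {N : LieSubmodule F K M} (f : N ≃ₗ[F] P)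
    (hf : ∀ x m, f ⁅x, m⁆ = ⁅θ x, f m⁆) (hP : ∀ Q : LieSubmodule F K' P, Q = ⊥ ∨ Q = ⊤)
    (N' : LieSubmodule F K M) (hN' : N' ≤ N) : N' = ⊥ ∨ N' = N := by
  rcases eq_bot_or_eq_top_of_equiv θ f hf hP (N'.comap N.incl) with h | h
  · left
    rw [LieSubmodule.eq_bot_iff]
    intro m hm
    have h1 : (⟨m, hN' hm⟩ : N) ∈ N'.comap N.incl := hm
    rw [h, LieSubmodule.mem_bot] at h1
    exact congrArg Subtype.val h1
  · refine Or.inr (le_antisymm hN' fun m hm => ?_)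
    have h1 : (⟨m, hm⟩ : N) ∈ N'.comap N.incl := by rw [h]; trivial
    exact h1

theorem isIrreducible_of_equiv [Nontrivial P] (θ : K ≃ₗ⁅F⁆ K') (f : M ≃ₗ[F] P)
    (hf : ∀ x m, f ⁅x, m⁆ = ⁅θ x, f m⁆) (hP : ∀ Q : LieSubmodule F K' P, Q = ⊥ ∨ Q = ⊤) :
    LieModule.IsIrreducible F K M := by
  have : Nontrivial M := f.symm.injective.nontrivial
  exact LieModule.IsIrreducible.mk fun N hN =>
    (eq_bot_or_eq_top_of_equiv θ f hf hP N).resolve_left hN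

/-- Restriction of submodules along a homomorphism of Lie algebras. -/
def pullSubmodule [LieRingModule K' M] [LieModule F K' M] (θ : K →ₗ⁅F⁆ K')
    (hc : ∀ (x : K) (m : M), ⁅x, m⁆ = ⁅θ x, m⁆) (N : LieSubmodule F K' M) :
    LieSubmodule F K M :=
  { N.toSubmodule with
    lie_mem := by
      intro x m hm
      change ⁅x, m⁆ ∈ N
      rw [hc]
      exact N.lie_mem hm }

theorem lieSpan_le_pullSubmodule [LieRingModule K' M] [LieModule F K' M] (θ : K →ₗ⁅F⁆ K')
    (hc : ∀ (x : K) (m : M), ⁅x, m⁆ = ⁅θ x, m⁆) (s : Set M) :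
    LieSubmodule.lieSpan F K s ≤ pullSubmodule θ hc (LieSubmodule.lieSpan F K' s) :=
  LieSubmodule.lieSpan_le.2 LieSubmodule.subset_lieSpan

/-- Generation does not change under isomorphisms of Lie algebras. -/
theorem lieSpan_eq_pullSubmodule [LieRingModule K' M] [LieModule F K' M] (θ : K ≃ₗ⁅F⁆ K')
    (hc : ∀ (x : K) (m : M), ⁅x, m⁆ = ⁅θ x, m⁆) (s : Set M) :
    LieSubmodule.lieSpan F K s =
      pullSubmodule (θ : K →ₗ⁅F⁆ K') hc (LieSubmodule.lieSpan F K' s) := by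
  refine le_antisymm (lieSpan_le_pullSubmodule (θ : K →ₗ⁅F⁆ K') hc s) ?_
  have hc' : ∀ (y : K') (m : M), ⁅y, m⁆ = ⁅(θ.symm : K' →ₗ⁅F⁆ K) y, m⁆ := by
    intro y m
    rw [hc]
    change _ = ⁅θ (θ.symm y), m⁆
    rw [LieEquiv.apply_symm_apply]
  exact lieSpan_le_pullSubmodule (θ.symm : K' →ₗ⁅F⁆ K) hc' s

end Transfer

/-! ### Roots of the subsystem as weights supported in `I₀`. -/

section SubsystemWeights

variable {I : Type*} [Fintype I] [DecidableEq I] {I₀ : Finset I}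

theorem wtComb_restrict {U : Type*} [AddCommGroup U] (ε : I → U) {μ : I → ℤ}
    (hμ : ∀ i ∉ I₀, μ i = 0) : wtComb ε μ = wtComb (fun i : I₀ => ε i) (fun i : I₀ => μ i) := by
  rw [wtComb, wtComb, Finset.sum_coe_sort I₀ fun i => μ i • ε i]
  refine (Finset.sum_subset (Finset.subset_univ _) fun i _ hi => ?_).symm
  rw [hμ i hi, zero_smul]

theorem lOne_restrict {μ : I → ℤ} (hμ : ∀ i ∉ I₀, μ i = 0) :
    lOne (fun i : I₀ => μ i) = lOne μ := by
  rw [lOne, lOne, Finset.sum_coe_sort I₀ fun i => |μ i|]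
  refine Finset.sum_subset (Finset.subset_univ _) fun i _ hi => ?_
  rw [hμ i hi, abs_zero]

theorem exists_extend (ν : I₀ → ℤ) :
    ∃ μ : I → ℤ, (∀ i ∉ I₀, μ i = 0) ∧ (fun i : I₀ => μ i) = ν :=
  ⟨fun i => if h : i ∈ I₀ then ν ⟨i, h⟩ else 0, fun _ hi => dif_neg hi,
    funext fun i => dif_pos i.2⟩

theorem mem_rootsBC_sub_iff [Nonempty I₀] {U : Type*} [AddCommGroup U] (ε : I → U) {α : U} :
    α ∈ rootsBC (fun i : I₀ => ε i) ↔
      ∃ μ : I → ℤ, (∀ i ∉ I₀, μ i = 0) ∧ lOne μ ≤ 2 ∧ α = wtComb ε μ := by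
  rw [mem_rootsBC_iff]
  constructor
  · rintro ⟨ν, hν, rfl⟩
    obtain ⟨μ, hμ, rfl⟩ := exists_extend ν
    exact ⟨μ, hμ, by rwa [lOne_restrict hμ] at hν, (wtComb_restrict ε hμ).symm⟩
  · rintro ⟨μ, hμ, hl, rfl⟩
    exact ⟨_, by rwa [lOne_restrict hμ], wtComb_restrict ε hμ⟩

theorem mem_semiDiv_sub_iff [Nonempty I₀] {F U : Type*} [Field F] [CharZero F] [AddCommGroup U]
    [Module F U] {ε : I → U} (hε : LinearIndependent F ε) {α : U} :
    α ∈ semiDiv (rootsBC (fun i : I₀ => ε i)) \ {0} ↔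
      ∃ μ : I → ℤ, (∀ i ∉ I₀, μ i = 0) ∧ lOne μ = 2 ∧ α = wtComb ε μ := by
  have hε₀ : LinearIndependent F (fun i : I₀ => ε i) := hε.comp _ Subtype.val_injective
  rw [Set.mem_sdiff, mem_semiDiv_rootsBC_iff hε₀]
  constructor
  · rintro ⟨⟨ν, hν, rfl⟩, h0⟩
    obtain ⟨μ, hμ, rfl⟩ := exists_extend ν
    rw [lOne_restrict hμ] at hν
    refine ⟨μ, hμ, hν.resolve_left fun h => h0 ?_, (wtComb_restrict ε hμ).symm⟩
    rw [← wtComb_restrict ε hμ, eq_zero_of_lOne h, wtComb_zero]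
    rfl
  · rintro ⟨μ, hμ, hl, rfl⟩
    refine ⟨⟨_, Or.inr (by rw [lOne_restrict hμ, hl]), wtComb_restrict ε hμ⟩, fun h => ?_⟩
    rw [Set.mem_singleton_iff, ← wtComb_zero ε] at h
    exact ne_zero_of_lOne hl (wtComb_injective hε h)

end SubsystemWeights

/-! ### Root spaces under the identification with the symplectic Lie algebra. -/

section Identification

open LieAlgebra.Symplectic

variable {F L I : Type*} [Field F] [CharZero F] [LieRing L] [LieAlgebra F L] [Fintype I]
  [DecidableEq I] {𝔤 𝔥 : LieSubalgebra F L} {ε : I → Module.Dual F 𝔥}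
  {e : 𝔥 ≃ₗ[F] (I → F)} {φ : 𝔤 ≃ₗ⁅F⁆ sp I F}

theorem symm_mem_rootSub {hle : 𝔥 ≤ 𝔤} (he : ∀ h i, e h i = ε i h)
    (hφ : ∀ c, φ (gTorus hle e c) = spTorus F I c) {μ : I → ℤ} {A : sp I F} :
    ((φ.symm A : 𝔤) : L) ∈ rootSub 𝔥 (wtComb ε μ) ↔ A ∈ wtSpace (spTorus F I) (sp I F) μ := by
  rw [← mem_wtSpace_gTorus hle he]
  constructor
  · intro h c
    have h1 := congrArg φ (h c)
    rw [LieEquiv.map_lie, hφ, LieEquiv.apply_symm_apply] at h1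
    rw [h1]
    change φ.toLinearEquiv _ = _
    rw [map_smul]
    change _ • φ (φ.symm A) = _
    rw [LieEquiv.apply_symm_apply]
  · intro h c
    refine φ.injective (?_ : φ _ = φ _)
    rw [LieEquiv.map_lie, hφ, LieEquiv.apply_symm_apply, h c]
    change _ = φ.toLinearEquiv _
    rw [map_smul]
    change _ = _ • φ (φ.symm A)
    rw [LieEquiv.apply_symm_apply]

section LModule

variable [LieRingModule (sp I F) L] [LieModule F (sp I F) L]

theorem mem_wtSpace_iff_mem_rootSub {hle : 𝔥 ≤ 𝔤} (he : ∀ h i, e h i = ε i h)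
    (hφ : ∀ c, φ (gTorus hle e c) = spTorus F I c)
    (hc : ∀ (A : sp I F) (m : L), ⁅A, m⁆ = ⁅((φ.symm A : 𝔤) : L), m⁆) {μ : I → ℤ} {m : L} :
    m ∈ wtSpace (spTorus F I) L μ ↔ m ∈ rootSub 𝔥 (wtComb ε μ) := by
  rw [mem_rootSub_wtComb he]
  have h1 : ∀ c, ⁅spTorus F I c, m⁆ = ⁅((e.symm c : 𝔥) : L), m⁆ := by
    intro c
    rw [hc, ← hφ, LieEquiv.symm_apply_apply]
    rfl
  simp only [mem_wtSpace, h1]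

theorem IsRootGraded.isWeightedBy [Nonempty I] (hL : IsRootGraded 𝔤 𝔥 (rootsBC ε))
    (he : ∀ h i, e h i = ε i h) (hφ : ∀ c, φ (gTorus hL.le e c) = spTorus F I c)
    (hc : ∀ (A : sp I F) (m : L), ⁅A, m⁆ = ⁅((φ.symm A : 𝔤) : L), m⁆) :
    IsWeightedBy (spTorus F I) L (weightsBC I) := by
  intro m
  have h1 : m ∈ ⨆ α : Module.Dual F 𝔥, rootSub 𝔥 α := by rw [hL.iSup_rootSub]; trivial
  refine (iSup_le fun α x hx => ?_ : (⨆ α : Module.Dual F 𝔥, rootSub 𝔥 α) ≤ _) h1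
  by_cases hbot : rootSub 𝔥 α = ⊥
  · rw [hbot, Submodule.mem_bot] at hx
    rw [hx]
    exact Submodule.zero_mem _
  · obtain ⟨μ, hμ, rfl⟩ := (mem_rootsBC_iff ε).1 (hL.weights_mem α hbot)
    exact mem_iSup_wtSpace (mem_weightsBC.2 hμ) ((mem_wtSpace_iff_mem_rootSub he hφ hc).2 hx)

variable {I₀ : Finset I}

/-- The weights occurring in `L^S` are supported in `I₀`, and a torus element of index outside `I₀`
acts through the coordinate there. This provides the missing condition in `mem_wtSpace_of_comp`. -/
theorem lie_spX_eq_zero_of_mem_gradedPart [Nonempty I₀] {hle : 𝔥 ≤ 𝔤} (he : ∀ h i, e h i = ε i h)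
    (hφ : ∀ c, φ (gTorus hle e c) = spTorus F I c)
    (hc : ∀ (A : sp I F) (m : L), ⁅A, m⁆ = ⁅((φ.symm A : 𝔤) : L), m⁆) {m : L}
    (hm : m ∈ gradedPart 𝔥 (rootsBC fun i : I₀ => ε i)) {i : I} (hi : i ∉ I₀) :
    ⁅spX F (Sum.inl i) (Sum.inl i), m⁆ = 0 := by
  have key : ∀ μ : I → ℤ, μ i = 0 → ∀ x ∈ rootSub 𝔥 (wtComb ε μ),
      ⁅spX F (Sum.inl i) (Sum.inl i), x⁆ = 0 := by
    intro μ hμ x hx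
    rw [lie_spX_self ((mem_wtSpace_iff_mem_rootSub he hφ hc).2 hx), pr_inl, hμ, Int.cast_zero,
      zero_smul]
  have hle : gradedPart 𝔥 (rootsBC fun i : I₀ => ε i) ≤
      lieComap (spX F (Sum.inl i) (Sum.inl i)) (⊥ : Submodule F L) := by
    refine sup_le (iSup₂_le fun α hα x hx => ?_) (iSup₂_le fun α _ => ?_)
    · obtain ⟨μ, hμ, -, rfl⟩ := (mem_rootsBC_sub_iff ε).1 hα.1
      exact key μ (hμ i hi) x hx.2
    · rw [bracketSpan, Submodule.span_le]
      rintro _ ⟨x, hx, y, hy, rfl⟩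
      refine key 0 rfl _ ?_
      have := lie_mem_rootSub hx.2 hy.2
      rwa [add_neg_cancel, ← wtComb_zero ε] at this
  exact hle hm

theorem mem_gradedPart [Nonempty I₀] (hε : LinearIndependent F ε) {μ : I → ℤ} (hμ : μ ≠ 0)
    (hμ' : ∀ i ∉ I₀, μ i = 0) (hl : lOne μ ≤ 2) {m : L} (hm : m ∈ rootSub 𝔥 (wtComb ε μ)) :
    m ∈ gradedPart 𝔥 (rootsBC fun i : I₀ => ε i) := by
  refine Submodule.mem_sup_left (Submodule.mem_iSup_of_mem (wtComb ε μ)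
    (Submodule.mem_iSup_of_mem ⟨(mem_rootsBC_sub_iff ε).2 ⟨μ, hμ', hl, rfl⟩, fun h => ?_⟩
      ⟨trivial, hm⟩))
  rw [Set.mem_singleton_iff, ← wtComb_zero ε] at h
  exact hμ (wtComb_injective hε h)

end LModule

/-! #### The subalgebra attached to a subsystem -/

variable {I₀ : Finset I}

theorem embMat_injective {ι κ : Type*} [Fintype ι] [DecidableEq ι] [Fintype κ] [DecidableEq κ]
    {j : κ → ι} (hj : Function.Injective j) :
    Function.Injective (embMat (F := F) j) := by
  intro A B h
  have h1 : ∀ A : Matrix (κ ⊕ κ) (κ ⊕ κ) F,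
      (inclMat F j).transpose * embMat j A * inclMat F j = A := by
    intro A
    have : (inclMat F j).transpose * embMat j A * inclMat F j =
        ((inclMat F j).transpose * inclMat F j) * A *
          ((inclMat F j).transpose * inclMat F j) := by
      rw [embMat_apply]
      simp only [Matrix.mul_assoc]
    rw [this, transpose_mul_inclMat hj, Matrix.one_mul, Matrix.mul_one]
  rw [← h1 A, h, h1]

theorem symm_spEmb_mem_gradingSub [Nonempty I₀] (hε : LinearIndependent F ε) {hle : 𝔥 ≤ 𝔤}
    (he : ∀ h i, e h i = ε i h) (hφ : ∀ c, φ (gTorus hle e c) = spTorus F I c) (A : sp I₀ F) :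
    ((φ.symm (spEmb F (Subtype.val : I₀ → I) Subtype.val_injective A) : 𝔤) : L) ∈
      gradingSub 𝔤 𝔥 (rootsBC fun i : I₀ => ε i) := by
  let f : sp I₀ F →ₗ⁅F⁆ L := 𝔤.incl.comp ((φ.symm : sp I F →ₗ⁅F⁆ 𝔤).comp
    (spEmb F (Subtype.val : I₀ → I) Subtype.val_injective))
  have hroot : ∀ p q : I₀ ⊕ I₀, p ≠ q →
      f (spX F p q) ∈ gradingSub 𝔤 𝔥 (rootsBC fun i : I₀ => ε i) := by
    intro p q hpq
    have h1 : spEmb F (Subtype.val : I₀ → I) Subtype.val_injective (spX F p q) ∈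
        wtSpace (spTorus F I) (sp I F) (wt (Sum.map Subtype.val Subtype.val p) -
          wt (Sum.map Subtype.val Subtype.val q)) := by
      rw [spEmb_spX]
      exact spX_mem _ _
    have h2 := (symm_mem_rootSub he hφ).2 h1
    have hsupp : ∀ (r : I₀ ⊕ I₀) (i : I), i ∉ I₀ →
        wt (Sum.map Subtype.val Subtype.val r : I ⊕ I) i = 0 := by
      rintro (k | k) i hi <;>
        simp [wt, show i ≠ k by rintro rfl; exact hi k.2]
    have hne := wt_sub_ne_zero (fun h => hpq (sumMap_injective Subtype.val_injective h) :
      (Sum.map Subtype.val Subtype.val p : I ⊕ I) ≠ Sum.map Subtype.val Subtype.val q)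
    have h3 : wtComb ε (wt (Sum.map Subtype.val Subtype.val p) -
          wt (Sum.map Subtype.val Subtype.val q)) ∈
        semiDiv (rootsBC fun i : I₀ => ε i) \ {0} :=
      (mem_semiDiv_sub_iff hε).2 ⟨_, fun i hi => by
        rw [Pi.sub_apply, hsupp p i hi, hsupp q i hi, sub_zero],
        (mem_weightsC.1 (wt_sub_wt_mem_weightsC _ _)).resolve_left
          fun h => hne (eq_zero_of_lOne h), rfl⟩
    exact LieSubalgebra.subset_lieSpan (Submodule.mem_sup_left (Submodule.mem_iSup_of_mem _
      (Submodule.mem_iSup_of_mem h3 ⟨(φ.symm _).2, h2⟩)))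
  refine sp_induction ((gradingSub 𝔤 𝔥 (rootsBC fun i : I₀ => ε i)).toSubmodule.comap
    (f : sp I₀ F →ₗ[F] L)) (fun p q => ?_) A
  by_cases hpq : p = q
  · subst hpq
    -- The diagonal elements are not root vectors; each is, up to a nonzero factor, the bracket of
    -- opposite long root vectors.
    have h1 := LieSubalgebra.lie_mem _ (hroot p p.swap (swap_ne_self p).symm)
      (hroot p.swap p (swap_ne_self p))
    rw [← LieHom.map_lie, lie_spX_spX (swap_ne_self p).symm, wtF_swap, sub_neg_eq_add, map_smul,
      map_add, ← spX_self, ← two_smul F, smul_smul, map_smul] at h1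
    have h2 : ((spκ p p.swap : ℤ) : F) * 2 ≠ 0 := by
      rw [spκ, if_pos rfl]
      norm_num
    exact ((gradingSub 𝔤 𝔥 (rootsBC fun i : I₀ => ε i)).toSubmodule.smul_mem_iff h2).1 h1
  · exact hroot p q hpq

/-- Root spaces of `𝔤` are lines, so those with root in the subsystem are spanned by images of
standard elements of `sp I₀`. Hence `𝔤^S` is the image of the embedding by extension with zeros. -/
theorem exists_equiv_gradingSub [Nonempty I₀] (hε : LinearIndependent F ε)
    (hL : IsRootGraded 𝔤 𝔥 (rootsBC ε))
    (he : ∀ h i, e h i = ε i h) (hφ : ∀ c, φ (gTorus hL.le e c) = spTorus F I c) :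
    ∃ θ : sp I₀ F ≃ₗ⁅F⁆ gradingSub 𝔤 𝔥 (rootsBC fun i : I₀ => ε i), ∀ A, (θ A : L) =
      ((φ.symm (spEmb F (Subtype.val : I₀ → I) Subtype.val_injective A) : 𝔤) : L) := by
  let f : sp I₀ F →ₗ⁅F⁆ L := 𝔤.incl.comp ((φ.symm : sp I F →ₗ⁅F⁆ 𝔤).comp
    (spEmb F (Subtype.val : I₀ → I) Subtype.val_injective))
  have hf : Function.Injective f := by
    intro A B h
    have h1 := φ.symm.injective (Subtype.val_injective h)
    exact Subtype.ext (embMat_injective Subtype.val_injective (congrArg Subtype.val h1))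
  have hrange : gradingSub 𝔤 𝔥 (rootsBC fun i : I₀ => ε i) = f.range := by
    apply le_antisymm
    · have : Nonempty I := ⟨(Classical.arbitrary I₀ : I₀)⟩
      have hT := hL.isTypeC hε he
      have hroot : ∀ α ∈ semiDiv (rootsBC fun i : I₀ => ε i) \ {0},
          ∀ x ∈ 𝔤.toSubmodule ⊓ rootSub 𝔥 α, x ∈ f.range := by
        intro α hα x hx
        obtain ⟨μ, hμ, hl, rfl⟩ := (mem_semiDiv_sub_iff hε).1 hα
        have key : ∃ p q : I₀ ⊕ I₀,
            wt (Sum.map Subtype.val Subtype.val p : I ⊕ I) -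
              wt (Sum.map Subtype.val Subtype.val q) = μ := by
          have hmem : ∀ i, μ i ≠ 0 → i ∈ I₀ := fun i hi => by
            by_contra h
            exact hi (hμ i h)
          have hone : ∀ (i : I₀) (t : ℤ), (t = 1 ∨ t = -1) → ∃ p : I₀ ⊕ I₀,
              wt (Sum.map Subtype.val Subtype.val p : I ⊕ I) = Pi.single (i : I) t := by
            rintro i t (rfl | rfl)
            · exact ⟨Sum.inl i, rfl⟩
            · exact ⟨Sum.inr i, by simp [wt, ← Pi.single_neg]⟩
          rcases weightsC_cases hl with ⟨i, t, ht, rfl⟩ | ⟨i, k, hik, t, u, ht, hu, rfl⟩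
          · have hi : i ∈ I₀ := hmem i (by rw [Pi.single_eq_same]; omega)
            obtain ⟨p, hp⟩ := hone ⟨i, hi⟩ t ht
            refine ⟨p, p.swap, ?_⟩
            rw [← swap_sumMap, wt_swap, hp, sub_neg_eq_add, two_mul, Pi.single_add]
          · obtain ⟨p, hp⟩ := hone ⟨i, hmem i (by
              rw [Pi.add_apply, Pi.single_eq_same, Pi.single_eq_of_ne hik]; omega)⟩ t ht
            obtain ⟨q, hq⟩ := hone ⟨k, hmem k (by
              rw [Pi.add_apply, Pi.single_eq_same, Pi.single_eq_of_ne hik.symm]; omega)⟩ u hu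
            refine ⟨p, q.swap, ?_⟩
            rw [← swap_sumMap, wt_swap, hp, hq, sub_neg_eq_add]
        obtain ⟨p, q, rfl⟩ := key
        have h1 : φ.symm (spX F (Sum.map Subtype.val Subtype.val p)
            (Sum.map Subtype.val Subtype.val q)) ∈ wtSpace (gTorus hL.le e) 𝔤 _ :=
          (mem_wtSpace_gTorus hL.le he).2 ((symm_mem_rootSub he hφ).2 (spX_mem _ _))
        obtain ⟨c, hcx⟩ := hT.exists_smul_of_ne_zero hl h1 (fun h => spX_ne_zero (F := F) _ _
          (φ.symm.injective (h.trans (map_zero φ.symm.toLinearEquiv).symm)))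
          ((mem_wtSpace_gTorus hL.le he).2 (show ((⟨x, hx.1⟩ : 𝔤) : L) ∈ _ from hx.2))
        refine ⟨c • spX F p q, ?_⟩
        have h2 := congrArg (fun y : 𝔤 => (y : L)) hcx
        change x = c • _ at h2
        rw [h2, ← spEmb_spX (Subtype.val : I₀ → I) Subtype.val_injective]
        exact map_smul f c _
      refine LieSubalgebra.lieSpan_le.2 ?_
      refine (sup_le (iSup₂_le fun α hα x hx => hroot α hα x hx)
        (iSup₂_le fun α hα => ?_) : _ ≤ f.range.toSubmodule)
      rw [bracketSpan, Submodule.span_le]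
      rintro _ ⟨x, hx, y, hy, rfl⟩
      refine LieSubalgebra.lie_mem _ (hroot α hα x hx) (hroot (-α) ?_ y hy)
      obtain ⟨μ, hμ, hl, rfl⟩ := (mem_semiDiv_sub_iff hε).1 hα
      exact (mem_semiDiv_sub_iff hε).2 ⟨-μ, fun i hi => by rw [Pi.neg_apply, hμ i hi, neg_zero],
        by rw [lOne_neg, hl], by rw [wtComb_neg]⟩
    · rintro _ ⟨A, rfl⟩
      exact symm_spEmb_mem_gradingSub hε he hφ A
  rw [hrange]
  exact ⟨LieEquiv.ofInjective f hf, fun A => rfl⟩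

end Identification

/-! ### Lifting highest weight vectors from the subsystem. -/

section Lifting

open LieAlgebra.Symplectic

theorem exists_equiv_pullSubmodule {F K K' M P : Type*} [Field F] [LieRing K] [LieAlgebra F K]
    [LieRing K'] [LieAlgebra F K'] [AddCommGroup M] [Module F M] [LieRingModule K M]
    [LieModule F K M] [LieRingModule K' M] [LieModule F K' M]
    [AddCommGroup P] [Module F P] [LieRingModule K' P] [LieModule F K' P] (θ : K →ₗ⁅F⁆ K')
    (hc : ∀ (x : K) (m : M), ⁅x, m⁆ = ⁅θ x, m⁆) {N : LieSubmodule F K' M}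
    (e : N ≃ₗ⁅F, K'⁆ P) :
    ∃ f : pullSubmodule θ hc N ≃ₗ[F] P, ∀ x m, f ⁅x, m⁆ = ⁅θ x, f m⁆ := by
  let f : pullSubmodule θ hc N ≃ₗ[F] P :=
    (LinearEquiv.ofEq (pullSubmodule θ hc N).toSubmodule N.toSubmodule rfl).trans
      (e : N ≃ₗ[F] P)
  refine ⟨f, fun x m => ?_⟩
  have h1 : ∀ m, f m = e ⟨m, m.2⟩ := fun m => rfl
  have h2 : e ⁅θ x, (⟨m, m.2⟩ : N)⁆ = ⁅θ x, e ⟨m, m.2⟩⁆ :=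
    LieModuleHom.map_lie e.toLieModuleHom _ _
  rw [h1, h1]
  refine Eq.trans (congrArg e ?_) h2
  exact Subtype.ext (hc x m)

theorem IsHWModule.nontrivial {F ι M : Type*} [Field F] [CharZero F] [Fintype ι] [DecidableEq ι]
    [AddCommGroup M] [Module F M] [LieRingModule (sp ι F) M] [LieModule F (sp ι F) M]
    {a lam : ι → ℤ} (h : IsHWModule F M a lam) : Nontrivial M := by
  obtain ⟨x, -, hx0, -⟩ := h.exists_gen
  exact ⟨x, 0, hx0⟩

theorem ne_bot_of_equiv {F K M P : Type*} [Field F] [LieRing K] [LieAlgebra F K]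
    [AddCommGroup M] [Module F M] [LieRingModule K M] [LieModule F K M]
    [AddCommGroup P] [Module F P] [Nontrivial P] {N : LieSubmodule F K M} (f : N ≃ₗ[F] P) :
    N ≠ ⊥ := by
  rintro rfl
  have := f.symm.injective.nontrivial
  exact not_subsingleton (⊥ : LieSubmodule F K M) inferInstance

variable {F L I : Type*} [Field F] [CharZero F] [LieRing L] [LieAlgebra F L] [Fintype I]
  [DecidableEq I] {𝔤 𝔥 : LieSubalgebra F L} {ε : I → Module.Dual F 𝔥}
  {e : 𝔥 ≃ₗ[F] (I → F)} {φ : 𝔤 ≃ₗ⁅F⁆ sp I F} {I₀ : Finset I}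
  [LieRingModule (sp I F) L] [LieModule F (sp I F) L]
  [LieRingModule (sp I₀ F) L] [LieModule F (sp I₀ F) L] {𝔨 : LieSubalgebra F L}

/-- Minimal submodules over the smaller symplectic Lie algebra contain highest weight vectors for
the larger one. -/
theorem exists_generator (hcard : 3 < I₀.card) {o₁ o₂ : I₀} {a : I → ℤ}
    (ha : IsHeight a (o₁ : I) o₂)
    (hM : IsWeightedBy (spTorus F I) L (weightsBC I))
    (hc : ∀ (A : sp I₀ F) (m : L),
      ⁅A, m⁆ = ⁅spEmb F (Subtype.val : I₀ → I) Subtype.val_injective A, m⁆)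
    (θ : sp I₀ F ≃ₗ⁅F⁆ 𝔨) (hθ : ∀ (A : sp I₀ F) (m : L), ⁅A, m⁆ = ⁅θ A, m⁆)
    {N : LieSubmodule F 𝔨 L}
    (htor : ∀ i ∉ I₀, ∀ m ∈ N, ⁅spX F (Sum.inl i) (Sum.inl i), m⁆ = 0)
    {P : Type*} [AddCommGroup P] [Module F P] [LieRingModule (sp I₀ F) P]
    [LieModule F (sp I₀ F) P] [Nontrivial P]
    (hP : ∀ Q : LieSubmodule F (sp I₀ F) P, Q = ⊥ ∨ Q = ⊤) (φ' : 𝔨 ≃ₗ⁅F⁆ sp I₀ F)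
    (f : N ≃ₗ[F] P) (hf : ∀ x m, f ⁅x, m⁆ = ⁅φ' x, f m⁆) :
    (Module.finrank F P = Module.finrank F (sp I₀ F) →
      ∃ y ∈ wtSpace (spTorus F I) L (Pi.single (o₁ : I) 2), y ≠ 0 ∧ IsHW F a y ∧ y ∈ N ∧
        (N : Set L) ⊆ LieSubmodule.lieSpan F (sp I F) {y}) ∧
    (Module.finrank F P = Module.finrank F (spS I₀ F) →
      ∃ y ∈ wtSpace (spTorus F I) L (Pi.single (o₁ : I) 1 + Pi.single (o₂ : I) 1), y ≠ 0 ∧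
        IsHW F a y ∧ y ∈ N ∧ (N : Set L) ⊆ LieSubmodule.lieSpan F (sp I F) {y}) ∧
    (Module.finrank F P = Module.finrank F (spV I₀ F) →
      ∃ y ∈ wtSpace (spTorus F I) L (Pi.single (o₁ : I) 1), y ≠ 0 ∧ IsHW F a y ∧ y ∈ N ∧
        (N : Set L) ⊆ LieSubmodule.lieSpan F (sp I F) {y}) := by
  have hinj : Function.Injective (Subtype.val : I₀ → I) := Subtype.val_injective
  let N₀ : LieSubmodule F (sp I₀ F) L := pullSubmodule (θ : sp I₀ F →ₗ⁅F⁆ 𝔨) hθ N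
  let f₀ : N₀ ≃ₗ[F] P := (LinearEquiv.ofEq N₀.toSubmodule N.toSubmodule rfl).trans f
  -- The isomorphism `φ'` need not be compatible with `θ`. Only irreducibility and dimension are
  -- taken from it, and neither depends on the choice.
  have hf₀ : ∀ x m, f₀ ⁅x, m⁆ = ⁅θ.trans φ' x, f₀ m⁆ := by
    intro x m
    have h1 : ∀ m, f₀ m = f ⟨m, m.2⟩ := fun m => rfl
    rw [h1, h1]
    change _ = ⁅φ' (θ x), _⁆
    rw [← hf]
    congr 1
    exact Subtype.ext (hθ x m)
  have hirr := eq_bot_or_eq_of_equiv (θ.trans φ') f₀ hf₀ hP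
  have hbot : N₀ ≠ ⊥ := ne_bot_of_equiv f₀
  have lift : ∀ μ : I → ℤ, IsDom (o₁ : I) o₂ μ → ∀ ν : I₀ → ℤ,
      μ ∘ (Subtype.val : I₀ → I) = ν →
      (∃ y ∈ wtSpace (spTorus F I₀) L ν, y ≠ 0 ∧ IsHW F (a ∘ (Subtype.val : I₀ → I)) y ∧
        LieSubmodule.lieSpan F (sp I₀ F) {y} = N₀) →
      ∃ y ∈ wtSpace (spTorus F I) L μ, y ≠ 0 ∧ IsHW F a y ∧ y ∈ N ∧
        (N : Set L) ⊆ LieSubmodule.lieSpan F (sp I F) {y} := by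
    rintro μ hμ ν rfl ⟨y, hy, hy0, hhw, hs⟩
    have hyN : y ∈ N := by
      have : y ∈ N₀ := by
        rw [← hs]
        exact LieSubmodule.subset_lieSpan rfl
      exact this
    -- Inside `I₀` the weight is known; outside, the torus kills `N` and `μ` vanishes.
    have hy' : y ∈ wtSpace (spTorus F I) L μ := by
      refine mem_wtSpace_of_comp hc hy (fun i hi => htor i (fun h => hi ⟨⟨i, h⟩, rfl⟩) y hyN)
        fun i hi => hμ.eq_zero_of_notMem hi
    refine ⟨y, hy', hy0, hhw.of_comp hc hM ha hμ hy', hyN, fun m hm => ?_⟩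
    have h1 : m ∈ LieSubmodule.lieSpan F (sp I₀ F) {y} := by
      rw [hs]
      exact hm
    exact lieSpan_le_pullSubmodule (spEmb F (Subtype.val : I₀ → I) hinj) hc {y} h1
  have hfin : Module.finrank F N₀ = Module.finrank F P := f₀.finrank_eq
  obtain ⟨h1, h2, h3⟩ := exists_isHW_of_finrank (by rwa [Fintype.card_coe]) (ha.comp hinj)
    (isWeightedBy_comp hc hM) hirr hbot
  rw [hfin] at h1 h2 h3
  refine ⟨fun h => lift _ (Or.inl rfl) _ (single_comp hinj o₁ 2) (h1 h),
    fun h => lift _ (Or.inr (Or.inl rfl)) _ ?_ (h2 h),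
    fun h => lift _ (Or.inr (Or.inr rfl)) _ (single_comp hinj o₁ 1) (h3 h)⟩
  rw [← single_comp hinj o₁ 1, ← single_comp hinj o₂ 1]
  rfl

end Lifting

/-! ### The decomposition theorem. -/

open LieAlgebra.Symplectic
theorem lemma3p16 {F : Type uF} {L : Type uL} {I : Type uI} [Field F] [CharZero F]
    [LieRing L] [LieAlgebra F L] [Fintype I] [DecidableEq I] (I₀ : Finset I) (hI₀ : 3 < I₀.card)
    (𝔤 𝔥 : LieSubalgebra F L)
    (ε : I → Module.Dual F 𝔥) (hε : LinearIndependent F ε)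
    (hL : IsRootGraded 𝔤 𝔥 (rootsBC ε))
    (S : Set (Module.Dual F 𝔥)) (hS : S = rootsBC (fun i : I₀ => ε i))
    {A₀ : Type uA} {B₀ : Type uB} {C₀ : Type uC}
    (g : A₀ → LieSubmodule F (gradingSub 𝔤 𝔥 S) L)
    (s : B₀ → LieSubmodule F (gradingSub 𝔤 𝔥 S) L)
    (v : C₀ → LieSubmodule F (gradingSub 𝔤 𝔥 S) L)
    (E : LieSubmodule F (gradingSub 𝔤 𝔥 S) L)
    (hg : ∀ i, Nonempty (g i ≃ₗ⁅F, gradingSub 𝔤 𝔥 S⁆ gradingSub 𝔤 𝔥 S))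
    (hs : ∀ j, ∃ φ : gradingSub 𝔤 𝔥 S ≃ₗ⁅F⁆ LieAlgebra.Symplectic.sp I₀ F, IsIsoS φ (s j))
    (hv : ∀ t, ∃ φ : gradingSub 𝔤 𝔥 S ≃ₗ⁅F⁆ LieAlgebra.Symplectic.sp I₀ F, IsIsoV φ (v t))
    (hE : LieModule.IsTrivial (gradingSub 𝔤 𝔥 S) E)
    (hsum : IsDirectDecomp (gradedPart 𝔥 S) g s v E) :
    ∃ (φ : 𝔤 ≃ₗ⁅F⁆ LieAlgebra.Symplectic.sp I F)
      (A : Type (max uL uA)) (B : Type (max uL uB)) (C : Type (max uL uC))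
      (a : A₀ ↪ A) (b : B₀ ↪ B) (c : C₀ ↪ C)
      (G : A → LieSubmodule F 𝔤 L) (T : B → LieSubmodule F 𝔤 L)
      (V : C → LieSubmodule F 𝔤 L) (D : LieSubmodule F 𝔤 L),
      -- the identification of `𝔤` with `𝔰𝔭` respects the Cartan subalgebras and the roots
      (∀ (h : 𝔤) (hh : (h : L) ∈ 𝔥), (φ h : Matrix (I ⊕ I) (I ⊕ I) F) =
        Matrix.diagonal (Sum.elim (fun i => ε i ⟨h, hh⟩) (fun i => -ε i ⟨h, hh⟩))) ∧
      -- finite dimensional irreducible submodules of the three types, and a trivial one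
      (∀ i, FiniteDimensional F (G i) ∧ LieModule.IsIrreducible F 𝔤 (G i) ∧
        Nonempty (G i ≃ₗ⁅F, 𝔤⁆ 𝔤)) ∧
      (∀ j, FiniteDimensional F (T j) ∧ LieModule.IsIrreducible F 𝔤 (T j) ∧ IsIsoS φ (T j)) ∧
      (∀ t, FiniteDimensional F (V t) ∧ LieModule.IsIrreducible F 𝔤 (V t) ∧ IsIsoV φ (V t)) ∧
      LieModule.IsTrivial 𝔤 D ∧
      -- the given summands lie in, and generate, the corresponding submodules
      (∀ i, (g i : Set L) ⊆ G (a i) ∧ LieSubmodule.lieSpan F 𝔤 (g i : Set L) = G (a i)) ∧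
      (∀ j, (s j : Set L) ⊆ T (b j) ∧ LieSubmodule.lieSpan F 𝔤 (s j : Set L) = T (b j)) ∧
      (∀ t, (v t : Set L) ⊆ V (c t) ∧ LieSubmodule.lieSpan F 𝔤 (v t : Set L) = V (c t)) ∧
      IsDirectDecomp ⊤ G T V D := by
  subst hS
  -- Two indices of `I₀` are made the highest ones, so that all three dominant weights are supported
  -- in `I₀`.
  obtain ⟨i₁, hi₁, i₂, hi₂, hne⟩ := Finset.one_lt_card.1 (show 1 < I₀.card by omega)
  have : Nonempty I₀ := ⟨⟨i₁, hi₁⟩⟩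
  have : Nonempty I := ⟨i₁⟩
  let o₁ : I₀ := ⟨i₁, hi₁⟩
  let o₂ : I₀ := ⟨i₂, hi₂⟩
  obtain ⟨ht, ha⟩ := exists_isHeight hne
  have ha₀ : IsHeight (ht ∘ Subtype.val) o₁ o₂ :=
    IsHeight.comp (j := (Subtype.val : I₀ → I)) ha Subtype.val_injective
  obtain ⟨e, he⟩ := hL.exists_coord hε
  obtain ⟨φ, hφ⟩ := (hL.isTypeC hε he).exists_equiv (isTypeC_spTorus hne)
  obtain ⟨θ, hθ⟩ := exists_equiv_gradingSub (I₀ := I₀) hε hL he hφ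
  -- the module structures on `L`
  let ρ : sp I F →ₗ⁅F⁆ L := 𝔤.incl.comp (φ.symm : sp I F →ₗ⁅F⁆ 𝔤)
  let ψ : sp I₀ F →ₗ⁅F⁆ sp I F := spEmb F (Subtype.val : I₀ → I) Subtype.val_injective
  let : LieRingModule (sp I F) L := LieRingModule.compLieHom L ρ
  let : LieModule F (sp I F) L := LieModule.compLieHom L ρ
  let : LieRingModule (sp I₀ F) L := LieRingModule.compLieHom L (ρ.comp ψ)
  let : LieModule F (sp I₀ F) L := LieModule.compLieHom L (ρ.comp ψ)
  have hc : ∀ (A : sp I F) (m : L), ⁅A, m⁆ = ⁅((φ.symm A : 𝔤) : L), m⁆ := fun _ _ => rfl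
  have hc₀ : ∀ (A : sp I₀ F) (m : L), ⁅A, m⁆ = ⁅ψ A, m⁆ := fun _ _ => rfl
  have hcθ : ∀ (A : sp I₀ F) (m : L), ⁅A, m⁆ = ⁅θ A, m⁆ := by
    intro A m
    change _ = ⁅(θ A : L), m⁆
    rw [hθ, hc₀, hc]
  have hcφ : ∀ (y : 𝔤) (m : L), ⁅y, m⁆ = ⁅φ y, m⁆ := by
    intro y m
    rw [hc, LieEquiv.symm_apply_apply]
    rfl
  have hM : IsWeightedBy (spTorus F I) L (weightsBC I) := hL.isWeightedBy he hφ hc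
  obtain ⟨hind, hsup⟩ := hsum
  rw [LieSubmodule.iSup_toSubmodule] at hsup
  have hpart : ∀ k, (Sum.elim g (Sum.elim s (Sum.elim v fun _ : Unit => E)) k).toSubmodule ≤
      gradedPart 𝔥 (rootsBC fun i : I₀ => ε i) := fun k => by
    rw [← hsup]
    exact le_iSup (fun k => (Sum.elim g (Sum.elim s (Sum.elim v fun _ : Unit => E)) k).toSubmodule) k
  have htor : ∀ k, ∀ i ∉ I₀, ∀ m ∈ Sum.elim g (Sum.elim s (Sum.elim v fun _ : Unit => E)) k,
      ⁅spX F (Sum.inl i) (Sum.inl i), m⁆ = 0 := fun k i hi m hm =>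
    lie_spX_eq_zero_of_mem_gradedPart he hφ hc (hpart k hm) hi
  have hsp₀ := isHWModule_sp (F := F) ha₀
  have hspS₀ := isHWModule_spS (F := F) ha₀
  have hspV₀ := isHWModule_spV (F := F) ha₀
  have hsp := isHWModule_sp (F := F) ha
  have hspS := isHWModule_spS (F := F) ha
  have hspV := isHWModule_spV (F := F) ha
  have := hsp₀.nontrivial
  have := hspS₀.nontrivial
  have := hspV₀.nontrivial
  have := hsp.nontrivial
  have := hspS.nontrivial
  have := hspV.nontrivial
  -- highest weight vectors
  have Hg : ∀ i, ∃ y ∈ wtSpace (spTorus F I) L (Pi.single i₁ 2), y ≠ 0 ∧ IsHW F ht y ∧ y ∈ g i ∧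
      (g i : Set L) ⊆ LieSubmodule.lieSpan F (sp I F) {y} := by
    intro i
    obtain ⟨f⟩ := hg i
    refine (exists_generator (o₁ := o₁) (o₂ := o₂) hI₀ ha hM hc₀ θ hcθ (htor (Sum.inl i))
      (hsp₀.eq_bot_or_eq_top ha₀ (Or.inl rfl)) θ.symm
      ((f : g i ≃ₗ[F] _).trans θ.symm.toLinearEquiv) fun x m => ?_).1 rfl
    change θ.symm (f ⁅x, m⁆) = ⁅θ.symm x, θ.symm (f m)⁆
    rw [← LieEquiv.map_lie]
    congr 1
    exact LieModuleHom.map_lie f.toLieModuleHom x m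
  have Hs : ∀ j, ∃ y ∈ wtSpace (spTorus F I) L (Pi.single i₁ 1 + Pi.single i₂ 1), y ≠ 0 ∧
      IsHW F ht y ∧ y ∈ s j ∧ (s j : Set L) ⊆ LieSubmodule.lieSpan F (sp I F) {y} := by
    intro j
    obtain ⟨φ', f, hf⟩ := hs j
    exact (exists_generator (o₁ := o₁) (o₂ := o₂) hI₀ ha hM hc₀ θ hcθ (htor (Sum.inr (Sum.inl j)))
      (hspS₀.eq_bot_or_eq_top ha₀ (Or.inr (Or.inl rfl))) φ' f
      fun x m => Subtype.ext (hf x m)).2.1 rfl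
  have Hv : ∀ t, ∃ y ∈ wtSpace (spTorus F I) L (Pi.single i₁ 1), y ≠ 0 ∧ IsHW F ht y ∧ y ∈ v t ∧
      (v t : Set L) ⊆ LieSubmodule.lieSpan F (sp I F) {y} := by
    intro t
    obtain ⟨φ', f, hf⟩ := hv t
    exact (exists_generator (P := spV I₀ F) (o₁ := o₁) (o₂ := o₂) hI₀ ha hM hc₀ θ hcθ
      (htor (Sum.inr (Sum.inr (Sum.inl t))))
      (hspV₀.eq_bot_or_eq_top ha₀ (Or.inr (Or.inr rfl))) φ' f hf).2.2 rfl
  choose yg hyg hyg0 hyghw hygN hygle using Hg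
  choose ys hys hys0 hyshw hysN hysle using Hs
  choose yv hyv hyv0 hyvhw hyvN hyvle using Hv
  let x : A₀ ⊕ (B₀ ⊕ C₀) → L := Sum.elim yg (Sum.elim ys yv)
  let lam : A₀ ⊕ (B₀ ⊕ C₀) → I → ℤ := Sum.elim (fun _ => Pi.single i₁ 2)
    (Sum.elim (fun _ => Pi.single i₁ 1 + Pi.single i₂ 1) fun _ => Pi.single i₁ 1)
  have hlam : ∀ k, IsDom i₁ i₂ (lam k) := by
    rintro (i | j | t)
    exacts [Or.inl rfl, Or.inr (Or.inl rfl), Or.inr (Or.inr rfl)]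
  have hx : ∀ k, x k ∈ wtSpace (spTorus F I) L (lam k) := by
    rintro (i | j | t)
    exacts [hyg i, hys j, hyv t]
  have hhw : ∀ k, IsHW F ht (x k) := by
    rintro (i | j | t)
    exacts [hyghw i, hyshw j, hyvhw t]
  have hx0 : ∀ k, x k ≠ 0 := by
    rintro (i | j | t)
    exacts [hyg0 i, hys0 j, hyv0 t]
  -- The vectors are nonzero members of distinct summands of a direct sum.
  have hlin : LinearIndependent F x := by
    let r : A₀ ⊕ (B₀ ⊕ C₀) → A₀ ⊕ (B₀ ⊕ (C₀ ⊕ Unit)) :=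
      Sum.map id (Sum.map id Sum.inl)
    have hr : Function.Injective r :=
      Function.injective_id.sumMap (Function.injective_id.sumMap Sum.inl_injective)
    refine ((LieSubmodule.iSupIndep_toSubmodule.2 hind).comp hr).linearIndependent _ ?_ hx0
    rintro (i | j | t)
    exacts [hygN i, hysN j, hyvN t]
  set N : LieSubmodule F (sp I F) L := ⨆ k, LieSubmodule.lieSpan F (sp I F) {x k} with hNdef
  have hxN : ∀ k, LieSubmodule.lieSpan F (sp I F) {x k} ≤ N := fun k =>
    le_iSup (fun k => LieSubmodule.lieSpan F (sp I F) {x k}) k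
  -- It suffices to treat weights supported in `I₀`, whose weight spaces lie in `L^S`.
  have hN : ∀ μ ≠ 0, ∀ m ∈ wtSpace (spTorus F I) L μ, m ∈ N := by
    refine wtSpace_le_of_support hM I₀ (by omega) N fun μ hμ hμ' m hm => ?_
    by_cases hm0 : m = 0
    · rw [hm0]; exact N.zero_mem
    obtain ⟨i, hi⟩ := Function.ne_iff.1 hμ
    have hiI : i ∈ I₀ := by
      by_contra h
      exact hi (hμ' i h)
    have hmS := mem_gradedPart hε hμ hμ' (mem_weightsBC.1 (hM.mem_of_ne_zero hm hm0))
      ((mem_wtSpace_iff_mem_rootSub he hφ hc).1 hm)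
    -- All summands of `L^S` except `E` lie in `N`, and `E` is killed by the torus element of index
    -- `i`. So this element maps `L^S` into `N`, while on `m` it is multiplication by `μ i ≠ 0`.
    have hle : gradedPart 𝔥 (rootsBC fun i : I₀ => ε i) ≤
        lieComap (spX F (Sum.inl i) (Sum.inl i) : sp I F) N.toSubmodule := by
      rw [← hsup]
      refine iSup_le ?_
      rintro (k | k | k | _) z hz
      · exact N.lie_mem (hxN (Sum.inl k) (hygle k hz))
      · exact N.lie_mem (hxN (Sum.inr (Sum.inl k)) (hysle k hz))
      · exact N.lie_mem (hxN (Sum.inr (Sum.inr k)) (hyvle k hz))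
      · change ⁅(spX F (Sum.inl i) (Sum.inl i) : sp I F), z⁆ ∈ N
        have h1 : ψ (spX F (Sum.inl ⟨i, hiI⟩) (Sum.inl ⟨i, hiI⟩)) =
          spX F (Sum.inl i) (Sum.inl i) := spEmb_spX _ _ _ _
        have h2 := congrArg Subtype.val (hE.trivial
          (θ (spX F (Sum.inl ⟨i, hiI⟩) (Sum.inl ⟨i, hiI⟩))) ⟨z, hz⟩)
        change ⁅θ (spX F (Sum.inl ⟨i, hiI⟩) (Sum.inl ⟨i, hiI⟩)), z⁆ = 0 at h2
        rw [← h1, ← hc₀, hcθ, h2]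
        exact N.zero_mem
    have h1 : ⁅(spX F (Sum.inl i) (Sum.inl i) : sp I F), m⁆ ∈ N := hle hmS
    rw [lie_spX_self hm, pr_inl] at h1
    exact (N.toSubmodule.smul_mem_iff (Int.cast_ne_zero.2 hi)).1 h1
  -- the submodules over `𝔤`
  let Φ : LieSubmodule F (sp I F) L → LieSubmodule F 𝔤 L :=
    pullSubmodule (φ : 𝔤 →ₗ⁅F⁆ sp I F) hcφ
  -- A set containing `y` and contained in the module generated by `y` generates that same module.
  have hgen : ∀ (y : L) (Y : Set L), y ∈ Y → Y ⊆ LieSubmodule.lieSpan F (sp I F) {y} →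
      Y ⊆ Φ (LieSubmodule.lieSpan F (sp I F) {y}) ∧
        LieSubmodule.lieSpan F 𝔤 Y = Φ (LieSubmodule.lieSpan F (sp I F) {y}) := by
    intro y Y hy hY
    refine ⟨hY, ?_⟩
    rw [lieSpan_eq_pullSubmodule φ hcφ]
    have : LieSubmodule.lieSpan F (sp I F) Y = LieSubmodule.lieSpan F (sp I F) {y} :=
      le_antisymm (LieSubmodule.lieSpan_le.2 hY)
        (LieSubmodule.lieSpan_le.2 (by
          rw [Set.singleton_subset_iff]
          exact LieSubmodule.subset_lieSpan hy))
    rw [this]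
  -- The given index sets suffice, up to the universe, and the trivial summand is the kernel of the
  -- Casimir operator.
  refine ⟨φ, ULift.{uL} A₀, ULift.{uL} B₀, ULift.{uL} C₀, ⟨ULift.up, ULift.up_injective⟩,
    ⟨ULift.up, ULift.up_injective⟩, ⟨ULift.up, ULift.up_injective⟩,
    fun i => Φ (LieSubmodule.lieSpan F (sp I F) {yg i.down}),
    fun j => Φ (LieSubmodule.lieSpan F (sp I F) {ys j.down}),
    fun t => Φ (LieSubmodule.lieSpan F (sp I F) {yv t.down}),
    Φ (casimirEigen F I L 0), ?_, ?_, ?_, ?_, ?_, fun i => hgen _ _ (hygN i) (hygle i),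
    fun j => hgen _ _ (hysN j) (hysle j), fun t => hgen _ _ (hyvN t) (hyvle t), ?_⟩
  · intro h hh
    have h1 : h = gTorus hL.le e (e ⟨h, hh⟩) :=
      Subtype.ext (by rw [coe_gTorus, e.symm_apply_apply])
    have h2 : φ h = spTorus F I (e ⟨h, hh⟩) := by
      rw [← hφ, ← h1]
    rw [h2, coe_spTorus]
    congr 1
    funext p
    rcases p with i | i
    · exact he _ i
    · exact congrArg Neg.neg (he _ i)
  · intro i
    obtain ⟨d⟩ := hsp.nonempty_equiv ha (Or.inl rfl) hM (hyg i.down) (hyg0 _) (hyghw _)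
    obtain ⟨f, hf⟩ := exists_equiv_pullSubmodule (φ : 𝔤 →ₗ⁅F⁆ sp I F) hcφ d
    refine ⟨f.symm.finiteDimensional,
      isIrreducible_of_equiv φ f hf (hsp.eq_bot_or_eq_top ha (Or.inl rfl)), ⟨?_⟩⟩
    refine { f.trans φ.symm.toLinearEquiv with map_lie' := ?_ }
    intro y m
    change φ.symm (f ⁅y, m⁆) = ⁅y, φ.symm (f m)⁆
    rw [hf]
    change φ.symm ⁅φ y, f m⁆ = _
    rw [LieEquiv.map_lie, LieEquiv.symm_apply_apply]
  · intro j
    obtain ⟨d⟩ := hspS.nonempty_equiv ha (Or.inr (Or.inl rfl)) hM (hys j.down) (hys0 _) (hyshw _)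
    obtain ⟨f, hf⟩ := exists_equiv_pullSubmodule (φ : 𝔤 →ₗ⁅F⁆ sp I F) hcφ d
    exact ⟨f.symm.finiteDimensional,
      isIrreducible_of_equiv φ f hf (hspS.eq_bot_or_eq_top ha (Or.inr (Or.inl rfl))),
      f, fun y m => congrArg Subtype.val (hf y m)⟩
  · intro t
    obtain ⟨d⟩ := hspV.nonempty_equiv ha (Or.inr (Or.inr rfl)) hM (hyv t.down) (hyv0 _) (hyvhw _)
    obtain ⟨f, hf⟩ := exists_equiv_pullSubmodule (φ : 𝔤 →ₗ⁅F⁆ sp I F) hcφ d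
    exact ⟨f.symm.finiteDimensional,
      isIrreducible_of_equiv φ f hf (hspV.eq_bot_or_eq_top ha (Or.inr (Or.inr rfl))), f, hf⟩
  · refine ⟨fun y m => Subtype.ext ?_⟩
    change ⁅y, (m : L)⁆ = 0
    rw [hcφ]
    exact casimirEigen_zero_trivial ha hM hlam hx hhw hlin hN (φ y) m.2
  · let r : ULift.{uL} A₀ ⊕ (ULift.{uL} B₀ ⊕ (ULift.{uL} C₀ ⊕ Unit)) ≃
        (A₀ ⊕ (B₀ ⊕ C₀)) ⊕ Unit :=
      (Equiv.sumCongr Equiv.ulift (Equiv.sumCongr Equiv.ulift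
        (Equiv.sumCongr Equiv.ulift (Equiv.refl Unit)))).trans
        ((Equiv.sumCongr (Equiv.refl A₀) (Equiv.sumAssoc B₀ C₀ Unit).symm).trans
          (Equiv.sumAssoc A₀ (B₀ ⊕ C₀) Unit).symm)
    have hr : (fun k => (Sum.elim
        (fun i : ULift.{uL} A₀ => Φ (LieSubmodule.lieSpan F (sp I F) {yg i.down}))
        (Sum.elim (fun j : ULift.{uL} B₀ => Φ (LieSubmodule.lieSpan F (sp I F) {ys j.down}))
        (Sum.elim (fun t : ULift.{uL} C₀ => Φ (LieSubmodule.lieSpan F (sp I F) {yv t.down}))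
          fun _ : Unit => Φ (casimirEigen F I L 0))) k).toSubmodule) =
        (Sum.elim (fun k => (LieSubmodule.lieSpan F (sp I F) {x k}).toSubmodule)
          fun _ : Unit => (casimirEigen F I L 0).toSubmodule) ∘ r := by
      funext k
      rcases k with i | j | t | _ <;> rfl
    constructor
    · rw [← LieSubmodule.iSupIndep_toSubmodule, hr]
      exact (iSupIndep_lieSpan ha hM hlam hx hhw hlin).comp r.injective
    · rw [LieSubmodule.iSup_toSubmodule, hr]
      exact (r.iSup_comp (g := Sum.elim
        (fun k => (LieSubmodule.lieSpan F (sp I F) {x k}).toSubmodule)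
          fun _ : Unit => (casimirEigen F I L 0).toSubmodule)).trans
        (iSup_lieSpan_eq_top ha hM hlam hx hhw hN)
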